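/- Let $P_4$ be the path with four vertices $v_1,v_2,v_3,v_4$, and let \[ A(P_4)=\langle v_1,v_2,v_3,v_4 \mid [v_1,v_2]=[v_2,v_3]=[v_3,v_4]=1\rangle \] be the right-angled Artin group on $P_4$. Let $M$ be a compact (possibly disconnected, possibly with boundary) smooth oriented one-manifold, and let $\mathrm{Diff}^{1+\mathrm{bv}}_+(M)$ be the group of orientation-preserving $C^1$ diffeomorphisms of $M$ whose first derivatives have bounded variation. Then $A(P_4)$ does not virtually embed into $\mathrm{Diff}^{1+\mathrm{bv}}_+(M)$: for every finite index subgroup $K\le A(P_4)$, there is no injective homomorphism $K\to \mathrm{Diff}^{1+\mathrm{bv}}_+(M)$. -/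

import Mathlib

open Set Filter Topology
open scoped Manifold ContDiff

/-- The right-angled Artin group `A(Γ)` of a simplicial graph `Γ`: one generator for each vertex,
and the relation `[v, w] = 1` for each edge `{v, w}`. -/
abbrev RightAngledArtinGroup {V : Type*} (Γ : SimpleGraph V) : Type _ :=
  PresentedGroup {r : FreeGroup V | ∃ v w, Γ.Adj v w ∧
    r = (FreeGroup.of v)⁻¹ * (FreeGroup.of w)⁻¹ * FreeGroup.of v * FreeGroup.of w}

/-- The group `H` virtually embeds into the group `G`: some subgroup of finite index of `H`
admits an injective homomorphism into `G`. -/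
def VirtuallyEmbeds (H G : Type*) [Group H] [Group G] : Prop :=
  ∃ K : Subgroup H, K.FiniteIndex ∧ ∃ φ : K →* G, Function.Injective φ

namespace OneManifold

/-! Auxiliary facts on real functions, used to show that bounded variation of the derivative is
stable under composition and inversion. -/

theorem exists_monotone_nhd {S : Set ℝ} (hS : Convex ℝ S) (hu : UniqueDiffOn ℝ S) {G : ℝ → ℝ}
    {a : ℝ} (ha : a ∈ S) (hG : ContDiffWithinAt ℝ 1 G S a) (hG' : derivWithin G S a ≠ 0) :
    ∃ U ∈ 𝓝[S] a, MonotoneOn G U ∨ AntitoneOn G U := by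
  wlog hpos : 0 < derivWithin G S a generalizing G
  · have hneg : 0 < derivWithin (-G) S a := by
      rw [derivWithin.neg]
      have := lt_of_le_of_ne (not_lt.mp hpos) hG'
      linarith
    obtain ⟨U, hU, h⟩ := this hG.neg hneg.ne' hneg
    refine ⟨U, hU, ?_⟩
    rcases h with h | h
    · right; simpa using h.neg
    · left; simpa using h.neg
  have hc : ContinuousWithinAt (derivWithin G S) S a := by
    have := hG.continuousWithinAt_fderivWithin hu one_ne_zero ha
    exact this.clm_apply continuousWithinAt_const
  have h1 : ∀ᶠ z in 𝓝[S] a, ContDiffWithinAt ℝ 1 G S z := by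
    have := hG.eventually (by simp)
    rwa [insert_eq_of_mem ha] at this
  have h2 : ∀ᶠ z in 𝓝[S] a, 0 < derivWithin G S z := hc.eventually (lt_mem_nhds hpos)
  obtain ⟨ε, hε, hb⟩ := Metric.mem_nhdsWithin_iff.mp (h1.and h2)
  refine ⟨Metric.ball a ε ∩ S, inter_mem (mem_nhdsWithin_of_mem_nhds (Metric.ball_mem_nhds a hε))
    self_mem_nhdsWithin, Or.inl ?_⟩
  have hi : ∀ z ∈ interior (Metric.ball a ε ∩ S), S ∈ 𝓝 z := fun z hz =>
    mem_interior_iff_mem_nhds.mp (interior_mono inter_subset_right hz)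
  refine monotoneOn_of_deriv_nonneg ((convex_ball a ε).inter hS) ?_ ?_ ?_
  · exact fun z hz => (hb hz).1.continuousWithinAt.mono inter_subset_right
  · intro z hz
    exact (((hb (interior_subset hz)).1.contDiffAt (hi z hz)).differentiableAt
      one_ne_zero).differentiableWithinAt
  · intro z hz
    rw [← derivWithin_of_mem_nhds (hi z hz)]
    exact (hb (interior_subset hz)).2.le

theorem bv_comp_nhd {S : Set ℝ} (hS : Convex ℝ S) (hu : UniqueDiffOn ℝ S) {G p : ℝ → ℝ}
    {a : ℝ} (ha : a ∈ S) (hG : ContDiffWithinAt ℝ 1 G S a) (hG' : derivWithin G S a ≠ 0)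
    (hm : ∀ z, G z ∈ S) {V : Set ℝ} (hV : V ∈ 𝓝[S] (G a)) (hp : BoundedVariationOn p V) :
    ∃ U ∈ 𝓝[S] a, BoundedVariationOn (p ∘ G) U := by
  obtain ⟨U, hU, h⟩ := exists_monotone_nhd hS hu ha hG hG'
  have ht : Tendsto G (𝓝[S] a) (𝓝[S] (G a)) :=
    tendsto_nhdsWithin_iff.mpr ⟨hG.continuousWithinAt, Eventually.of_forall hm⟩
  refine ⟨U ∩ G ⁻¹' V, inter_mem hU (ht hV), ?_⟩
  refine ne_top_of_le_ne_top hp ?_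
  rcases h with h | h
  · exact eVariationOn.comp_le_of_monotoneOn p G (h.mono inter_subset_left) fun z hz => hz.2
  · exact eVariationOn.comp_le_of_antitoneOn p G (h.mono inter_subset_left) fun z hz => hz.2

theorem eventually_derivWithin_comp {S : Set ℝ} {F G K : ℝ → ℝ}
    {a : ℝ} (ha : a ∈ S) (hG : ContDiffWithinAt ℝ 1 G S a) (hm : ∀ z, G z ∈ S)
    (hF : ContDiffWithinAt ℝ 1 F S (G a)) (hK : K =ᶠ[𝓝[S] a] F ∘ G) :
    ∀ᶠ z in 𝓝[S] a, derivWithin K S z = derivWithin F S (G z) * derivWithin G S z := by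
  have ht : Tendsto G (𝓝[S] a) (𝓝[S] (G a)) :=
    tendsto_nhdsWithin_iff.mpr ⟨hG.continuousWithinAt, Eventually.of_forall hm⟩
  have h1 : ∀ᶠ z in 𝓝[S] a, ContDiffWithinAt ℝ 1 G S z := by
    have := hG.eventually (by simp)
    rwa [insert_eq_of_mem ha] at this
  have h2 : ∀ᶠ z in 𝓝[S] (G a), ContDiffWithinAt ℝ 1 F S z := by
    have := hF.eventually (by simp)
    rwa [insert_eq_of_mem (hm a)] at this
  filter_upwards [h1, ht.eventually h2, eventually_eventually_nhdsWithin.mpr hK,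
    self_mem_nhdsWithin] with z hz1 hz2 hz3 hz4
  rw [Filter.EventuallyEq.derivWithin_eq_of_mem hz3 hz4]
  exact derivWithin_comp z (hz2.differentiableWithinAt one_ne_zero)
    (hz1.differentiableWithinAt one_ne_zero) (fun y _ => hm y)

theorem bv_deriv_comp {S : Set ℝ} (hS : Convex ℝ S) (hu : UniqueDiffOn ℝ S) {F G K : ℝ → ℝ}
    {a : ℝ} (ha : a ∈ S) (hG : ContDiffWithinAt ℝ 1 G S a) (hm : ∀ z, G z ∈ S)
    (hF : ContDiffWithinAt ℝ 1 F S (G a)) (hK : K =ᶠ[𝓝[S] a] F ∘ G)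
    (hG' : derivWithin G S a ≠ 0)
    (bF : ∃ V ∈ 𝓝[S] (G a), BoundedVariationOn (derivWithin F S) V)
    (bG : ∃ V ∈ 𝓝[S] a, BoundedVariationOn (derivWithin G S) V) :
    ∃ U ∈ 𝓝[S] a, BoundedVariationOn (derivWithin K S) U := by
  obtain ⟨V, hV, bF⟩ := bF
  obtain ⟨W, hW, bG⟩ := bG
  obtain ⟨U, hU, h⟩ := bv_comp_nhd hS hu ha hG hG' hm hV bF
  have hd := eventually_derivWithin_comp ha hG hm hF hK
  refine ⟨U ∩ W ∩ {z | derivWithin K S z = derivWithin F S (G z) * derivWithin G S z},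
    inter_mem (inter_mem hU hW) hd, ?_⟩
  set T := U ∩ W ∩ {z | derivWithin K S z = derivWithin F S (G z) * derivWithin G S z}
  have hTU : T ⊆ U := inter_subset_left.trans inter_subset_left
  have hTW : T ⊆ W := inter_subset_left.trans inter_subset_right
  have := (h.mono hTU).mul (bG.mono hTW)
  rw [BoundedVariationOn, eVariationOn.congr (g := (derivWithin F S ∘ G) * derivWithin G S)]
  · exact this
  · exact fun z hz => hz.2

theorem bv_deriv_inv {S : Set ℝ} (hS : Convex ℝ S) (hu : UniqueDiffOn ℝ S) {F G : ℝ → ℝ}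
    {a : ℝ} (ha : a ∈ S) (hG : ContDiffWithinAt ℝ 1 G S a) (hm : ∀ z, G z ∈ S)
    (hF : ContDiffWithinAt ℝ 1 F S (G a)) (hK : id =ᶠ[𝓝[S] a] F ∘ G)
    (bF : ∃ V ∈ 𝓝[S] (G a), BoundedVariationOn (derivWithin F S) V) :
    ∃ U ∈ 𝓝[S] a, BoundedVariationOn (derivWithin G S) U := by
  obtain ⟨V, hV, bF⟩ := bF
  have hd : ∀ᶠ z in 𝓝[S] a, derivWithin F S (G z) * derivWithin G S z = 1 := by
    filter_upwards [eventually_derivWithin_comp ha hG hm hF hK, self_mem_nhdsWithin]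
      with z hz hzS
    rw [← hz, derivWithin_id _ _ (hu z hzS)]
  have hda := hd.self_of_nhdsWithin ha
  obtain ⟨U, hU, h⟩ := bv_comp_nhd hS hu ha hG (right_ne_zero_of_mul_eq_one hda) hm hV bF
  have hc : ContinuousWithinAt (derivWithin G S) S a :=
    (hG.continuousWithinAt_fderivWithin hu one_ne_zero ha).clm_apply continuousWithinAt_const
  set C := |derivWithin G S a| + 1 with hC
  have hC0 : 0 ≤ C := by positivity
  have hb : ∀ᶠ z in 𝓝[S] a, |derivWithin G S z| < C :=
    hc.abs.eventually (gt_mem_nhds (lt_add_one _))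
  refine ⟨U ∩ {z | derivWithin F S (G z) * derivWithin G S z = 1 ∧ |derivWithin G S z| < C},
    inter_mem hU (hd.and hb), ?_⟩
  set T := U ∩ {z | derivWithin F S (G z) * derivWithin G S z = 1 ∧ |derivWithin G S z| < C}
  have hL : LipschitzOnWith (Real.toNNReal (C * C)) (fun t : ℝ => t⁻¹)
      {t : ℝ | t ≠ 0 ∧ |t⁻¹| ≤ C} := by
    refine LipschitzOnWith.of_dist_le_mul ?_
    rintro x ⟨hx, hxC⟩ y ⟨hy, hyC⟩
    rw [Real.coe_toNNReal _ (by positivity), Real.dist_eq, Real.dist_eq,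
      show x⁻¹ - y⁻¹ = (x⁻¹ * y⁻¹) * (y - x) by field_simp, abs_mul, abs_mul, abs_sub_comm y x]
    gcongr
  have hi : EqOn (derivWithin G S) ((fun t : ℝ => t⁻¹) ∘ (derivWithin F S ∘ G)) T := fun z hz =>
    eq_inv_of_mul_eq_one_right hz.2.1
  rw [BoundedVariationOn, eVariationOn.congr hi]
  refine hL.comp_boundedVariationOn ?_ (h.mono inter_subset_left)
  intro z hz
  refine ⟨left_ne_zero_of_mul_eq_one hz.2.1, ?_⟩
  have := hi hz
  simp only [Function.comp_apply] at this ⊢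
  rw [← this]
  exact hz.2.2.le

section Manifold

variable {H : Type*} [TopologicalSpace H] (I : ModelWithCorners ℝ ℝ H)
  (M : Type*) [TopologicalSpace M] [ChartedSpace H M]

/-- The `C^1` diffeomorphisms of a manifold form a group under composition. -/
noncomputable instance diffeomorphGroup : Group (M ≃ₘ^1⟮I, I⟯ M) where
  mul f g := g.trans f
  one := Diffeomorph.refl I M 1
  inv f := f.symm
  mul_assoc _ _ _ := rfl
  one_mul _ := Diffeomorph.ext fun _ => rfl
  mul_one _ := Diffeomorph.ext fun _ => rfl
  inv_mul_cancel f := Diffeomorph.ext fun x => f.symm_apply_apply x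

/-- An orientation of a one-manifold: an orientation of each tangent line, locally constant in the
local trivializations of the tangent bundle. -/
structure ManifoldOrientation [IsManifold I 1 M] where
  /-- The orientation of the tangent line at each point. -/
  at_point : ∀ x : M, Orientation ℝ (TangentSpace I x) (Fin 1)
  locally_constant : ∀ x₀ : M, ∃ o : Orientation ℝ ℝ (Fin 1), ∀ᶠ x in 𝓝 x₀,
    ∀ hx : x ∈ (trivializationAt ℝ (TangentSpace I) x₀).baseSet,
      Orientation.map (Fin 1)
        ((trivializationAt ℝ (TangentSpace I) x₀).linearEquivAt ℝ x hx) (at_point x) = o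

variable {I M}

/-- The diffeomorphism `f` preserves the orientation `o`: its differential maps the orientation of
the tangent line at `x` to the orientation of the tangent line at `f x`, for each `x`. -/
def PreservesOrientation [IsManifold I 1 M] (o : ManifoldOrientation I M)
    (f : M ≃ₘ^1⟮I, I⟯ M) : Prop :=
  ∀ x : M, Orientation.map (Fin 1)
    (f.mfderivToContinuousLinearEquiv one_ne_zero x).toLinearEquiv (o.at_point x) =
      o.at_point (f x)

variable (I) in
/-- The first derivative of `f` has bounded variation locally: the derivative of `f` read in the
charts at `x` and `f x` has bounded variation near `x`, for each `x`. On a compact one-manifold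
this says that the first derivative of `f` has finite total variation. -/
def HasBVDerivative (f : M → M) : Prop :=
  ∀ x : M, ∃ U ∈ 𝓝[range I] (extChartAt I x x),
    BoundedVariationOn (derivWithin (writtenInExtChartAt I I x f) (range I)) U

theorem writtenInExtChartAt_mem_range (f : M → M) (x : M) (z : ℝ) :
    writtenInExtChartAt I I x f z ∈ range I := ⟨_, rfl⟩

theorem extChartAt_self_mem_range (x : M) : extChartAt I x x ∈ range I := ⟨_, rfl⟩

theorem writtenInExtChartAt_self (f : M → M) (x : M) :
    writtenInExtChartAt I I x f (extChartAt I x x) = extChartAt I (f x) (f x) := by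
  simp

theorem contDiffWithinAt_written (f : M ≃ₘ^1⟮I, I⟯ M) (x : M) :
    ContDiffWithinAt ℝ 1 (writtenInExtChartAt I I x f) (range I) (extChartAt I x x) :=
  (contMDiffAt_iff.mp (f.contMDiff x)).2

theorem written_comp (f g : M ≃ₘ^1⟮I, I⟯ M) (x : M) :
    writtenInExtChartAt I I x (f ∘ g) =ᶠ[𝓝[range I] (extChartAt I x x)]
      writtenInExtChartAt I I (g x) f ∘ writtenInExtChartAt I I x g := by
  have := writtenInExtChartAt_comp (I := I) (I' := I) (I'' := I) (g := f) (f := g) (s := univ)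
    (x := x) g.continuous.continuousAt.continuousWithinAt
  simpa using this

theorem written_id (x : M) :
    id =ᶠ[𝓝[range I] (extChartAt I x x)] writtenInExtChartAt I I x (id : M → M) := by
  filter_upwards [extChartAt_target_mem_nhdsWithin (I := I) x] with z hz
  exact ((extChartAt I x).right_inv hz).symm

theorem written_inv (f : M ≃ₘ^1⟮I, I⟯ M) (x : M) :
    id =ᶠ[𝓝[range I] (extChartAt I x x)]
      writtenInExtChartAt I I (f.symm x) f ∘ writtenInExtChartAt I I x f.symm := by
  have h : (f ∘ f.symm : M → M) = id := funext f.apply_symm_apply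
  have := written_comp f f.symm x
  rw [h] at this
  exact (written_id x).trans this

theorem derivWithin_written_ne_zero (f : M ≃ₘ^1⟮I, I⟯ M) (x : M) :
    derivWithin (writtenInExtChartAt I I x f) (range I) (extChartAt I x x) ≠ 0 := by
  have hF : ContDiffWithinAt ℝ 1 (writtenInExtChartAt I I (f x) f.symm) (range I)
      (writtenInExtChartAt I I x f (extChartAt I x x)) := by
    rw [writtenInExtChartAt_self]
    exact contDiffWithinAt_written f.symm (f x)
  have h := (eventually_derivWithin_comp (extChartAt_self_mem_range x)
    (contDiffWithinAt_written f x) (writtenInExtChartAt_mem_range f x) hF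
    (written_inv f.symm x)).self_of_nhdsWithin (extChartAt_self_mem_range x)
  rw [derivWithin_id _ _ (I.uniqueDiffOn _ (extChartAt_self_mem_range x))] at h
  exact right_ne_zero_of_mul_eq_one h.symm

theorem HasBVDerivative.one : HasBVDerivative I ((1 : M ≃ₘ^1⟮I, I⟯ M) : M → M) := by
  intro x
  refine ⟨{z | derivWithin (writtenInExtChartAt I I x (id : M → M)) (range I) z = 1}, ?_, ?_⟩
  · filter_upwards [eventually_eventually_nhdsWithin.mpr (written_id (I := I) x),
      self_mem_nhdsWithin] with z hz hzS
    have := Filter.EventuallyEq.derivWithin_eq_of_mem hz hzS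
    rw [derivWithin_id _ _ (I.uniqueDiffOn z hzS)] at this
    exact this.symm
  · refine ne_top_of_le_ne_top ENNReal.zero_ne_top (le_of_eq ?_)
    refine eVariationOn.constant_on ?_
    rintro _ ⟨y, hy, rfl⟩ _ ⟨z, hz, rfl⟩
    exact hy.trans hz.symm

theorem HasBVDerivative.mul {f g : M ≃ₘ^1⟮I, I⟯ M} (hf : HasBVDerivative I f)
    (hg : HasBVDerivative I g) : HasBVDerivative I (f * g : M ≃ₘ^1⟮I, I⟯ M) := by
  intro x
  refine bv_deriv_comp (F := writtenInExtChartAt I I (g x) f) I.convex_range I.uniqueDiffOn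
    (extChartAt_self_mem_range x) (contDiffWithinAt_written g x)
    (writtenInExtChartAt_mem_range g x) ?_ (written_comp f g x)
    (derivWithin_written_ne_zero g x) ?_ (hg x)
  · rw [writtenInExtChartAt_self]
    exact contDiffWithinAt_written f (g x)
  · rw [writtenInExtChartAt_self]
    exact hf (g x)

theorem HasBVDerivative.inv {f : M ≃ₘ^1⟮I, I⟯ M} (hf : HasBVDerivative I f) :
    HasBVDerivative I (f⁻¹ : M ≃ₘ^1⟮I, I⟯ M) := by
  intro x
  refine bv_deriv_inv (F := writtenInExtChartAt I I (f.symm x) f) I.convex_range I.uniqueDiffOn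
    (extChartAt_self_mem_range x) (contDiffWithinAt_written f.symm x)
    (writtenInExtChartAt_mem_range f.symm x) ?_ (written_inv f x) ?_
  · rw [writtenInExtChartAt_self]
    exact contDiffWithinAt_written f (f.symm x)
  · rw [writtenInExtChartAt_self]
    exact hf (f.symm x)

theorem orientation_map_trans {E₁ E₂ E₃ : Type*} [AddCommGroup E₁] [Module ℝ E₁]
    [AddCommGroup E₂] [Module ℝ E₂] [AddCommGroup E₃] [Module ℝ E₃] (e : E₁ ≃ₗ[ℝ] E₂)
    (e' : E₂ ≃ₗ[ℝ] E₃) (o : Orientation ℝ E₁ (Fin 1)) :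
    Orientation.map (Fin 1) (e.trans e') o =
      Orientation.map (Fin 1) e' (Orientation.map (Fin 1) e o) := by
  induction o using Module.Ray.ind with
  | h v hv => rfl

theorem mfderiv_equiv_mul [IsManifold I 1 M] (f g : M ≃ₘ^1⟮I, I⟯ M) (x : M) :
    ((f * g).mfderivToContinuousLinearEquiv one_ne_zero x).toLinearEquiv =
      (g.mfderivToContinuousLinearEquiv one_ne_zero x).toLinearEquiv.trans
        (f.mfderivToContinuousLinearEquiv one_ne_zero (g x)).toLinearEquiv := by
  ext v
  exact DFunLike.congr_fun (mfderiv_comp x (f.mdifferentiable one_ne_zero (g x))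
    (g.mdifferentiable one_ne_zero x)) v

theorem map_orientation_mul [IsManifold I 1 M] (f g : M ≃ₘ^1⟮I, I⟯ M) (x : M)
    (o : Orientation ℝ (TangentSpace I x) (Fin 1)) :
    Orientation.map (Fin 1)
        ((f * g).mfderivToContinuousLinearEquiv one_ne_zero x).toLinearEquiv o =
      Orientation.map (Fin 1) (f.mfderivToContinuousLinearEquiv one_ne_zero (g x)).toLinearEquiv
        (Orientation.map (Fin 1)
          (g.mfderivToContinuousLinearEquiv one_ne_zero x).toLinearEquiv o) :=
  (DFunLike.congr_fun (congrArg (Orientation.map (Fin 1)) (mfderiv_equiv_mul f g x)) o).trans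
    (orientation_map_trans _ _ _)

theorem PreservesOrientation.one [IsManifold I 1 M] (o : ManifoldOrientation I M) :
    PreservesOrientation o (1 : M ≃ₘ^1⟮I, I⟯ M) := by
  intro x
  have h : ((1 : M ≃ₘ^1⟮I, I⟯ M).mfderivToContinuousLinearEquiv one_ne_zero x).toLinearEquiv =
      LinearEquiv.refl ℝ (TangentSpace I x) := by
    ext v
    exact DFunLike.congr_fun (mfderiv_id (I := I) (x := x)) v
  exact (DFunLike.congr_fun (congrArg (Orientation.map (Fin 1)) h) (o.at_point x)).trans
    (DFunLike.congr_fun (Orientation.map_refl (Fin 1)) (o.at_point x))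

theorem PreservesOrientation.mul [IsManifold I 1 M] {o : ManifoldOrientation I M}
    {f g : M ≃ₘ^1⟮I, I⟯ M} (hf : PreservesOrientation o f) (hg : PreservesOrientation o g) :
    PreservesOrientation o (f * g) := by
  intro x
  rw [map_orientation_mul, hg x, hf (g x)]
  rfl

theorem PreservesOrientation.inv [IsManifold I 1 M] {o : ManifoldOrientation I M}
    {f : M ≃ₘ^1⟮I, I⟯ M} (hf : PreservesOrientation o f) : PreservesOrientation o f⁻¹ := by
  intro x
  obtain ⟨y, rfl⟩ := f.surjective x
  have h : PreservesOrientation o (f⁻¹ * f) := by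
    rw [inv_mul_cancel]
    exact PreservesOrientation.one o
  have h' := h y
  rw [map_orientation_mul, hf y] at h'
  exact h'

/-- The group `Diff₊^{1+bv}(M)` of orientation-preserving `C^1` diffeomorphisms of the one-manifold
`M`, oriented by `o`, whose first derivatives have bounded variation. -/
def DiffBV [IsManifold I 1 M] (o : ManifoldOrientation I M) : Subgroup (M ≃ₘ^1⟮I, I⟯ M) where
  carrier := {f | PreservesOrientation o f ∧ HasBVDerivative I f}
  mul_mem' hf hg := ⟨hf.1.mul hg.1, hf.2.mul hg.2⟩
  one_mem' := ⟨PreservesOrientation.one o, HasBVDerivative.one⟩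
  inv_mem' hf := ⟨hf.1.inv, hf.2.inv⟩

end Manifold

end OneManifold

/-! Model the path group by `TwistTorus`, the extension of a free group of rank three by ℤ, and call
an element fibral (`IsFibral`) if its image there is a nontrivial element of the free fibre. A
homomorphism that kills a fibral element is not injective, so it is enough to find one that acts
trivially on M. Centralizers in free groups are cyclic. Hence commutators of noncommuting elements
are fibral, noncommuting conjugates are plentiful, and fibral elements killed on different
components of M combine by commutators (`exists_isFibral_forall_map_eq_one`).

On one component the generators, after passing to powers, lift to diffeomorphisms a, b, c, d of ℝ
that commute with a translation, satisfy the path relations and have derivatives of locally bounded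
variation. Further powers and translations make each of them either fix a point or be aperiodic.
`exists_pow_gap_eq` contains Kopell's lemma and Denjoy's theorem: a map with a fixed point preserves
every gap of a map commuting with it, and an aperiodic map commutes with no nontrivial map having a
fixed point. With Hölder's theorem this shows that w(d) = [d b d⁻¹, a⁻¹ c a] acts trivially if some
generator is aperiodic. Otherwise a point moved by w(d) produces a two-jump: overlapping gaps of a
and d, where a and d⁻¹ carry one point out of the overlap in opposite directions. Two-jumps cannot
accumulate at a fixed point of a, because a and d would have derivative 1 there, and maps that close
to translations cannot jump so far (`eventually_not_isTwoJump`).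

If w(d) acts nontrivially, the end s of such a two-jump is fixed by Γ = ⟨a, c, d⁻¹ b d⟩. The word
w(d⁻¹) lies in Γ and is the identity near every global fixed point of Γ. Modulo the translation its
support therefore meets finitely many components of the moved set of Γ. On each of them some element
of Γ pushes the support off itself, so a commutator with a conjugate is trivial there; repeating
this kills the action while staying fibral (`exists_isFibral_map_eq_one`).

Circles and intervals are lifted in the same way. A unit speed curve reflected at the boundary runs
periodically over its whole component, and the square of a diffeomorphism preserving the component
lifts to an increasing map of its parameter. The metric is induced by a smooth immersion, so that
the stretching factors have bounded variation. -/

/-! ### Centralizers in free groups -/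

namespace FreeGroup

/-- Prefix x by a generator l different from its first letter. The result is reduced; as it also
equals x l, its word is a sublist, of full length, of the word of x followed by l. The first letters
then disagree. -/
theorem eq_one_of_forall_commute_of {ι : Type*} {i j : ι} (hij : i ≠ j) {x : FreeGroup ι}
    (hx : ∀ k, Commute x (of k)) : x = 1 := by
  classical
  by_contra hne
  have hw : x.toWord ≠ [] := fun h => hne (toWord_eq_nil_iff.mp h)
  obtain ⟨⟨k, ε⟩, L, hL⟩ := List.exists_cons_of_ne_nil hw
  obtain ⟨l, hl⟩ : ∃ l, l ≠ k := by
    by_cases h : i = k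
    · exact ⟨j, fun h' => hij (h.trans h'.symm)⟩
    · exact ⟨i, h⟩
  have h1 : (of l * x).toWord = (l, true) :: x.toWord := by
    rw [toWord_mul, toWord_of]
    refine IsReduced.reduce_eq ?_
    have := isReduced_toWord (x := x)
    rw [hL] at this ⊢
    exact isReduced_cons_cons.mpr ⟨fun h => absurd h hl, this⟩
  have h2 := toWord_mul_sublist x (of l)
  rw [(hx l).eq, h1, toWord_of] at h2
  have h3 := h2.eq_of_length (by simp)
  rw [hL] at h3
  simp only [List.cons_append, List.cons.injEq, Prod.mk.injEq] at h3
  exact hl h3.1.1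

end FreeGroup

namespace IsFreeGroup

theorem exists_forall_mem_zpowers {G : Type*} [Group G] [IsFreeGroup G] {x : G} (hx : x ≠ 1)
    (hc : ∀ y, Commute x y) : ∃ g : G, ∀ y, y ∈ Subgroup.zpowers g := by
  have e := IsFreeGroup.toFreeGroup G
  by_cases hs : Subsingleton (IsFreeGroup.Generators G)
  · rcases isEmpty_or_nonempty (IsFreeGroup.Generators G) with h | ⟨⟨i⟩⟩
    · refine ⟨1, fun y => ?_⟩
      have : y = 1 := e.injective (Subsingleton.elim _ _)
      rw [this]
      exact one_mem _
    · refine ⟨e.symm (FreeGroup.of i), fun y => ?_⟩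
      obtain ⟨z, rfl⟩ := e.symm.surjective y
      induction z using FreeGroup.induction_on with
      | C1 => rw [map_one]; exact one_mem _
      | of j => rw [Subsingleton.elim j i]; exact Subgroup.mem_zpowers _
      | inv_of j h => rw [map_inv]; exact inv_mem h
      | mul a b ha hb => rw [map_mul]; exact mul_mem ha hb
  · rw [not_subsingleton_iff_nontrivial] at hs
    obtain ⟨i, j, hij⟩ := hs
    refine absurd (FreeGroup.eq_one_of_forall_commute_of hij (x := e x) fun k => ?_) ?_
    · have := (hc (e.symm (FreeGroup.of k))).map e.toMonoidHom
      simpa using this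
    · simpa using hx

end IsFreeGroup

namespace FreeGroup

variable {ι : Type*}

/-- The centralizer is free by Nielsen–Schreier and has x in its centre, so it is cyclic. -/
theorem exists_zpow_of_commute {x : FreeGroup ι} (hx : x ≠ 1) :
    ∃ g : FreeGroup ι, ∀ y, Commute x y ↔ y ∈ Subgroup.zpowers g := by
  have hmem : ∀ y, y ∈ Subgroup.centralizer {x} ↔ Commute x y := fun y => by
    rw [Subgroup.mem_centralizer_singleton_iff]
    exact ⟨fun h => h.symm, fun h => h.symm⟩
  obtain ⟨g, hg⟩ := IsFreeGroup.exists_forall_mem_zpowers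
    (G := Subgroup.centralizer {x}) (x := ⟨x, (hmem x).mpr (Commute.refl x)⟩)
    (fun h => hx (congrArg Subtype.val h))
    (fun y => Subtype.ext ((hmem y).mp y.2))
  refine ⟨g, fun y => ⟨fun h => ?_, ?_⟩⟩
  · obtain ⟨k, hk⟩ := hg ⟨y, (hmem y).mpr h⟩
    exact ⟨k, congrArg Subtype.val hk⟩
  · rintro ⟨k, rfl⟩
    exact ((hmem g).mp g.2).zpow_right k

theorem commute_trans {x y z : FreeGroup ι} (hx : x ≠ 1)
    (hy : Commute x y) (hz : Commute x z) : Commute y z := by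
  obtain ⟨g, hg⟩ := exists_zpow_of_commute hx
  obtain ⟨k, rfl⟩ := (hg y).mp hy
  obtain ⟨l, rfl⟩ := (hg z).mp hz
  exact Commute.zpow_zpow_self g k l

/-- Conjugation by p and by its inverse both map the centralizer ⟨g⟩ of w into itself, so p g p⁻¹ is
g or its inverse. Then p² commutes with g, and commuting is transitive through the nontrivial
element p². -/
theorem commute_of_commute_conj {w p : FreeGroup ι} (hw : w ≠ 1)
    (h : Commute w (p * w * p⁻¹)) : Commute w p := by
  obtain ⟨g, hg⟩ := exists_zpow_of_commute hw
  have hwg : Commute w g := (hg g).mpr (Subgroup.mem_zpowers g)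
  have key : ∀ q : FreeGroup ι, Commute w (q * w * q⁻¹) → ∃ k : ℤ, g ^ k = q * g * q⁻¹ := by
    intro q hq
    have h1 : Commute (q * w * q⁻¹) (q * g * q⁻¹) := by
      have := hwg.map (MulAut.conj q).toMonoidHom
      simpa using this
    exact (hg _).mp (commute_trans (by simpa using hw) hq.symm h1)
  have h' : Commute w (p⁻¹ * w * p⁻¹⁻¹) := by
    have := h.map (MulAut.conj p⁻¹).toMonoidHom
    simp only [MulEquiv.toMonoidHom_eq_coe, MonoidHom.coe_coe, MulAut.conj_apply] at this
    have h2 : p⁻¹ * (p * w * p⁻¹) * p⁻¹⁻¹ = w := by group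
    rw [h2] at this
    exact this.symm
  obtain ⟨k, hk⟩ := key p h
  obtain ⟨l, hl⟩ := key p⁻¹ h'
  have hg1 : g ≠ 1 := by
    rintro rfl
    obtain ⟨m, hm⟩ := (hg w).mp (Commute.refl w)
    exact hw (by simpa using hm.symm)
  have hkl : g ^ (k * l) = g ^ (1 : ℤ) := by
    rw [zpow_mul, hk, conj_zpow, hl]
    group
  have hkl' : k * l = 1 := by
    by_contra hne
    refine hg1 (zpow_left_injective (sub_ne_zero.mpr hne) ?_)
    simp only [one_zpow, zpow_sub, hkl]
    group
  have hp2 : Commute g (p * p) := by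
    have h1 : p * p * g * (p * p)⁻¹ = g := by
      have : p * (p * g * p⁻¹) * p⁻¹ = g := by
        rw [← hk, ← conj_zpow, ← hk, ← zpow_mul]
        rcases Int.eq_one_or_neg_one_of_mul_eq_one hkl' with rfl | rfl <;> simp
      calc p * p * g * (p * p)⁻¹ = p * (p * g * p⁻¹) * p⁻¹ := by group
        _ = g := this
    exact (mul_inv_eq_iff_eq_mul.mp h1).symm
  by_cases hp : p = 1
  · rw [hp]
    exact Commute.one_right w
  have hp2' : p * p ≠ 1 := fun h => hp (pow_left_injective two_ne_zero (by simpa [sq] using h))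
  have hwp2 : Commute w (p * p) := by
    obtain ⟨m, hm⟩ := (hg w).mp (Commute.refl w)
    rw [← hm]
    exact hp2.zpow_left m
  exact commute_trans hp2' hwp2.symm ((Commute.refl p).mul_left (Commute.refl p))

end FreeGroup

/-! ### The mapping torus that models the path group -/

/-- The automorphism of the free group on `x, y, z` fixing `x` and `y` and mapping `z` to
`y z y⁻¹`. -/
def twist : MulAut (FreeGroup (Fin 3)) :=
  MonoidHom.toMulEquiv
    (FreeGroup.lift ![FreeGroup.of 0, FreeGroup.of 1,
      FreeGroup.of 1 * FreeGroup.of 2 * (FreeGroup.of 1)⁻¹])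
    (FreeGroup.lift ![FreeGroup.of 0, FreeGroup.of 1,
      (FreeGroup.of 1)⁻¹ * FreeGroup.of 2 * FreeGroup.of 1])
    (by ext i; fin_cases i <;> simp [mul_assoc])
    (by ext i; fin_cases i <;> simp [mul_assoc])

/-- The mapping torus of `twist`; it is isomorphic to the right-angled Artin group on the path
with four vertices. -/
abbrev TwistTorus : Type := FreeGroup (Fin 3) ⋊[zpowersHom _ twist] Multiplicative ℤ

namespace TwistTorus

/-- The inclusion of the fibre. -/
abbrev fib : FreeGroup (Fin 3) →* TwistTorus := SemidirectProduct.inl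

/-- The stable letter. -/
abbrev stab : TwistTorus := SemidirectProduct.inr (Multiplicative.ofAdd 1)

theorem stab_conj (x : FreeGroup (Fin 3)) : stab * fib x * stab⁻¹ = fib (twist x) := by
  have := (SemidirectProduct.inl_aut (φ := zpowersHom _ twist) (Multiplicative.ofAdd 1) x).symm
  simpa using this

theorem mem_range_fib_conj {w : TwistTorus} (hw : w ∈ fib.range) (g : TwistTorus) :
    g * w * g⁻¹ ∈ fib.range := by
  rw [SemidirectProduct.range_inl_eq_ker_rightHom] at hw ⊢
  exact (MonoidHom.normal_ker _).conj_mem w hw g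

theorem commutator_mem_range_fib (g h : TwistTorus) : g * h * g⁻¹ * h⁻¹ ∈ fib.range := by
  rw [SemidirectProduct.range_inl_eq_ker_rightHom, MonoidHom.mem_ker]
  simp only [map_mul, map_inv]
  rw [mul_right_comm _ _ (_)⁻¹]
  simp

theorem commute_trans {x y z : TwistTorus} (hx : x ∈ fib.range) (hy : y ∈ fib.range)
    (hz : z ∈ fib.range) (hx1 : x ≠ 1) (hxy : Commute x y) (hxz : Commute x z) :
    Commute y z := by
  obtain ⟨x, rfl⟩ := hx
  obtain ⟨y, rfl⟩ := hy
  obtain ⟨z, rfl⟩ := hz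
  have hi : Function.Injective fib := SemidirectProduct.inl_injective
  have h1 : Commute x y := hi (by simpa using hxy.eq)
  have h2 : Commute x z := hi (by simpa using hxz.eq)
  exact (FreeGroup.commute_trans (fun h => hx1 (by rw [h, map_one])) h1 h2).map fib

/-- The elements conjugating `w` to an element commuting with `w`. -/
def conjStabilizer (w : TwistTorus) (hw : w ∈ fib.range) (hw1 : w ≠ 1) : Subgroup TwistTorus where
  carrier := {g | Commute w (g * w * g⁻¹)}
  one_mem' := by simp
  -- Both w and the conjugate of w by gh commute with the nontrivial fibre element g w g⁻¹.
  mul_mem' {g h} hg hh := by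
    have h1 : Commute (g * w * g⁻¹) (g * (h * w * h⁻¹) * g⁻¹) := by
      have := Commute.map hh (MulAut.conj g).toMonoidHom
      simpa using this
    have e : g * h * w * (g * h)⁻¹ = g * (h * w * h⁻¹) * g⁻¹ := by group
    change Commute w (g * h * w * (g * h)⁻¹)
    rw [e]
    exact commute_trans (mem_range_fib_conj hw g) hw
      (mem_range_fib_conj (mem_range_fib_conj hw h) g) (by simpa using hw1) hg.symm h1
  inv_mem' {g} hg := by
    have := Commute.map hg (MulAut.conj g⁻¹).toMonoidHom
    simp only [MulEquiv.toMonoidHom_eq_coe, MonoidHom.coe_coe, MulAut.conj_apply] at this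
    have h2 : g⁻¹ * (g * w * g⁻¹) * g⁻¹⁻¹ = w := by group
    rw [h2] at this
    exact this.symm

/-- In the fibre, commuting with a conjugate by r means commuting with r. Consequently, of two
noncommuting fibre elements at least one conjugates w to an element that does not commute with w. -/
theorem commute_of_mem_conjStabilizer {w : TwistTorus} (hw : w ∈ fib.range) (hw1 : w ≠ 1)
    {p q : TwistTorus} (hp : p ∈ fib.range) (hq : q ∈ fib.range)
    (hp' : p ∈ conjStabilizer w hw hw1) (hq' : q ∈ conjStabilizer w hw hw1) : Commute p q := by
  have key : ∀ r ∈ fib.range, r ∈ conjStabilizer w hw hw1 → Commute w r := by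
    intro r hr hr'
    have hr'' : Commute w (r * w * r⁻¹) := hr'
    obtain ⟨w, rfl⟩ := hw
    obtain ⟨r, rfl⟩ := hr
    have hi : Function.Injective fib := SemidirectProduct.inl_injective
    have h1 : Commute w (r * w * r⁻¹) := hi (by simpa using hr''.eq)
    exact (FreeGroup.commute_of_commute_conj (fun h => hw1 (by rw [h, map_one])) h1).map fib
  exact commute_trans hw hp hq hw1 (key p hp hp') (key q hq hq')

/-- The images of the standard generators of the right-angled Artin group on the path. -/
def gen : Fin 4 → TwistTorus :=
  ![fib (FreeGroup.of 0) * stab, stab, (fib (FreeGroup.of 1))⁻¹ * stab,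
    (fib (FreeGroup.of 2))⁻¹ * ((fib (FreeGroup.of 1))⁻¹ * stab)]

theorem commute_stab_of_twist {x : FreeGroup (Fin 3)} (h : twist x = x) :
    Commute stab (fib x) := by
  have := stab_conj x
  rw [h] at this
  exact mul_inv_eq_iff_eq_mul.mp this

theorem commute_stab_x : Commute stab (fib (FreeGroup.of 0)) :=
  commute_stab_of_twist (by simp [twist])

theorem commute_stab_y : Commute stab (fib (FreeGroup.of 1)) :=
  commute_stab_of_twist (by simp [twist])

/-- The stable letter conjugates z to y z y⁻¹, and y⁻¹ undoes this. -/
theorem commute_c_z : Commute ((fib (FreeGroup.of 1))⁻¹ * stab) (fib (FreeGroup.of 2)) := by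
  have h := stab_conj (FreeGroup.of 2)
  have h2 : twist (FreeGroup.of 2) =
      FreeGroup.of 1 * FreeGroup.of 2 * (FreeGroup.of 1)⁻¹ := by simp [twist]
  rw [h2, mul_inv_eq_iff_eq_mul] at h
  change _ * _ * _ = _ * (_ * _)
  rw [mul_assoc, h]
  simp only [map_mul, map_inv]
  group

theorem gen_commute {i j : Fin 4} (h : (SimpleGraph.pathGraph 4).Adj i j) :
    Commute (gen i) (gen j) := by
  have h01 : Commute (gen 0) (gen 1) := by
    simpa [gen] using commute_stab_x.symm.mul_left (Commute.refl stab)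
  have h12 : Commute (gen 1) (gen 2) := by
    simpa [gen] using commute_stab_y.inv_right.mul_right (Commute.refl stab)
  have h23 : Commute (gen 2) (gen 3) := by
    simpa [gen] using commute_c_z.inv_right.mul_right (Commute.refl _)
  rw [SimpleGraph.pathGraph_adj] at h
  fin_cases i <;> fin_cases j <;> simp at h <;>
    first | exact h01 | exact h12 | exact h23 | exact h01.symm | exact h12.symm | exact h23.symm

/-- The homomorphism from the right-angled Artin group on the path to `TwistTorus`. -/
def ofArtin : RightAngledArtinGroup (SimpleGraph.pathGraph 4) →* TwistTorus :=
  PresentedGroup.toGroup (f := gen) (by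
    rintro r ⟨v, w, hvw, rfl⟩
    have := gen_commute hvw
    simp only [map_mul, map_inv, FreeGroup.lift_apply_of]
    rw [mul_assoc, this.eq]
    group)

theorem ofArtin_of (i : Fin 4) : ofArtin (PresentedGroup.of i) = gen i :=
  PresentedGroup.toGroup.of _

end TwistTorus

/-! ### The word [d b d⁻¹, a⁻¹ c a] in the mapping torus -/

section Words

variable {G : Type*} [Group G]

/-- The word `[d b d⁻¹, a⁻¹ c a]`. -/
def pathWord (a b c d : G) : G :=
  (d * b * d⁻¹) * (a⁻¹ * c * a) * (d * b * d⁻¹)⁻¹ * (a⁻¹ * c * a)⁻¹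

theorem map_pathWord {G' : Type*} [Group G'] (f : G →* G') (a b c d : G) :
    f (pathWord a b c d) = pathWord (f a) (f b) (f c) (f d) := by
  simp [pathWord]

theorem mul_commutator_of_semiconj {C P G₁ G₂ : G} (hP : Commute C P) (hG : C * G₁ = G₂ * C) :
    (P * C) * (G₁ * C) * (P * C)⁻¹ * (G₁ * C)⁻¹ = P * G₂ * P⁻¹ * G₁⁻¹ := by
  calc (P * C) * (G₁ * C) * (P * C)⁻¹ * (G₁ * C)⁻¹
      = P * (C * G₁) * (P⁻¹ * C⁻¹) * G₁⁻¹ := by group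
    _ = P * (G₂ * C) * (C⁻¹ * P⁻¹) * G₁⁻¹ := by rw [hG, (hP.inv_inv).eq]
    _ = _ := by group

variable {X Y Z C : G}

theorem conj_c_by_a (hY : Commute C Y) (hX : Commute (Y * C) X) :
    (X * (Y * C))⁻¹ * C * (X * (Y * C)) = X⁻¹ * Y⁻¹ * X * Y * C := by
  have hC : C = Y⁻¹ * (Y * C) := by group
  have hYC : Commute (Y * C) Y := (Commute.refl Y).mul_left hY
  calc (X * (Y * C))⁻¹ * C * (X * (Y * C))
      = (Y * C)⁻¹ * (X⁻¹ * Y⁻¹) * ((Y * C) * X) * (Y * C) := by group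
    _ = (Y * C)⁻¹ * (X⁻¹ * Y⁻¹ * X) * (Y * C) * (Y * C) := by rw [hX.eq]; group
    _ = (Y * C)⁻¹ * ((X⁻¹ * Y⁻¹ * X) * (Y * C)) * (Y * C) := by group
    _ = (Y * C)⁻¹ * ((Y * C) * (X⁻¹ * Y⁻¹ * X)) * (Y * C) := by
      rw [((hX.inv_right.mul_right hYC.inv_right).mul_right hX).eq]
    _ = _ := by group

theorem c_conj (hY : Commute C Y) (hX : Commute (Y * C) X) :
    C * (X⁻¹ * Y⁻¹ * X * Y) = (Y⁻¹ * X⁻¹ * Y⁻¹ * X * Y * Y) * C := by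
  have hYC : Commute (Y * C) Y := (Commute.refl Y).mul_left hY
  calc C * (X⁻¹ * Y⁻¹ * X * Y) = Y⁻¹ * ((Y * C) * (X⁻¹ * Y⁻¹ * X * Y)) := by group
    _ = Y⁻¹ * ((X⁻¹ * Y⁻¹ * X * Y) * (Y * C)) := by
      rw [(((hX.inv_right.mul_right hYC.inv_right).mul_right hX).mul_right hYC).eq]
    _ = _ := by group

/-- Each of the two factors of the commutator is a word in X, Y, Z times C. Moving C across leaves
an expression in X, Y, Z alone, which lies in the fibre when these do. -/
theorem pathWord_eq (hY : Commute C Y) (hX : Commute (Y * C) X) (hZ : Commute C Z) :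
    pathWord (X * (Y * C)) (Y * C) C (Z⁻¹ * C) =
      (Z⁻¹ * Y * Z) * (Y⁻¹ * X⁻¹ * Y⁻¹ * X * Y * Y) * (Z⁻¹ * Y * Z)⁻¹ *
        (X⁻¹ * Y⁻¹ * X * Y)⁻¹ := by
  have hf : (Z⁻¹ * C) * (Y * C) * (Z⁻¹ * C)⁻¹ = (Z⁻¹ * Y * Z) * C := by
    calc (Z⁻¹ * C) * (Y * C) * (Z⁻¹ * C)⁻¹ = Z⁻¹ * (C * (Y * Z)) := by group
      _ = Z⁻¹ * ((Y * Z) * C) := by rw [(hY.mul_right hZ).eq]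
      _ = _ := by group
  rw [pathWord, hf, conj_c_by_a hY hX]
  exact mul_commutator_of_semiconj ((hZ.inv_right.mul_right hY).mul_right hZ) (c_conj hY hX)

theorem pathWord_inv_eq (hY : Commute C Y) (hX : Commute (Y * C) X) (hZ : Commute C Z) :
    pathWord (X * (Y * C)) (Y * C) C (Z⁻¹ * C)⁻¹ =
      (Z * Y * Z⁻¹) * (Y⁻¹ * X⁻¹ * Y⁻¹ * X * Y * Y) * (Z * Y * Z⁻¹)⁻¹ *
        (X⁻¹ * Y⁻¹ * X * Y)⁻¹ := by
  have hf : (Z⁻¹ * C)⁻¹ * (Y * C) * (Z⁻¹ * C)⁻¹⁻¹ = (Z * Y * Z⁻¹) * C := by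
    calc (Z⁻¹ * C)⁻¹ * (Y * C) * (Z⁻¹ * C)⁻¹⁻¹ = C⁻¹ * ((Z * Y) * (C * Z⁻¹)) * C := by group
      _ = C⁻¹ * ((Z * Y * Z⁻¹) * C) * C := by rw [hZ.inv_right.eq]; group
      _ = C⁻¹ * (C * (Z * Y * Z⁻¹)) * C := by
        rw [((hZ.mul_right hY).mul_right hZ.inv_right).eq]
      _ = _ := by group
  rw [pathWord, hf, conj_c_by_a hY hX]
  exact mul_commutator_of_semiconj ((hZ.mul_right hY).mul_right hZ.inv_right) (c_conj hY hX)

end Words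

/-! ### Nontriviality of the words through SL(2, ℤ) -/

open Matrix in
/-- The upper unipotent element of `SL(2, ℤ)` with entry `n`. -/
def upperUnipotent (n : ℤ) : SpecialLinearGroup (Fin 2) ℤ := ⟨!![1, n; 0, 1], by simp⟩

open Matrix in
/-- The lower unipotent element of `SL(2, ℤ)` with entry `n`. -/
def lowerUnipotent (n : ℤ) : SpecialLinearGroup (Fin 2) ℤ := ⟨!![1, 0; n, 1], by simp⟩

theorem coe_upperUnipotent (n : ℤ) : (upperUnipotent n).1 = !![1, n; 0, 1] := rfl

theorem coe_lowerUnipotent (n : ℤ) : (lowerUnipotent n).1 = !![1, 0; n, 1] := rfl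

theorem upperUnipotent_mul (m n : ℤ) :
    upperUnipotent m * upperUnipotent n = upperUnipotent (n + m) := by
  apply Subtype.ext
  rw [Matrix.SpecialLinearGroup.coe_mul]
  simp [coe_upperUnipotent]

theorem lowerUnipotent_mul (m n : ℤ) :
    lowerUnipotent m * lowerUnipotent n = lowerUnipotent (m + n) := by
  apply Subtype.ext
  rw [Matrix.SpecialLinearGroup.coe_mul]
  simp [coe_lowerUnipotent]

theorem upperUnipotent_zero : upperUnipotent 0 = 1 := by
  apply Subtype.ext
  simp [coe_upperUnipotent, Matrix.one_fin_two]

theorem lowerUnipotent_zero : lowerUnipotent 0 = 1 := by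
  apply Subtype.ext
  simp [coe_lowerUnipotent, Matrix.one_fin_two]

theorem upperUnipotent_inv (n : ℤ) : (upperUnipotent n)⁻¹ = upperUnipotent (-n) := by
  rw [inv_eq_iff_mul_eq_one, upperUnipotent_mul, neg_add_cancel, upperUnipotent_zero]

theorem lowerUnipotent_inv (n : ℤ) : (lowerUnipotent n)⁻¹ = lowerUnipotent (-n) := by
  rw [inv_eq_iff_mul_eq_one, lowerUnipotent_mul, add_neg_cancel, lowerUnipotent_zero]

theorem upperUnipotent_one_pow (n : ℕ) : upperUnipotent 1 ^ n = upperUnipotent n := by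
  induction n with
  | zero => rw [pow_zero, Nat.cast_zero, upperUnipotent_zero]
  | succ n ih => rw [pow_succ, ih, upperUnipotent_mul, Nat.cast_succ, add_comm]

theorem lowerUnipotent_one_pow (n : ℕ) : lowerUnipotent 1 ^ n = lowerUnipotent n := by
  induction n with
  | zero => rw [pow_zero, Nat.cast_zero, lowerUnipotent_zero]
  | succ n ih => rw [pow_succ, ih, lowerUnipotent_mul, Nat.cast_succ]

namespace TwistTorus

/-- The specialization `x, z ↦ [1 1; 0 1]`, `y ↦ [1 0; 1 1]` of the fibre. -/
def spec : FreeGroup (Fin 3) →* Matrix.SpecialLinearGroup (Fin 2) ℤ :=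
  FreeGroup.lift ![upperUnipotent 1, lowerUnipotent 1, upperUnipotent 1]

theorem fib_ne_one_of_spec {x : FreeGroup (Fin 3)} (h : spec x ≠ 1) : fib x ≠ 1 := by
  intro hx
  rw [← map_one fib] at hx
  exact h (by rw [SemidirectProduct.inl_injective hx, map_one])

/-- Powers keep the shape of the generators: the stable letter is y times y⁻¹t with commuting
factors, and the other generators are likewise products of commuting factors. The word identities
for X, Y, Z, C thus apply to all exponents N at once. -/
theorem gen_pow (N : ℕ) :
    ∃ X Y Z C : TwistTorus, X = fib (FreeGroup.of 0 ^ N) ∧ Y = fib (FreeGroup.of 1 ^ N) ∧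
      Z = fib (FreeGroup.of 2 ^ N) ∧ Commute C Y ∧ Commute (Y * C) X ∧ Commute C Z ∧
      gen 0 ^ N = X * (Y * C) ∧ gen 1 ^ N = Y * C ∧ gen 2 ^ N = C ∧ gen 3 ^ N = Z⁻¹ * C := by
  have hcy : Commute ((fib (FreeGroup.of 1))⁻¹ * stab) (fib (FreeGroup.of 1)) :=
    (Commute.refl _).inv_left.mul_left commute_stab_y
  have e : (fib (FreeGroup.of 1) ^ N) * ((fib (FreeGroup.of 1))⁻¹ * stab) ^ N = stab ^ N := by
    rw [← hcy.symm.mul_pow]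
    group
  refine ⟨_, _, _, ((fib (FreeGroup.of 1))⁻¹ * stab) ^ N, rfl, rfl, rfl, ?_⟩
  simp only [map_pow]
  refine ⟨hcy.pow_pow N N, ?_, commute_c_z.pow_pow N N, ?_, ?_, ?_, ?_⟩
  · rw [e]
    exact commute_stab_x.pow_pow N N
  · rw [e, ← commute_stab_x.symm.mul_pow]
    simp [gen]
  · rw [e]
    simp [gen]
  · simp [gen]
  · rw [← inv_pow, ← commute_c_z.symm.inv_left.mul_pow]
    simp [gen]

theorem pathWord_gen_pow_ne_one {N : ℕ} (hN : 0 < N) :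
    pathWord (gen 0 ^ N) (gen 1 ^ N) (gen 2 ^ N) (gen 3 ^ N) ≠ 1 := by
  obtain ⟨X, Y, Z, C, rfl, rfl, rfl, hY, hX, hZ, h0, h1, h2, h3⟩ := gen_pow N
  rw [h0, h1, h2, h3, pathWord_eq hY hX hZ]
  simp only [← map_mul, ← map_inv]
  apply fib_ne_one_of_spec
  simp only [map_mul, map_inv, map_pow, spec, FreeGroup.lift_apply_of]
  simp only [Matrix.cons_val, upperUnipotent_one_pow, lowerUnipotent_one_pow, mul_inv_rev,
    upperUnipotent_inv, lowerUnipotent_inv]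
  intro h
  -- The upper right entry would force a polynomial in N with positive coefficients to vanish.
  have := congrArg (fun m : Matrix.SpecialLinearGroup (Fin 2) ℤ => m.1 0 1) h
  simp only [Matrix.SpecialLinearGroup.coe_mul, coe_upperUnipotent, coe_lowerUnipotent,
    Matrix.SpecialLinearGroup.coe_one] at this
  simp at this
  ring_nf at this
  have hN' : (0 : ℤ) < N := by exact_mod_cast hN
  have : (0 : ℤ) < N ^ 7 * 2 + N ^ 11 * 2 + N ^ 15 * 2 := by positivity
  omega

theorem pathWord_gen_pow_inv_ne_one {N : ℕ} (hN : 0 < N) :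
    pathWord (gen 0 ^ N) (gen 1 ^ N) (gen 2 ^ N) (gen 3 ^ N)⁻¹ ≠ 1 := by
  obtain ⟨X, Y, Z, C, rfl, rfl, rfl, hY, hX, hZ, h0, h1, h2, h3⟩ := gen_pow N
  rw [h0, h1, h2, h3, pathWord_inv_eq hY hX hZ]
  simp only [← map_mul, ← map_inv]
  apply fib_ne_one_of_spec
  simp only [map_mul, map_inv, map_pow, spec, FreeGroup.lift_apply_of]
  simp only [Matrix.cons_val, upperUnipotent_one_pow, lowerUnipotent_one_pow, mul_inv_rev,
    upperUnipotent_inv, lowerUnipotent_inv]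
  intro h
  have := congrArg (fun m : Matrix.SpecialLinearGroup (Fin 2) ℤ => m.1 0 1) h
  simp only [Matrix.SpecialLinearGroup.coe_mul, coe_upperUnipotent, coe_lowerUnipotent,
    Matrix.SpecialLinearGroup.coe_one] at this
  simp at this
  ring_nf at this
  have hN' : (0 : ℤ) < N := by exact_mod_cast hN
  have : (0 : ℤ) < N ^ 5 * 4 + N ^ 7 * 10 + N ^ 9 * 16 + N ^ 11 * 18 + N ^ 13 * 10 + N ^ 15 * 2 := by
    positivity
  omega

/-- A noncommuting pair of fibre elements built from powers of a and c alone, hence available in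
every subgroup containing them. As YC commutes with X and Y, the commutator is X Y⁻¹ X⁻¹ Y, and
conjugation by a acts on it as conjugation by X. -/
theorem not_commute_commutator_gen_pow {N : ℕ} (hN : 0 < N) :
    ¬ Commute (gen 0 ^ N * gen 2 ^ N * (gen 0 ^ N)⁻¹ * (gen 2 ^ N)⁻¹)
      (gen 0 ^ N * (gen 0 ^ N * gen 2 ^ N * (gen 0 ^ N)⁻¹ * (gen 2 ^ N)⁻¹) * (gen 0 ^ N)⁻¹) := by
  obtain ⟨X, Y, Z, C, rfl, rfl, rfl, hY, hX, hZ, h0, h1, h2, h3⟩ := gen_pow N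
  set X := fib (FreeGroup.of 0 ^ N)
  set Y := fib (FreeGroup.of 1 ^ N)
  have hYC : Commute (Y * C) Y := (Commute.refl Y).mul_left hY
  have e1 : X * (Y * C) * C * (X * (Y * C))⁻¹ * C⁻¹ = X * Y⁻¹ * X⁻¹ * Y := by
    calc X * (Y * C) * C * (X * (Y * C))⁻¹ * C⁻¹
        = X * Y * (C * (C * Y⁻¹)) * C⁻¹ * C⁻¹ * (C * X⁻¹ * C⁻¹) := by
          rw [hY.inv_right.eq]; group
      _ = X * Y⁻¹ * ((Y * C) * X⁻¹) * C⁻¹ := by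
        rw [hY.inv_right.eq, ← mul_assoc C, hY.inv_right.eq]; group
      _ = _ := by rw [hX.inv_right.eq]; group
  rw [h0, h2, e1]
  have e2 : X * (Y * C) * (X * Y⁻¹ * X⁻¹ * Y) * (X * (Y * C))⁻¹ =
      X * (X * Y⁻¹ * X⁻¹ * Y) * X⁻¹ := by
    rw [mul_inv_rev, mul_assoc X,
      (((hX.mul_right hYC.inv_right).mul_right hX.inv_right).mul_right hYC).eq]
    group
  rw [e2]
  simp only [X, Y, ← map_mul, ← map_inv]
  intro h
  have h := SemidirectProduct.inl_injective (by simpa only [← map_mul] using h.eq)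
  have h := congrArg spec h
  simp only [map_mul, map_inv, map_pow, spec, FreeGroup.lift_apply_of] at h
  simp only [Matrix.cons_val, upperUnipotent_one_pow, lowerUnipotent_one_pow,
    upperUnipotent_inv, lowerUnipotent_inv] at h
  have := congrArg (fun m : Matrix.SpecialLinearGroup (Fin 2) ℤ => m.1 1 0) h
  simp only [Matrix.SpecialLinearGroup.coe_mul, coe_upperUnipotent, coe_lowerUnipotent] at this
  simp at this
  ring_nf at this
  have hN' : (0 : ℤ) < N := by exact_mod_cast hN
  have : (0 : ℤ) < N ^ 7 * 2 := by positivity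
  omega

end TwistTorus

/-! ### Kopell's lemma and Denjoy's theorem for periodic diffeomorphisms -/

/-- Induct by removing the interval with the largest left end; the remaining ones lie to the left of
that end, which replaces B. -/
theorem sum_sub_le_of_monotone {ι : Type*} (s : Finset ι) {P : ℝ → ℝ} (hP : Monotone P) {A B : ℝ}
    (hAB : A ≤ B) {u v : ι → ℝ} (huv : ∀ i ∈ s, u i < v i) (hA : ∀ i ∈ s, A ≤ u i)
    (hB : ∀ i ∈ s, v i ≤ B) (hd : ∀ i ∈ s, ∀ j ∈ s, i ≠ j → v i ≤ u j ∨ v j ≤ u i) :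
    ∑ i ∈ s, (P (v i) - P (u i)) ≤ P B - P A := by
  classical
  induction s using Finset.induction_on_max_value u generalizing B with
  | empty => simpa using hP hAB
  | insert a s ha hmax ih =>
    rw [Finset.sum_insert ha]
    have h1 : ∑ i ∈ s, (P (v i) - P (u i)) ≤ P (u a) - P A := by
      refine ih (hA a (by simp)) (fun i hi => huv i (by simp [hi])) (fun i hi => hA i (by simp [hi]))
        (fun i hi => ?_) (fun i hi j hj => hd i (by simp [hi]) j (by simp [hj]))
      rcases hd i (by simp [hi]) a (by simp) (by rintro rfl; exact ha hi) with h | h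
      · exact h
      · have := hmax i hi
        have := huv a (by simp)
        linarith
    have h2 := hP (hB a (by simp))
    linarith

/-- The `C¹` diffeomorphisms of the line with positive derivative that commute with the translation
by `p`. -/
def periodicDiffeo (p : ℝ) : Subgroup (ℝ ≃o ℝ) where
  carrier := {f | (∀ x, f (x + p) = f x + p) ∧ (∀ x, DifferentiableAt ℝ f x) ∧
    Continuous (deriv f) ∧ ∀ x, 0 < deriv f x}
  one_mem' := by
    have h : deriv (⇑(1 : ℝ ≃o ℝ)) = fun _ => 1 := deriv_id'
    refine ⟨fun x => rfl, fun x => differentiableAt_id, ?_, ?_⟩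
    · rw [h]; exact continuous_const
    · rw [h]; exact fun _ => one_pos
  mul_mem' {f g} hf hg := by
    have h : deriv (⇑(f * g)) = fun x => deriv f (g x) * deriv g x :=
      funext fun x => deriv_comp x (hf.2.1 _) (hg.2.1 x)
    refine ⟨fun x => ?_, fun x => (hf.2.1 _).comp x (hg.2.1 x), ?_, ?_⟩
    · change f (g (x + p)) = f (g x) + p
      rw [hg.1, hf.1]
    · rw [h]
      exact (hf.2.2.1.comp g.continuous).mul hg.2.2.1
    · rw [h]
      exact fun x => mul_pos (hf.2.2.2 _) (hg.2.2.2 _)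
  inv_mem' {f} hf := by
    have h1 : ∀ x, HasDerivAt (⇑(f⁻¹)) (deriv f (f⁻¹ x))⁻¹ x := fun x =>
      ((hf.2.1 _).hasDerivAt).of_local_left_inverse f.symm.continuous.continuousAt
        (hf.2.2.2 _).ne' (Eventually.of_forall f.apply_symm_apply)
    have h : deriv (⇑(f⁻¹)) = fun x => (deriv f (f⁻¹ x))⁻¹ := funext fun x => (h1 x).deriv
    refine ⟨fun x => ?_, fun x => (h1 x).differentiableAt, ?_, ?_⟩
    · apply f.injective
      rw [hf.1]
      change f (f.symm _) = f (f.symm _) + p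
      rw [f.apply_symm_apply, f.apply_symm_apply]
    · rw [h]
      exact (hf.2.2.1.comp f.symm.continuous).inv₀ fun x => (hf.2.2.2 _).ne'
    · rw [h]
      exact fun x => inv_pos.mpr (hf.2.2.2 _)

namespace periodicDiffeo

variable {p : ℝ} {f h : ℝ ≃o ℝ}

theorem hasDerivAt (hf : f ∈ periodicDiffeo p) (x : ℝ) : HasDerivAt f (deriv f x) x :=
  (hf.2.1 x).hasDerivAt

theorem map_add_int_mul (hf : f ∈ periodicDiffeo p) (x : ℝ) (k : ℤ) :
    f (x + k * p) = f x + k * p := by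
  induction k using Int.induction_on with
  | zero => simp
  | succ n ih =>
    have := hf.1 (x + n * p)
    push_cast at ih ⊢
    rw [add_mul, one_mul, ← add_assoc, this, ih]
    ring
  | pred n ih =>
    have := hf.1 (x + (-n - 1 : ℤ) * p)
    push_cast at ih this ⊢
    have e : x + (-(n : ℝ) - 1) * p + p = x + -n * p := by ring
    rw [e, ih] at this
    linarith

theorem deriv_add_int_mul (hf : f ∈ periodicDiffeo p) (x : ℝ) (k : ℤ) :
    deriv f (x + k * p) = deriv f x := by
  rw [← deriv_comp_add_const]
  have : (fun y => f (y + k * p)) = fun y => f y + k * p := funext fun y => map_add_int_mul hf y k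
  rw [this, deriv_add_const]

theorem exists_deriv_ge (hp : 0 < p) (hf : f ∈ periodicDiffeo p) :
    ∃ m > 0, ∀ x, m ≤ deriv f x := by
  obtain ⟨x₀, -, hx₀⟩ := isCompact_Icc.exists_isMinOn (nonempty_Icc.mpr hp.le)
    (hf.2.2.1.continuousOn (s := Icc 0 p))
  refine ⟨deriv f x₀, hf.2.2.2 x₀, fun x => ?_⟩
  have h1 := deriv_add_int_mul hf x (-⌊x / p⌋)
  rw [← h1]
  refine hx₀ ⟨?_, ?_⟩
  · have := mul_le_mul_of_nonneg_right (Int.floor_le (x / p)) hp.le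
    rw [div_mul_cancel₀ _ hp.ne'] at this
    push_cast
    linarith
  · have := mul_le_mul_of_nonneg_right (Int.lt_floor_add_one (x / p)).le hp.le
    rw [div_mul_cancel₀ _ hp.ne'] at this
    push_cast
    linarith

theorem hasDerivAt_pow (hf : f ∈ periodicDiffeo p) (n : ℕ) (x : ℝ) :
    HasDerivAt (⇑(f ^ n)) (∏ j ∈ Finset.range n, deriv f ((f ^ j) x)) x := by
  induction n with
  | zero => simpa using hasDerivAt_id x
  | succ n ih =>
    rw [Finset.prod_range_succ, mul_comm, pow_succ']
    exact (hasDerivAt hf _).comp x ih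

end periodicDiffeo

theorem OrderIso.exists_tendsto_pow_of_le {g : ℝ ≃o ℝ} {x y : ℝ} (hx : x ≤ g x)
    (hy : ∀ n : ℕ, (g ^ n) x ≤ y) :
    ∃ l, Tendsto (fun n : ℕ => (g ^ n) x) atTop (𝓝 l) ∧ g l = l ∧ (∀ n : ℕ, (g ^ n) x ≤ l) ∧
      l ≤ y := by
  have hm : Monotone fun n : ℕ => (g ^ n) x := monotone_nat_of_le_succ fun n => by
    rw [pow_succ]
    exact (g ^ n).monotone hx
  have hb : BddAbove (range fun n : ℕ => (g ^ n) x) := ⟨y, by rintro _ ⟨n, rfl⟩; exact hy n⟩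
  have hl := tendsto_atTop_ciSup hm hb
  refine ⟨_, hl, ?_, fun n => le_ciSup hb n, ciSup_le hy⟩
  have h1 := (g.continuous.tendsto _).comp hl
  have h2 := hl.comp (tendsto_add_atTop_nat 1)
  refine tendsto_nhds_unique h1 (h2.congr fun n => ?_)
  simp only [Function.comp_apply, pow_succ']
  rfl

theorem OrderIso.exists_tendsto_pow_of_ge {g : ℝ ≃o ℝ} {x y : ℝ} (hx : g x ≤ x)
    (hy : ∀ n : ℕ, y ≤ (g ^ n) x) :
    ∃ l, Tendsto (fun n : ℕ => (g ^ n) x) atTop (𝓝 l) ∧ g l = l ∧ (∀ n : ℕ, l ≤ (g ^ n) x) ∧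
      y ≤ l := by
  have hm : Antitone fun n : ℕ => (g ^ n) x := antitone_nat_of_succ_le fun n => by
    rw [pow_succ]
    exact (g ^ n).monotone hx
  have hb : BddBelow (range fun n : ℕ => (g ^ n) x) := ⟨y, by rintro _ ⟨n, rfl⟩; exact hy n⟩
  have hl := tendsto_atTop_ciInf hm hb
  refine ⟨_, hl, ?_, fun n => ciInf_le hb n, le_ciInf hy⟩
  have h1 := (g.continuous.tendsto _).comp hl
  have h2 := hl.comp (tendsto_add_atTop_nat 1)
  refine tendsto_nhds_unique h1 (h2.congr fun n => ?_)
  simp only [Function.comp_apply, pow_succ']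
  rfl

theorem OrderIso.gap_disjoint {h : ℝ ≃o ℝ} {u v u' v' : ℝ} (hu : h u = u) (hu' : h u' = u')
    (hg : ∀ x ∈ Ioo u v, h x ≠ x) (hg' : ∀ x ∈ Ioo u' v', h x ≠ x) (hne : u ≠ u') :
    v ≤ u' ∨ v' ≤ u := by
  by_contra! hcon
  rcases lt_or_gt_of_ne hne with h1 | h1
  · exact hg u' ⟨h1, hcon.1⟩ hu'
  · exact hg' u ⟨h1, hcon.2⟩ hu

/-- **Kopell's lemma**, in a form that also covers Denjoy's theorem: if `f` has a derivative of
bounded variation and commutes with `h`, then `f` permutes cyclically (modulo translations) the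
gaps between fixed points of `h`. -/
theorem exists_pow_gap_eq {p : ℝ} (hp : 0 < p) {f h : ℝ ≃o ℝ} (hf : f ∈ periodicDiffeo p)
    (hbv : LocallyBoundedVariationOn (deriv f) univ) (hh : h ∈ periodicDiffeo p)
    (hc : Commute f h) {u v : ℝ} (huv : u < v) (hu : h u = u) (hv : h v = v)
    (hg : ∀ x ∈ Ioo u v, h x ≠ x) : ∃ n : ℕ, 0 < n ∧ ∃ k : ℤ, (f ^ n) u = u + k * p := by
  -- Replacing h by its inverse, h moves the midpoint of the gap to the right.
  wlog hx : h ((u + v) / 2) > (u + v) / 2 generalizing h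
  · have hinv : ∀ x, h x = x → h⁻¹ x = x := fun x hx => by
      conv_lhs => rw [← hx]
      exact h.symm_apply_apply x
    refine this (inv_mem hh) hc.inv_right (hinv u hu) (hinv v hv) (fun x hx' he => hg x hx' ?_) ?_
    · conv_lhs => rw [← he]
      exact h.apply_symm_apply x
    · have h1 : h ((u + v) / 2) < (u + v) / 2 :=
        lt_of_le_of_ne (not_lt.mp hx) (hg _ ⟨by linarith, by linarith⟩)
      have := h⁻¹.strictMono h1
      rwa [RelIso.inv_apply_self] at this
  by_contra! hcon
  set x₀ := (u + v) / 2 with hx₀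
  have hux : u < x₀ := by rw [hx₀]; linarith
  have hxv : x₀ < v := by rw [hx₀]; linarith
  -- the points `f ^ n u`, `f ^ n v` and their representatives
  have hfix : ∀ (n : ℕ) (y : ℝ), h y = y → h ((f ^ n) y) = (f ^ n) y := fun n y hy => by
    have := DFunLike.congr_fun ((hc.pow_left n).eq) y
    change (f ^ n) (h y) = h ((f ^ n) y) at this
    rw [← this, hy]
  have hfix' : ∀ (n : ℕ) (y : ℝ), h ((f ^ n) y) = (f ^ n) y → h y = y := fun n y hy => by
    have := DFunLike.congr_fun ((hc.pow_left n).eq) y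
    change (f ^ n) (h y) = h ((f ^ n) y) at this
    exact (f ^ n).injective (this.trans hy)
  -- The translation by −k n multiples of p brings the n-th image of the gap to [a n, b n] inside
  -- [0, 2p]; a gap has length at most p. Under the assumption `hcon` these intervals do not
  -- overlap.
  let k : ℕ → ℤ := fun n => ⌊(f ^ n) u / p⌋
  let a : ℕ → ℝ := fun n => (f ^ n) u + (-k n : ℤ) * p
  let b : ℕ → ℝ := fun n => (f ^ n) v + (-k n : ℤ) * p
  have hhk : ∀ (x : ℝ) (k : ℤ), h (x + k * p) = x + k * p ↔ h x = x := fun x k => by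
    rw [periodicDiffeo.map_add_int_mul hh]
    exact add_left_inj _
  have hvu : v ≤ u + p := by
    by_contra! hlt
    exact hg (u + p) ⟨by linarith, hlt⟩ (by rw [hh.1, hu])
  have hfpow : ∀ n : ℕ, f ^ n ∈ periodicDiffeo p := fun n => pow_mem hf n
  have hab : ∀ n, a n < b n := fun n => by
    have := (f ^ n).strictMono huv
    simp only [a, b]
    linarith
  have ha0 : ∀ n, 0 ≤ a n := fun n => by
    have := mul_le_mul_of_nonneg_right (Int.floor_le ((f ^ n) u / p)) hp.le
    rw [div_mul_cancel₀ _ hp.ne'] at this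
    simp only [a, k]
    push_cast
    linarith
  have hap : ∀ n, a n ≤ p := fun n => by
    have := mul_le_mul_of_nonneg_right (Int.lt_floor_add_one ((f ^ n) u / p)).le hp.le
    rw [div_mul_cancel₀ _ hp.ne'] at this
    simp only [a, k]
    push_cast
    linarith
  have hb2 : ∀ n, b n ≤ 2 * p := fun n => by
    have h1 := (f ^ n).monotone hvu
    rw [(hfpow n).1] at h1
    have h2 := hap n
    simp only [a, b] at h2 ⊢
    linarith
  have hgap : ∀ n, ∀ x ∈ Ioo (a n) (b n), h x ≠ x := by
    intro n x hx' he
    have e1 : x = (x + (k n : ℤ) * p) + (-k n : ℤ) * p := by push_cast; ring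
    obtain ⟨y, hy⟩ := (f ^ n).surjective (x + (k n : ℤ) * p)
    rw [e1, ← hy, hhk] at he
    refine hg y ⟨?_, ?_⟩ (hfix' n y he)
    · have := hx'.1
      rw [e1, ← hy] at this
      exact (f ^ n).lt_iff_lt.mp (by simpa [a] using this)
    · have := hx'.2
      rw [e1, ← hy] at this
      exact (f ^ n).lt_iff_lt.mp (by simpa [b] using this)
  have hne : ∀ i j, i < j → a i ≠ a j := by
    intro i j hij he
    obtain ⟨m, rfl⟩ := Nat.exists_eq_add_of_lt hij
    refine hcon (m + 1) (Nat.succ_pos m) (k (i + m + 1) - k i) ((f ^ i).injective ?_)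
    rw [periodicDiffeo.map_add_int_mul (hfpow i)]
    have e : (f ^ i) ((f ^ (m + 1)) u) = (f ^ (i + m + 1)) u := by
      rw [add_assoc, pow_add f i]; rfl
    rw [e]
    simp only [a] at he
    push_cast at he ⊢
    linarith
  have hdis : ∀ i j, i ≠ j → b i ≤ a j ∨ b j ≤ a i := by
    intro i j hij
    refine OrderIso.gap_disjoint ((hhk _ _).mpr (hfix i u hu)) ((hhk _ _).mpr (hfix j u hu))
      (hgap i) (hgap j) ?_
    rcases lt_or_gt_of_ne hij with h1 | h1
    · exact hne i j h1
    · exact (hne j i h1).symm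
  have hsum : ∀ (P : ℝ → ℝ), Monotone P → ∀ n, ∑ i ∈ Finset.range n, (P (b i) - P (a i)) ≤
      P (2 * p) - P 0 := fun P hP n =>
    sum_sub_le_of_monotone _ hP (by linarith) (fun i _ => hab i) (fun i _ => ha0 i)
      (fun i _ => hb2 i) (fun i _ j _ => hdis i j)
  -- distortion
  obtain ⟨m, hm, hmf⟩ := periodicDiffeo.exists_deriv_ge hp hf
  obtain ⟨P, Q, hP, hQ, hPQ⟩ := hbv.exists_monotoneOn_sub_monotoneOn
  rw [monotoneOn_univ] at hP hQ
  -- A bound for the logarithmic distortion of all iterates of f on the gap: the variation of the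
  -- derivative over nonoverlapping intervals in [0, 2p], divided by a lower bound of the
  -- derivative.
  set V := ((P (2 * p) - P 0) + (Q (2 * p) - Q 0)) / m
  have hdist : ∀ n, ∀ ξ ∈ Icc u v, ∀ η ∈ Icc u v, ∏ j ∈ Finset.range n, deriv f ((f ^ j) η) ≤
      Real.exp V * ∏ j ∈ Finset.range n, deriv f ((f ^ j) ξ) := by
    intro n ξ hξ η hη
    have h1 : ∀ j, deriv f ((f ^ j) η) ≤ Real.exp (((P (b j) - P (a j)) + (Q (b j) - Q (a j))) / m) *
        deriv f ((f ^ j) ξ) := by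
      intro j
      have mem : ∀ y ∈ Icc u v, (f ^ j) y + (-k j : ℤ) * p ∈ Icc (a j) (b j) := fun y hy =>
        ⟨by have := (f ^ j).monotone hy.1; simp only [a]; linarith,
          by have := (f ^ j).monotone hy.2; simp only [b]; linarith⟩
      have hη' := mem η hη
      have hξ' := mem ξ hξ
      rw [← periodicDiffeo.deriv_add_int_mul hf _ (-k j),
        ← periodicDiffeo.deriv_add_int_mul hf ((f ^ j) ξ) (-k j)]
      set y := (f ^ j) η + (-k j : ℤ) * p
      set z := (f ^ j) ξ + (-k j : ℤ) * p
      have e : ∀ w, deriv f w = P w - Q w := fun w => by rw [hPQ]; rfl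
      have hd : deriv f y - deriv f z ≤ (P (b j) - P (a j)) + (Q (b j) - Q (a j)) := by
        rw [e, e]
        linarith [hP hη'.2, hP hξ'.1, hQ hη'.1, hQ hξ'.2]
      set δ := (P (b j) - P (a j)) + (Q (b j) - Q (a j))
      have hδ : 0 ≤ δ := by
        have := hP (hab j).le
        have := hQ (hab j).le
        simp only [δ]
        linarith
      calc deriv f y ≤ deriv f z + δ := by linarith
        _ ≤ deriv f z + δ / m * deriv f z := by
          have : δ ≤ δ / m * deriv f z := by
            rw [div_mul_eq_mul_div, le_div_iff₀ hm]
            exact mul_le_mul_of_nonneg_left (hmf z) hδ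
          linarith
        _ = (δ / m + 1) * deriv f z := by ring
        _ ≤ _ := mul_le_mul_of_nonneg_right (Real.add_one_le_exp _) (hm.le.trans (hmf z))
    calc ∏ j ∈ Finset.range n, deriv f ((f ^ j) η)
        ≤ ∏ j ∈ Finset.range n, (Real.exp (((P (b j) - P (a j)) + (Q (b j) - Q (a j))) / m) *
          deriv f ((f ^ j) ξ)) := Finset.prod_le_prod (fun j _ => (hf.2.2.2 _).le) fun j _ => h1 j
      _ = Real.exp (∑ j ∈ Finset.range n, ((P (b j) - P (a j)) + (Q (b j) - Q (a j))) / m) *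
          ∏ j ∈ Finset.range n, deriv f ((f ^ j) ξ) := by
        rw [Finset.prod_mul_distrib, Real.exp_sum]
      _ ≤ _ := by
        refine mul_le_mul_of_nonneg_right (Real.exp_le_exp.mpr ?_)
          (Finset.prod_nonneg fun j _ => (hf.2.2.2 _).le)
        rw [← Finset.sum_div, Finset.sum_add_distrib]
        exact div_le_div_of_nonneg_right (add_le_add (hsum P hP n) (hsum Q hQ n)) hm.le
  -- the derivative of `h` on the images of the gap is close to `1`
  have hlen : Tendsto (fun n => b n - a n) atTop (𝓝 0) := by
    refine Summable.tendsto_atTop_zero (summable_of_sum_range_le (c := 2 * p - 0)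
      (fun n => (sub_pos.mpr (hab n)).le) fun n => hsum id monotone_id n)
  have hsmall : ∀ ε > 0, ∃ n, ∀ y ∈ Icc ((f ^ n) u) ((f ^ n) v), deriv h y ≤ 1 + ε := by
    intro ε hε
    have huc := isCompact_Icc.uniformContinuousOn_of_continuous
      (hh.2.2.1.continuousOn (s := Icc 0 (2 * p)))
    obtain ⟨δ, hδ, hδ'⟩ := Metric.uniformContinuousOn_iff.mp huc ε hε
    obtain ⟨n, hn⟩ := ((hlen.eventually (gt_mem_nhds hδ))).exists
    refine ⟨n, fun y hy => ?_⟩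
    -- Both ends of the image gap are fixed by h, so its derivative is 1 somewhere inside; the gap
    -- is short, so uniform continuity keeps it near 1 throughout.
    obtain ⟨ξ, hξ, hξ1⟩ := exists_hasDerivAt_eq_slope h (deriv h) (hab n)
      (h.continuous.continuousOn) (fun x _ => periodicDiffeo.hasDerivAt hh x)
    have e1 : h (b n) = b n := (hhk _ _).mpr (hfix n v hv)
    have e2 : h (a n) = a n := (hhk _ _).mpr (hfix n u hu)
    rw [e1, e2, div_self (sub_pos.mpr (hab n)).ne'] at hξ1
    rw [← periodicDiffeo.deriv_add_int_mul hh y (-k n)]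
    have hy1 : a n ≤ y + (-k n : ℤ) * p := by simp only [a]; linarith [hy.1]
    have hy2 : y + (-k n : ℤ) * p ≤ b n := by simp only [b]; linarith [hy.2]
    have := hδ' (y + (-k n : ℤ) * p) ⟨(ha0 n).trans hy1, hy2.trans (hb2 n)⟩ ξ
      ⟨(ha0 n).trans hξ.1.le, hξ.2.le.trans (hb2 n)⟩ (by
        rw [Real.dist_eq, abs_lt]
        constructor <;> linarith [hξ.1, hξ.2])
    rw [hξ1, Real.dist_eq, abs_lt] at this
    linarith [this.2]
  -- backward orbit under `h`
  have hb0 : ∀ n : ℕ, u < (h⁻¹ ^ n) x₀ := fun n => by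
    have h1 : (h⁻¹ ^ n) u = u := by
      induction n with
      | zero => rfl
      | succ n ih =>
        have : h⁻¹ u = u := by
          conv_lhs => rw [← hu]
          exact h.symm_apply_apply u
        rw [pow_succ, RelIso.mul_apply, this, ih]
    have := (h⁻¹ ^ n).strictMono hux
    rwa [h1] at this
  have hx0 : h⁻¹ x₀ < x₀ := by
    have := h⁻¹.strictMono hx
    rwa [RelIso.inv_apply_self] at this
  -- The backward iterates of x₀ decrease to a fixed point of h in [u, v), which can only be u. The
  -- denominator leaves room for the distortion of f and for a factor 2 from h.
  obtain ⟨N, hN⟩ : ∃ N : ℕ, (h⁻¹ ^ N) x₀ - u < (x₀ - u) / (2 * Real.exp V) := by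
    obtain ⟨l, hl, hl1, hl2, hl3⟩ := OrderIso.exists_tendsto_pow_of_ge hx0.le
      (fun n => (hb0 n).le)
    have hlu : l = u := by
      by_contra hne
      refine hg l ⟨lt_of_le_of_ne hl3 (Ne.symm hne), (hl2 0).trans_lt hxv⟩ ?_
      conv_lhs => rw [← hl1]
      exact h.apply_symm_apply l
    rw [hlu] at hl
    have h1 := hl.sub_const u
    rw [sub_self] at h1
    exact (h1.eventually (gt_mem_nhds (div_pos (sub_pos.mpr hux) (by positivity)))).exists
  set x₁ := (h⁻¹ ^ N) x₀ with hx₁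
  have hx₁u : u < x₁ := hb0 N
  have hx₁v : x₁ ≤ v := by
    have : ∀ n : ℕ, (h⁻¹ ^ n) x₀ ≤ x₀ := fun n => by
      induction n with
      | zero => exact le_rfl
      | succ n ih =>
        rw [pow_succ]
        exact ((h⁻¹ ^ n).monotone hx0.le).trans ih
    exact (this N).trans hxv.le
  -- With N already fixed, ε is chosen so that N steps of h on a late image gap stretch distances
  -- from its left end by at most 2.
  obtain ⟨ε, hε, hεN⟩ : ∃ ε > 0, (1 + ε) ^ N ≤ (2 : ℝ) := by
    have h1 : Tendsto (fun ε : ℝ => (1 + ε) ^ N) (𝓝[>] 0) (𝓝 ((1 + 0) ^ N)) :=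
      ((continuous_const.add continuous_id).pow N).continuousWithinAt
    rw [add_zero, one_pow] at h1
    obtain ⟨ε, h2, h3⟩ := ((h1.eventually (gt_mem_nhds one_lt_two)).and
      self_mem_nhdsWithin).exists
    exact ⟨ε, h3, h2.le⟩
  obtain ⟨n, hn⟩ := hsmall ε hε
  set U := (f ^ n) u
  set W := (f ^ n) v
  have hU : h U = U := hfix n u hu
  have hW : h W = W := hfix n v hv
  have hstep : ∀ y ∈ Icc U W, h y ∈ Icc U W ∧ h y - U ≤ (1 + ε) * (y - U) := by
    intro y hy
    refine ⟨⟨by rw [← hU]; exact h.monotone hy.1, by rw [← hW]; exact h.monotone hy.2⟩, ?_⟩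
    rcases eq_or_lt_of_le hy.1 with h1 | h1
    · rw [← h1, hU]; simp
    · obtain ⟨ξ, hξ, hξ1⟩ := exists_hasDerivAt_eq_slope h (deriv h) h1
        (h.continuous.continuousOn) (fun x _ => periodicDiffeo.hasDerivAt hh x)
      have h2 := hn ξ ⟨hξ.1.le, hξ.2.le.trans hy.2⟩
      rw [hξ1, div_le_iff₀ (sub_pos.mpr h1), hU] at h2
      exact h2
  have hiter : ∀ j : ℕ, ∀ y ∈ Icc U W, (h ^ j) y ∈ Icc U W ∧
      (h ^ j) y - U ≤ (1 + ε) ^ j * (y - U) := by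
    intro j
    induction j with
    | zero => intro y hy; simpa using hy
    | succ j ih =>
      intro y hy
      obtain ⟨h1, h2⟩ := ih y hy
      obtain ⟨h3, h4⟩ := hstep _ h1
      rw [pow_succ', pow_succ', RelIso.mul_apply]
      refine ⟨h3, h4.trans ?_⟩
      rw [mul_assoc]
      exact mul_le_mul_of_nonneg_left h2 (by linarith)
  have hx₁mem : (f ^ n) x₁ ∈ Icc U W := ⟨(f ^ n).monotone hx₁u.le, (f ^ n).monotone hx₁v⟩
  have h1 := (hiter N _ hx₁mem).2
  -- Commutation makes the N-th power of h carry the image of x₁ to the image of x₀, stretching the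
  -- distance to U by at most 2. Bounded distortion instead keeps the ratio of these distances above
  -- 2.
  have h2 : (h ^ N) ((f ^ n) x₁) = (f ^ n) x₀ := by
    have h3 : (h ^ N) ((f ^ n) x₁) = (f ^ n) ((h ^ N) x₁) :=
      (DFunLike.congr_fun ((hc.pow_pow n N).eq) x₁).symm
    rw [h3, hx₁, inv_pow]
    congr 1
    exact (h ^ N).apply_symm_apply x₀
  rw [h2] at h1
  obtain ⟨ξ, hξ, hξ1⟩ := exists_hasDerivAt_eq_slope (⇑(f ^ n)) _ hux
    ((f ^ n).continuous.continuousOn) (fun x _ => periodicDiffeo.hasDerivAt_pow hf n x)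
  obtain ⟨η, hη, hη1⟩ := exists_hasDerivAt_eq_slope (⇑(f ^ n)) _ hx₁u
    ((f ^ n).continuous.continuousOn) (fun x _ => periodicDiffeo.hasDerivAt_pow hf n x)
  have h3 := hdist n ξ ⟨hξ.1.le, hξ.2.le.trans hxv.le⟩ η ⟨hη.1.le, hη.2.le.trans hx₁v⟩
  set A := ∏ j ∈ Finset.range n, deriv f ((f ^ j) ξ)
  set B := ∏ j ∈ Finset.range n, deriv f ((f ^ j) η)
  have hA : 0 < A := Finset.prod_pos fun j _ => hf.2.2.2 _
  rw [eq_div_iff (sub_pos.mpr hux).ne'] at hξ1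
  rw [eq_div_iff (sub_pos.mpr hx₁u).ne'] at hη1
  have hE : 0 < Real.exp V := Real.exp_pos V
  rw [lt_div_iff₀ (by positivity)] at hN
  have h4 : A * (x₀ - u) ≤ 2 * (B * (x₁ - u)) := by
    rw [hξ1, hη1]
    refine h1.trans (mul_le_mul_of_nonneg_right hεN ?_)
    exact sub_nonneg.mpr hx₁mem.1
  have h5 : B * (x₁ - u) ≤ Real.exp V * A * (x₁ - u) :=
    mul_le_mul_of_nonneg_right h3 (sub_pos.mpr hx₁u).le
  have h6 : A * ((x₁ - u) * (2 * Real.exp V)) < A * (x₀ - u) := mul_lt_mul_of_pos_left hN hA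
  nlinarith

/-! ### Gaps of commuting diffeomorphisms -/

/-- `(u, v)` is a connected component of the set of points moved by `h`. -/
structure IsGap (h : ℝ ≃o ℝ) (u v : ℝ) : Prop where
  lt : u < v
  left : h u = u
  right : h v = v
  ne : ∀ x ∈ Ioo u v, h x ≠ x

/-- The subgroup of the order automorphisms that fix `u`. -/
def fixingPoint (u : ℝ) : Subgroup (ℝ ≃o ℝ) where
  carrier := {h | h u = u}
  one_mem' := rfl
  mul_mem' {f g} hf hg := by
    change f (g u) = u
    rw [hg, hf]
  inv_mem' {f} hf := by
    change f⁻¹ u = u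
    conv_lhs => rw [← (show f u = u from hf)]
    exact f.symm_apply_apply u

theorem mem_fixingPoint {u : ℝ} {h : ℝ ≃o ℝ} : h ∈ fixingPoint u ↔ h u = u := Iff.rfl

/-- The fixed set is closed, and translates of one fixed point lie on both sides of x; the nearest
fixed points bound the gap. -/
theorem exists_isGap {p : ℝ} (hp : 0 < p) {h : ℝ ≃o ℝ} (hh : h ∈ periodicDiffeo p)
    (hfix : ∃ z, h z = z) {x : ℝ} (hx : h x ≠ x) : ∃ u v, IsGap h u v ∧ x ∈ Ioo u v := by
  obtain ⟨z, hz⟩ := hfix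
  have hzk : ∀ k : ℤ, h (z + k * p) = z + k * p := fun k => by
    rw [periodicDiffeo.map_add_int_mul hh, hz]
  have hcl : IsClosed {y | h y = y} := isClosed_eq h.continuous continuous_id
  have h1 : ({y | h y = y} ∩ Iic x).Nonempty := by
    obtain ⟨n, hn⟩ := exists_nat_gt ((z - x) / p)
    rw [div_lt_iff₀ hp] at hn
    refine ⟨z + (-n : ℤ) * p, hzk _, ?_⟩
    push_cast
    rw [mem_Iic]
    linarith
  have h2 : ({y | h y = y} ∩ Ici x).Nonempty := by
    obtain ⟨n, hn⟩ := exists_nat_gt ((x - z) / p)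
    rw [div_lt_iff₀ hp] at hn
    refine ⟨z + (n : ℤ) * p, hzk _, ?_⟩
    push_cast
    rw [mem_Ici]
    linarith
  have b1 : BddAbove ({y | h y = y} ∩ Iic x) := ⟨x, fun y hy => hy.2⟩
  have b2 : BddBelow ({y | h y = y} ∩ Ici x) := ⟨x, fun y hy => hy.2⟩
  have m1 := (hcl.inter isClosed_Iic).csSup_mem h1 b1
  have m2 := (hcl.inter isClosed_Ici).csInf_mem h2 b2
  set u := sSup ({y | h y = y} ∩ Iic x)
  set v := sInf ({y | h y = y} ∩ Ici x)
  have hux : u < x := lt_of_le_of_ne m1.2 fun e => hx (e ▸ m1.1)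
  have hxv : x < v := lt_of_le_of_ne m2.2 fun e => hx (e.symm ▸ m2.1)
  refine ⟨u, v, ⟨hux.trans hxv, m1.1, m2.1, fun y hy he => ?_⟩, hux, hxv⟩
  rcases le_total y x with h3 | h3
  · exact absurd (le_csSup b1 ⟨he, h3⟩) (not_le.mpr hy.1)
  · exact absurd (csInf_le b2 ⟨he, h3⟩) (not_le.mpr hy.2)

section Commuting

variable {p : ℝ} {f h : ℝ ≃o ℝ}

theorem apply_eq_of_pow_apply_eq {f : ℝ ≃o ℝ} {u : ℝ} {n : ℕ} (hn : 0 < n)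
    (hu : (f ^ n) u = u) : f u = u := by
  obtain ⟨m, rfl⟩ := Nat.exists_eq_succ_of_ne_zero hn.ne'
  rcases lt_trichotomy (f u) u with h | h | h
  · have : ∀ m : ℕ, (f ^ (m + 1)) u < u := fun m => by
      induction m with
      | zero => simpa using h
      | succ m ih =>
        rw [pow_succ]
        exact ((f ^ (m + 1)).strictMono h).trans ih
    exact absurd hu (this m).ne
  · exact h
  · have : ∀ m : ℕ, u < (f ^ (m + 1)) u := fun m => by
      induction m with
      | zero => simpa using h
      | succ m ih =>
        rw [pow_succ]
        exact ih.trans ((f ^ (m + 1)).strictMono h)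
    exact absurd hu (this m).ne'

/-- The translates of a fixed point trap u in an invariant interval of length p, so u moves by less
than p. -/
theorem eq_zero_of_apply_eq_add {p : ℝ} (hp : 0 < p) {f : ℝ ≃o ℝ} (hf : f ∈ periodicDiffeo p)
    (hfix : ∃ z, f z = z) {u : ℝ} {k : ℤ} (hu : f u = u + k * p) : k = 0 := by
  obtain ⟨z, hz⟩ := hfix
  have hj : ∀ j : ℤ, f (z + j * p) = z + j * p := fun j => by
    rw [periodicDiffeo.map_add_int_mul hf, hz]
  set j := ⌊(u - z) / p⌋
  have h1 := mul_le_mul_of_nonneg_right (Int.floor_le ((u - z) / p)) hp.le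
  have h2 := mul_lt_mul_of_pos_right (Int.lt_floor_add_one ((u - z) / p)) hp
  rw [div_mul_cancel₀ _ hp.ne'] at h1 h2
  have h3 : z + j * p ≤ u := by simp only [j]; linarith
  have h4 : u < z + ((j + 1 : ℤ)) * p := by push_cast; simp only [j]; linarith
  have h5 := f.monotone h3
  have h6 := f.strictMono h4
  rw [hj, hu] at h5 h6
  have h7 : -p < k * p := by push_cast at h4; linarith
  have h8 : k * p < p := by push_cast at h6; linarith
  have h9 : (-1 : ℝ) < k := by nlinarith
  have h10 : (k : ℝ) < 1 := by nlinarith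
  have h11 : -1 < k := by exact_mod_cast h9
  have h12 : k < 1 := by exact_mod_cast h10
  omega

/-- If `f` has a fixed point and commutes with `h`, then `f` fixes the ends of the gaps of `h`. -/
theorem IsGap.apply_ends {p : ℝ} (hp : 0 < p) {f h : ℝ ≃o ℝ} (hf : f ∈ periodicDiffeo p)
    (hbv : LocallyBoundedVariationOn (deriv f) univ) (hh : h ∈ periodicDiffeo p)
    (hc : Commute f h) (hfix : ∃ z, f z = z) {u v : ℝ} (hg : IsGap h u v) :
    f u = u ∧ f v = v := by
  -- A power of f moves u by a multiple of p. The fixed point of f makes this multiple zero, and an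
  -- increasing map with u periodic fixes u.
  obtain ⟨n, hn, k, hk⟩ := exists_pow_gap_eq hp hf hbv hh hc hg.lt hg.left hg.right hg.ne
  have hfixn : ∃ z, (f ^ n) z = z := by
    obtain ⟨z, hz⟩ := hfix
    exact ⟨z, (pow_mem (mem_fixingPoint.mpr hz) n : f ^ n ∈ fixingPoint z)⟩
  have hk0 := eq_zero_of_apply_eq_add hp (pow_mem hf n) hfixn hk
  rw [hk0] at hk
  have hu : f u = u := apply_eq_of_pow_apply_eq hn (by simpa using hk)
  refine ⟨hu, ?_⟩
  have hcx : ∀ x, f (h x) = h (f x) := fun x => DFunLike.congr_fun hc.eq x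
  have hv : h (f v) = f v := by rw [← hcx, hg.right]
  rcases lt_trichotomy (f v) v with h1 | h1 | h1
  · refine absurd hv (hg.ne _ ⟨?_, h1⟩)
    have := f.strictMono hg.lt
    rwa [hu] at this
  · exact h1
  · obtain ⟨w, hw⟩ := f.surjective v
    refine absurd (f.injective ?_) (hg.ne w ⟨?_, ?_⟩)
    · rw [hcx, hw, hg.right]
    · rw [← f.lt_iff_lt, hu, hw]
      exact hg.lt
    · rw [← f.lt_iff_lt, hw]
      exact h1

/-- If `h` commutes with `f` and fixes a point of a gap of `f`, it is the identity there. -/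
theorem IsGap.eqOn_of_fixed {p : ℝ} (hp : 0 < p) {f h : ℝ ≃o ℝ} (hf : f ∈ periodicDiffeo p)
    (hbv : LocallyBoundedVariationOn (deriv f) univ) (hh : h ∈ periodicDiffeo p)
    (hc : Commute f h) {u v : ℝ} (hg : IsGap f u v) {x : ℝ} (hx : x ∈ Ioo u v) (hhx : h x = x) :
    ∀ z ∈ Ioo u v, h z = z := by
  intro z hz
  by_contra hne
  obtain ⟨u', v', hg', hz'⟩ := exists_isGap hp hh ⟨x, hhx⟩ hne
  obtain ⟨h1, h2⟩ := hg'.apply_ends hp hf hbv hh hc ⟨u, hg.left⟩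
  -- If x were outside the gap of h around z, an end of that gap would lie between x and z, hence
  -- inside the gap of f; but f fixes it.
  refine hg'.ne x ⟨?_, ?_⟩ hhx
  · by_contra! hlt
    exact hg.ne u' ⟨hx.1.trans_le hlt, hz'.1.trans hz.2⟩ h1
  · by_contra! hlt
    exact hg.ne v' ⟨hz.1.trans hz'.2, hlt.trans_lt hx.2⟩ h2

/-- Gaps of commuting diffeomorphisms are equal as soon as they intersect. -/
theorem IsGap.eq_of_commute {p : ℝ} (hp : 0 < p) {f h : ℝ ≃o ℝ} (hf : f ∈ periodicDiffeo p)
    (hbv : LocallyBoundedVariationOn (deriv f) univ) (hh : h ∈ periodicDiffeo p)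
    (hbv' : LocallyBoundedVariationOn (deriv h) univ)
    (hc : Commute f h) {u v u' v' : ℝ} (hg : IsGap f u v) (hg' : IsGap h u' v') {x : ℝ}
    (hx : x ∈ Ioo u v) (hx' : x ∈ Ioo u' v') : u = u' ∧ v = v' := by
  obtain ⟨h1, h2⟩ := hg'.apply_ends hp hf hbv hh hc ⟨u, hg.left⟩
  obtain ⟨h3, h4⟩ := hg.apply_ends hp hh hbv' hf hc.symm ⟨u', hg'.left⟩
  constructor <;> apply le_antisymm <;> by_contra! hlt
  · exact hg'.ne u ⟨hlt, hx.1.trans hx'.2⟩ h3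
  · exact hg.ne u' ⟨hlt, hx'.1.trans hx.2⟩ h1
  · exact hg.ne v' ⟨hx.1.trans hx'.2, hlt⟩ h2
  · exact hg'.ne v ⟨hx'.1.trans hx.2, hlt⟩ h4

/-- If `f` has no periodic points modulo translations and commutes with `h`, and `h` has a fixed
point, then `h` is the identity. -/
theorem eq_one_of_commute_of_aperiodic {p : ℝ} (hp : 0 < p) {f h : ℝ ≃o ℝ}
    (hf : f ∈ periodicDiffeo p) (hbv : LocallyBoundedVariationOn (deriv f) univ)
    (hh : h ∈ periodicDiffeo p) (hc : Commute f h)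
    (hap : ∀ n : ℕ, 0 < n → ∀ (k : ℤ) (x : ℝ), (f ^ n) x ≠ x + k * p) (hfix : ∃ z, h z = z) :
    h = 1 := by
  ext x
  by_contra hne
  obtain ⟨u, v, hg, -⟩ := exists_isGap hp hh hfix (x := x) hne
  obtain ⟨n, hn, k, hk⟩ := exists_pow_gap_eq hp hf hbv hh hc hg.lt hg.left hg.right hg.ne
  exact hap n hn k u hk

end Commuting

/-! ### Hölder's theorem on free actions -/

section Holder

variable {Z : Subgroup (ℝ ≃o ℝ)} {N : Set ℝ}

/-- **Hölder's theorem**: a group of order automorphisms of an interval that acts freely is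
commutative. -/
theorem commute_on_of_free (hNc : N.OrdConnected) (hN : ∀ g ∈ Z, ∀ x ∈ N, g x ∈ N)
    (hfree : ∀ g ∈ Z, (∃ x ∈ N, g x = x) → ∀ x ∈ N, g x = x) {a c : ℝ ≃o ℝ} (ha : a ∈ Z)
    (hc : c ∈ Z) {x₀ : ℝ} (hx₀ : x₀ ∈ N) : a (c x₀) = c (a x₀) := by
  -- By freeness and the intermediate value theorem an element moves all points of N in the same
  -- direction. Comparing values at one point therefore orders the group.
  have hpos : ∀ g ∈ Z, ∀ y ∈ N, y < g y → ∀ z ∈ N, z < g z := by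
    intro g hg y hy hlt z hz
    by_contra! hle
    obtain ⟨w, hw, he⟩ := hNc.isPreconnected.intermediate_value₂ hy hz continuousOn_id
      g.continuous.continuousOn hlt.le hle
    exact hlt.ne' (hfree g hg ⟨w, hw, he.symm⟩ y hy)
  have hlt : ∀ g ∈ Z, ∀ h ∈ Z, ∀ y ∈ N, g y < h y → ∀ z ∈ N, g z < h z := by
    intro g hg h hh y hy hlt z hz
    have h1 : y < (g⁻¹ * h) y := by
      rw [RelIso.mul_apply, ← g.lt_iff_lt, RelIso.apply_inv_self]
      exact hlt
    have h2 := hpos _ (mul_mem (inv_mem hg) hh) y hy h1 z hz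
    rwa [RelIso.mul_apply, ← g.lt_iff_lt, RelIso.apply_inv_self] at h2
  have hle : ∀ g ∈ Z, ∀ h ∈ Z, ∀ y ∈ N, g y ≤ h y → ∀ z ∈ N, g z ≤ h z := by
    intro g hg h hh y hy hle z hz
    by_contra! hcon
    exact absurd (hlt h hh g hg z hz hcon y hy) (not_lt.mpr hle)
  -- The order is Archimedean: a bounded orbit would converge to a fixed point in N.
  have harch : ∀ e ∈ Z, ∀ y ∈ N, y < e y → ∀ z ∈ N, ∃ n : ℕ, z < (e ^ n) y := by
    intro e he y hy hlt z hz
    by_contra! hcon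
    obtain ⟨l, -, hl, hl1, hl2⟩ := OrderIso.exists_tendsto_pow_of_le hlt.le hcon
    exact hlt.ne' (hfree e he ⟨l, hNc.out hy hz ⟨by simpa using hl1 0, hl2⟩, hl⟩ y hy)
  have hmono : ∀ e ∈ Z, x₀ < e x₀ → StrictMono fun m : ℤ => (e ^ m) x₀ := by
    intro e he hlt
    refine strictMono_int_of_lt_succ fun m => ?_
    rw [zpow_add_one]
    exact (e ^ m).strictMono hlt
  have hint : ∀ e ∈ Z, x₀ < e x₀ → ∀ g ∈ Z, ∃ m : ℤ, (e ^ m) x₀ ≤ g x₀ ∧ g x₀ < (e ^ (m + 1)) x₀ := by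
    intro e he hlt g hg
    obtain ⟨n, hn⟩ := harch e he x₀ hx₀ hlt (g x₀) (hN g hg x₀ hx₀)
    obtain ⟨n', hn'⟩ := harch e he (g x₀) (hN g hg x₀ hx₀)
      (hpos e he x₀ hx₀ hlt _ (hN g hg x₀ hx₀)) x₀ hx₀
    obtain ⟨m, hm, hm'⟩ := Int.exists_greatest_of_bdd (P := fun m => (e ^ m) x₀ ≤ g x₀)
      ⟨n, fun m hm => by
        by_contra! hcon
        have := (hmono e he hlt).monotone hcon.le
        simp only [zpow_natCast] at this
        exact absurd (this.trans hm) (not_le.mpr hn)⟩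
      ⟨-n', by
        rw [zpow_neg, zpow_natCast, ← (e ^ n').le_iff_le, RelIso.apply_inv_self]
        exact hn'.le⟩
    refine ⟨m, hm, ?_⟩
    by_contra! hcon
    have := hm' (m + 1) hcon
    omega
  by_contra hne
  wlog hgt : c (a x₀) < a (c x₀) generalizing a c
  · exact this hc ha (Ne.symm hne) (lt_of_le_of_ne (not_lt.mp hgt) hne)
  have hca : c (a x₀) ∈ N := hN c hc _ (hN a ha _ hx₀)
  set e₀ := a * c * (c * a)⁻¹ with he₀
  have he₀Z : e₀ ∈ Z := mul_mem (mul_mem ha hc) (inv_mem (mul_mem hc ha))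
  have he₀x : e₀ (c (a x₀)) = a (c x₀) := by
    have : (c * a)⁻¹ (c (a x₀)) = x₀ := (c * a).symm_apply_apply x₀
    rw [he₀, RelIso.mul_apply, this]
    rfl
  have he₀pos : ∀ z ∈ N, z < e₀ z := hpos e₀ he₀Z _ hca (by rw [he₀x]; exact hgt)
  -- If the square of some positive e is at most the commutator e₀, bracket a and c between
  -- consecutive powers of e. Then ac and ca differ by less than two steps of e, but also by e₀.
  by_cases hdense : ∃ e ∈ Z, x₀ < e x₀ ∧ e (e x₀) ≤ e₀ x₀
  · obtain ⟨e, he, he1, he2⟩ := hdense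
    obtain ⟨m, hm1, hm2⟩ := hint e he he1 a ha
    obtain ⟨n, hn1, hn2⟩ := hint e he he1 c hc
    have h1 : a (c x₀) < (e ^ (m + 1)) ((e ^ (n + 1)) x₀) :=
      (hlt a ha _ (zpow_mem he _) x₀ hx₀ hm2 (c x₀) (hN c hc _ hx₀)).trans
        ((e ^ (m + 1)).strictMono hn2)
    have h2 : (e ^ n) ((e ^ m) x₀) ≤ c (a x₀) :=
      (hle _ (zpow_mem he _) c hc x₀ hx₀ hn1 _ (hN _ (zpow_mem he _) _ hx₀)).trans
        (c.monotone hm1)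
    have h3 : e (e (c (a x₀))) ≤ a (c x₀) := by
      rw [← he₀x]
      exact hle (e * e) (mul_mem he he) e₀ he₀Z x₀ hx₀ he2 _ hca
    have h4 : e (e ((e ^ n) ((e ^ m) x₀))) = (e ^ (m + 1)) ((e ^ (n + 1)) x₀) := by
      have : e * (e * (e ^ n * e ^ m)) = e ^ (m + 1) * e ^ (n + 1) := by
        simp only [← zpow_add, ← zpow_one_add]
        congr 1
        ring
      exact DFunLike.congr_fun this x₀
    have h5 := (e.monotone (e.monotone h2)).trans h3
    rw [h4] at h5
    exact absurd h1 (not_lt.mpr h5)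
  · push Not at hdense
    -- Otherwise e₀ is the least positive element: if g were smaller, both g and g⁻¹e₀ would be
    -- positive, the square of g would exceed e₀, and the square of g⁻¹e₀ would then be below e₀. So
    -- the group acts on N through powers of e₀.
    have hmin : ∀ g ∈ Z, x₀ < g x₀ → e₀ x₀ ≤ g x₀ := by
      intro g hg hg1
      by_contra! hg2
      have hk : g⁻¹ * e₀ ∈ Z := mul_mem (inv_mem hg) he₀Z
      have hgk : ∀ y, g ((g⁻¹ * e₀) y) = e₀ y := fun y => by
        rw [RelIso.mul_apply, RelIso.apply_inv_self]
      have hk1 : x₀ < (g⁻¹ * e₀) x₀ := by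
        rw [← g.lt_iff_lt, hgk]
        exact hg2
      have hk2 : (g⁻¹ * e₀) x₀ < g x₀ := by
        rw [← g.lt_iff_lt, hgk]
        exact hdense g hg hg1
      have hk3 := hlt _ hk g hg x₀ hx₀ hk2 _ (hN _ hk x₀ hx₀)
      rw [hgk] at hk3
      exact absurd (hdense _ hk hk1) (not_lt.mpr hk3.le)
    have hpow : ∀ g ∈ Z, ∃ m : ℤ, ∀ z ∈ N, g z = (e₀ ^ m) z := by
      intro g hg
      obtain ⟨m, hm1, hm2⟩ := hint e₀ he₀Z (he₀pos x₀ hx₀) g hg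
      have hk : (e₀ ^ m)⁻¹ * g ∈ Z := mul_mem (inv_mem (zpow_mem he₀Z m)) hg
      have hgk : ∀ y, (e₀ ^ m) (((e₀ ^ m)⁻¹ * g) y) = g y := fun y => by
        rw [RelIso.mul_apply, RelIso.apply_inv_self]
      have hk1 : ((e₀ ^ m)⁻¹ * g) x₀ = x₀ := by
        by_contra hne
        have h1 : x₀ ≤ ((e₀ ^ m)⁻¹ * g) x₀ := by
          rw [← (e₀ ^ m).le_iff_le, hgk]
          exact hm1
        have h2 := hmin _ hk (lt_of_le_of_ne h1 (Ne.symm hne))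
        rw [← (e₀ ^ m).le_iff_le, hgk] at h2
        rw [zpow_add_one] at hm2
        exact absurd hm2 (not_lt.mpr h2)
      refine ⟨m, fun z hz => ?_⟩
      rw [← hgk, hfree _ hk ⟨x₀, hx₀, hk1⟩ z hz]
    obtain ⟨m, hm⟩ := hpow a ha
    obtain ⟨n, hn⟩ := hpow c hc
    apply hne
    rw [hm _ (hN c hc _ hx₀), hn _ hx₀, hn _ (hN a ha _ hx₀), hm _ hx₀]
    have : e₀ ^ m * e₀ ^ n = e₀ ^ n * e₀ ^ m := by rw [← zpow_add, ← zpow_add, add_comm]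
    exact DFunLike.congr_fun this x₀

end Holder

/-! ### Derivatives of bounded variation, and when the word collapses -/

theorem LocallyBoundedVariationOn.comp_monotone_univ {φ g : ℝ → ℝ}
    (h : LocallyBoundedVariationOn φ univ) (hg : Monotone g) :
    LocallyBoundedVariationOn (φ ∘ g) univ := by
  intro x y _ _
  refine ne_top_of_le_ne_top (h (g x) (g y) trivial trivial) ?_
  exact eVariationOn.comp_le_of_monotoneOn φ g (hg.monotoneOn _)
    fun z hz => ⟨trivial, hg hz.2.1, hg hz.2.2⟩

/-- The elements of `periodicDiffeo p` with derivative of locally bounded variation. -/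
def bvDiffeo (p : ℝ) (hp : 0 < p) : Subgroup (ℝ ≃o ℝ) where
  carrier := {f | f ∈ periodicDiffeo p ∧ LocallyBoundedVariationOn (deriv f) univ}
  one_mem' := by
    refine ⟨one_mem _, ?_⟩
    have h : deriv (⇑(1 : ℝ ≃o ℝ)) = fun _ => 1 := deriv_id'
    rw [h]
    exact monotone_const.monotoneOn univ |>.locallyBoundedVariationOn
  mul_mem' {f g} hf hg := by
    refine ⟨mul_mem hf.1 hg.1, ?_⟩
    have h : deriv (⇑(f * g)) = (deriv f ∘ g) * deriv g :=
      funext fun x => deriv_comp x (hf.1.2.1 _) (hg.1.2.1 x)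
    rw [h]
    exact (hf.2.comp_monotone_univ g.monotone).mul hg.2
  inv_mem' {f} hf := by
    refine ⟨inv_mem hf.1, ?_⟩
    obtain ⟨m, hm, hmf⟩ := periodicDiffeo.exists_deriv_ge hp hf.1
    have h : deriv (⇑(f⁻¹)) = (fun t : ℝ => t⁻¹) ∘ (deriv f ∘ ⇑(f⁻¹)) := funext fun x =>
      (((hf.1.2.1 _).hasDerivAt).of_local_left_inverse f.symm.continuous.continuousAt
        (hf.1.2.2.2 _).ne' (Eventually.of_forall f.apply_symm_apply)).deriv
    rw [h]
    have hL : LipschitzOnWith (Real.toNNReal (m⁻¹ * m⁻¹)) (fun t : ℝ => t⁻¹) (Ici m) := by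
      refine LipschitzOnWith.of_dist_le_mul fun x hx y hy => ?_
      have hx0 : 0 < x := hm.trans_le hx
      have hy0 : 0 < y := hm.trans_le hy
      rw [Real.coe_toNNReal _ (by positivity), Real.dist_eq, Real.dist_eq,
        show x⁻¹ - y⁻¹ = (x⁻¹ * y⁻¹) * (y - x) by field_simp, abs_mul, abs_sub_comm y x,
        abs_of_pos (by positivity)]
      have h1 : x⁻¹ ≤ m⁻¹ := inv_anti₀ hm hx
      have h2 : y⁻¹ ≤ m⁻¹ := inv_anti₀ hm hy
      gcongr
    exact hL.comp_locallyBoundedVariationOn (fun x _ => hmf _)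
      (hf.2.comp_monotone_univ f⁻¹.monotone)

section FourDiffeos

variable {p : ℝ} {hp : 0 < p} {a b c d : ℝ ≃o ℝ}

/-- The second factor of the word is then c, and c commutes with b and d. -/
theorem pathWord_eq_one_of_commute_ac {G : Type*} [Group G] {a b c d : G} (hbc : Commute b c)
    (hcd : Commute c d) (hac : Commute a c) : pathWord a b c d = 1 := by
  have h1 : a⁻¹ * c * a = c := by rw [hac.inv_left.eq, mul_assoc, inv_mul_cancel, mul_one]
  have h2 : Commute (d * b * d⁻¹) c := (hcd.symm.mul_left hbc).mul_left hcd.symm.inv_left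
  rw [pathWord, h1, h2.eq]
  group

theorem pathWord_eq_one_of_commute_bd {G : Type*} [Group G] {a b c d : G} (hab : Commute a b)
    (hbc : Commute b c) (hbd : Commute b d) : pathWord a b c d = 1 := by
  have h1 : d * b * d⁻¹ = b := by rw [← hbd.eq, mul_assoc, mul_inv_cancel, mul_one]
  have h2 : Commute b (a⁻¹ * c * a) := (hab.symm.inv_right.mul_right hbc).mul_right hab.symm
  rw [pathWord, h1, h2.eq]
  group

/-- By Denjoy's theorem a map commuting with b that fixes a point is the identity, so the
centralizer of b acts freely and Hölder's theorem applies. -/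
theorem commute_of_commute_aperiodic (hb : b ∈ bvDiffeo p hp)
    (hap : ∀ n : ℕ, 0 < n → ∀ (k : ℤ) (x : ℝ), (b ^ n) x ≠ x + k * p)
    (ha : a ∈ periodicDiffeo p) (hc : c ∈ periodicDiffeo p) (hab : Commute b a)
    (hbc : Commute b c) : Commute a c := by
  have hmem : ∀ h, h ∈ periodicDiffeo p ⊓ Subgroup.centralizer {b} ↔
      h ∈ periodicDiffeo p ∧ Commute b h := fun h => by
    rw [Subgroup.mem_inf, Subgroup.mem_centralizer_singleton_iff]
    exact and_congr_right fun _ => ⟨fun h => h.symm, fun h => h.symm⟩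
  ext x
  refine commute_on_of_free (Z := periodicDiffeo p ⊓ Subgroup.centralizer {b}) (N := univ)
    ordConnected_univ (fun _ _ _ _ => trivial) (fun g hg ⟨z, _, hz⟩ x _ => ?_)
    ((hmem a).mpr ⟨ha, hab⟩) ((hmem c).mpr ⟨hc, hbc⟩) (mem_univ x)
  rw [hmem] at hg
  rw [eq_one_of_commute_of_aperiodic hp hb.1 hb.2 hg.1 hg.2 hap ⟨z, hz⟩]
  rfl

theorem OrderIso.apply_mem_Ioo {g : ℝ ≃o ℝ} {u v : ℝ} (hu : g u = u) (hv : g v = v) {x : ℝ}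
    (hx : x ∈ Ioo u v) : g x ∈ Ioo u v := by
  constructor
  · rw [← hu]; exact g.strictMono hx.1
  · rw [← hv]; exact g.strictMono hx.2

end FourDiffeos

theorem OrderIso.inv_apply_eq_of_apply_eq {f : ℝ ≃o ℝ} {x y : ℝ} (h : f y = x) : f⁻¹ x = y := by
  rw [← h]
  exact f.symm_apply_apply y

/-- If g fixes x, then f⁻¹ x is moved by both maps; if f fixes x, then g⁻¹ x is. This localizes the
support of a commutator to the common support of its factors. -/
theorem OrderIso.exists_moved_of_commutator_moved {f g : ℝ ≃o ℝ} {x : ℝ}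
    (h : (f * g * f⁻¹ * g⁻¹) x ≠ x) :
    ∃ y, (y = x ∨ y = f⁻¹ x ∨ y = g⁻¹ x) ∧ f y ≠ y ∧ g y ≠ y := by
  have hf' : f (f⁻¹ x) = x := RelIso.apply_inv_self f x
  have hg' : g (g⁻¹ x) = x := RelIso.apply_inv_self g x
  have h' : f (g (f⁻¹ (g⁻¹ x))) ≠ x := h
  by_cases hg : g x = x
  · have h1 : g (f⁻¹ x) ≠ f⁻¹ x := by
      intro he
      apply h'
      rw [OrderIso.inv_apply_eq_of_apply_eq hg, he, hf']
    refine ⟨f⁻¹ x, Or.inr (Or.inl rfl), fun he => ?_, h1⟩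
    rw [← he, hf'] at h1
    exact h1 hg
  · by_cases hf : f x = x
    · refine ⟨g⁻¹ x, Or.inr (Or.inr rfl), fun he => ?_, fun he => ?_⟩
      · apply h'
        rw [OrderIso.inv_apply_eq_of_apply_eq he, hg', hf]
      · rw [hg'] at he
        exact hg (by conv_lhs => rw [he, hg'])
    · exact ⟨x, Or.inl rfl, hf, hg⟩

/-! ### Two-jumps and the support of the word -/

section Essential

/-- A point `y` that `d⁻¹` and `a` move in opposite directions beyond fixed points `s` of `a` and
`t` of `d`. -/
structure IsTwoJump (a d : ℝ ≃o ℝ) (y s t : ℝ) : Prop where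
  left : a s = s
  right : d t = t
  left_ne : d s ≠ s
  right_ne : a t ≠ t
  order : (d⁻¹ y ≤ s ∧ s < y ∧ y < t ∧ t ≤ a y) ∨ (a y ≤ t ∧ t < y ∧ y < s ∧ s ≤ d⁻¹ y)

variable {p : ℝ} {hp : 0 < p} {a b c d : ℝ ≃o ℝ}

theorem conj_apply_ne_iff {f g : ℝ ≃o ℝ} {y : ℝ} :
    (g * f * g⁻¹) y ≠ y ↔ f (g⁻¹ y) ≠ g⁻¹ y := by
  rw [not_iff_not, RelIso.mul_apply, RelIso.mul_apply, ← g⁻¹.injective.eq_iff,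
    RelIso.inv_apply_self]

/-- On a common gap of `b` and `c` the two factors of the word commute. -/
theorem commute_on_common_gap (ha : a ∈ bvDiffeo p hp) (hb : b ∈ bvDiffeo p hp)
    (hc : c ∈ bvDiffeo p hp) (hd : d ∈ bvDiffeo p hp) (hab : Commute a b) (hbc : Commute b c)
    (hcd : Commute c d) (fa : ∃ z, a z = z) (fd : ∃ z, d z = z) {u v : ℝ} (hgb : IsGap b u v)
    (hgc : IsGap c u v) :
    (a u = u ∧ a v = v) ∧ (d u = u ∧ d v = v) ∧ ∀ z ∈ Ioo u v,
      (d * b * d⁻¹) ((a⁻¹ * c * a) z) = (a⁻¹ * c * a) ((d * b * d⁻¹) z) := by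
  have hau := hgb.apply_ends hp ha.1 ha.2 hb.1 hab fa
  have hdu := hgc.apply_ends hp hd.1 hd.2 hc.1 hcd.symm fd
  refine ⟨hau, hdu, ?_⟩
  -- The maps that commute with b and fix both ends act freely on the gap by Kopell's lemma, hence
  -- commute there by Hölder's theorem. So a⁻¹ c a equals c on the gap, and d b d⁻¹ commutes with c
  -- everywhere.
  set Z := periodicDiffeo p ⊓ Subgroup.centralizer {b} ⊓ fixingPoint u ⊓ fixingPoint v
  have hmem : ∀ h, h ∈ Z ↔ ((h ∈ periodicDiffeo p ∧ Commute b h) ∧ h u = u) ∧ h v = v := fun h => by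
    simp only [Z, Subgroup.mem_inf, Subgroup.mem_centralizer_singleton_iff, mem_fixingPoint]
    exact and_congr_left fun _ => and_congr_left fun _ => and_congr_right fun _ =>
      ⟨fun h => h.symm, fun h => h.symm⟩
  have hcomm : ∀ z ∈ Ioo u v, a (c z) = c (a z) := fun z hz => by
    refine commute_on_of_free (Z := Z) ordConnected_Ioo (fun g hg x hx => ?_)
      (fun g hg ⟨x, hx, hgx⟩ => ?_) ((hmem a).mpr ⟨⟨⟨ha.1, hab.symm⟩, hau.1⟩, hau.2⟩)
      ((hmem c).mpr ⟨⟨⟨hc.1, hbc⟩, hgc.left⟩, hgc.right⟩) hz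
    · rw [hmem] at hg
      exact OrderIso.apply_mem_Ioo hg.1.2 hg.2 hx
    · rw [hmem] at hg
      exact hgb.eqOn_of_fixed hp hb.1 hb.2 hg.1.1.1 hg.1.1.2 hx hgx
  have hg : ∀ z ∈ Ioo u v, (a⁻¹ * c * a) z = c z := fun z hz => by
    rw [RelIso.mul_apply, RelIso.mul_apply, ← hcomm z hz, RelIso.inv_apply_self]
  have hfc : Commute (d * b * d⁻¹) c := (hcd.symm.mul_left hbc).mul_left hcd.symm.inv_left
  have hf : ∀ w, w ∈ fixingPoint u ⊓ fixingPoint v → ∀ z ∈ Ioo u v, w z ∈ Ioo u v :=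
    fun w hw z hz => OrderIso.apply_mem_Ioo hw.1 hw.2 hz
  have hdmem : d ∈ fixingPoint u ⊓ fixingPoint v := hdu
  have hbmem : b ∈ fixingPoint u ⊓ fixingPoint v := ⟨hgb.left, hgb.right⟩
  intro z hz
  rw [hg z hz, hg _ (hf _ (mul_mem (mul_mem hdmem hbmem) (inv_mem hdmem)) z hz)]
  exact DFunLike.congr_fun hfc.eq z

/-- The point d⁻¹y is moved by b and ay by c. If one of them is moved by both b and c, their gaps
there coincide and contain y. Otherwise b and c fix y; then b is the identity on the gap J of a at
y, and c is the identity on the gap L of d at y. Hence d⁻¹y lies in L outside J and ay in J outside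
L, so the gaps overlap without nesting. Here s is the end of J inside L and t the end of L inside J.
-/
theorem exists_isTwoJump_of_moved (ha : a ∈ bvDiffeo p hp) (hb : b ∈ bvDiffeo p hp)
    (hc : c ∈ bvDiffeo p hp) (hd : d ∈ bvDiffeo p hp) (hab : Commute a b) (hbc : Commute b c)
    (hcd : Commute c d) (fa : ∃ z, a z = z) (fb : ∃ z, b z = z) (fc : ∃ z, c z = z)
    (fd : ∃ z, d z = z) {y : ℝ} (hf : (d * b * d⁻¹) y ≠ y) (hg : (a⁻¹ * c * a) y ≠ y) :
    (∃ u v, IsGap b u v ∧ IsGap c u v ∧ y ∈ Ioo u v) ∨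
      ∃ s t, IsTwoJump a d y s t ∧ b s = s ∧ c s = s ∧ b (d s) = d s := by
  have hx1 : b (d⁻¹ y) ≠ d⁻¹ y := conj_apply_ne_iff.mp hf
  have hx2 : c (a y) ≠ a y := by
    have : (a⁻¹ * c * a⁻¹⁻¹) y ≠ y := by rwa [inv_inv]
    simpa using conj_apply_ne_iff.mp this
  have hcab : ∀ x, a (b x) = b (a x) := fun x => DFunLike.congr_fun hab.eq x
  have hccd : ∀ x, c (d⁻¹ x) = d⁻¹ (c x) := fun x => DFunLike.congr_fun hcd.inv_right.eq x
  obtain ⟨k1, k2, hK, hKx⟩ := exists_isGap hp hb.1 fb hx1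
  obtain ⟨n1, n2, hN, hNx⟩ := exists_isGap hp hc.1 fc hx2
  by_cases h1 : c (d⁻¹ y) = d⁻¹ y
  swap
  · obtain ⟨u, v, hg', hx⟩ := exists_isGap hp hc.1 fc h1
    obtain ⟨rfl, rfl⟩ := hK.eq_of_commute hp hb.1 hb.2 hc.1 hc.2 hbc hg' hKx hx
    obtain ⟨hdu, hdv⟩ := hg'.apply_ends hp hd.1 hd.2 hc.1 hcd.symm fd
    have := OrderIso.apply_mem_Ioo hdu hdv hKx
    rw [RelIso.apply_inv_self] at this
    exact Or.inl ⟨_, _, hK, hg', this⟩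
  by_cases h2 : b (a y) = a y
  swap
  · obtain ⟨u, v, hg', hx⟩ := exists_isGap hp hb.1 fb h2
    obtain ⟨rfl, rfl⟩ := hg'.eq_of_commute hp hb.1 hb.2 hc.1 hc.2 hbc hN hx hNx
    obtain ⟨hau, hav⟩ := hg'.apply_ends hp ha.1 ha.2 hb.1 hab fa
    have hau' : a⁻¹ u = u := inv_mem (mem_fixingPoint.mpr hau)
    have hav' : a⁻¹ v = v := inv_mem (mem_fixingPoint.mpr hav)
    have := OrderIso.apply_mem_Ioo hau' hav' hx
    rw [RelIso.inv_apply_self] at this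
    exact Or.inl ⟨_, _, hg', hN, this⟩
  right
  have hby : b y = y := a.injective ((hcab y).trans h2)
  have hcy : c y = y := d⁻¹.injective ((hccd y).symm.trans h1)
  have hdy : d y ≠ y := fun h => by
    have : d⁻¹ y = y := inv_mem (mem_fixingPoint.mpr h)
    rw [this] at hx1
    exact hx1 hby
  have hay : a y ≠ y := fun h => by
    rw [h] at hx2
    exact hx2 hcy
  obtain ⟨l1, l2, hL, hLy⟩ := exists_isGap hp hd.1 fd hdy
  obtain ⟨j1, j2, hJ, hJy⟩ := exists_isGap hp ha.1 fa hay
  have hx1L : d⁻¹ y ∈ Ioo l1 l2 := OrderIso.apply_mem_Ioo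
    (inv_mem (mem_fixingPoint.mpr hL.left)) (inv_mem (mem_fixingPoint.mpr hL.right)) hLy
  have hx2J : a y ∈ Ioo j1 j2 := OrderIso.apply_mem_Ioo hJ.left hJ.right hJy
  -- the gap of `a` around `y` does not meet the support of `b`
  have hJb : ∀ x ∈ Ioo j1 j2, b x = x := by
    intro x hx
    by_contra hne
    obtain ⟨u, v, hg', hx'⟩ := exists_isGap hp hb.1 fb hne
    obtain ⟨rfl, rfl⟩ := hJ.eq_of_commute hp ha.1 ha.2 hb.1 hb.2 hab hg' hx hx'
    exact hg'.ne y hJy hby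
  have hLc : ∀ x ∈ Ioo l1 l2, c x = x := by
    intro x hx
    by_contra hne
    obtain ⟨u, v, hg', hx'⟩ := exists_isGap hp hc.1 fc hne
    obtain ⟨rfl, rfl⟩ := hL.eq_of_commute hp hd.1 hd.2 hc.1 hc.2 hcd.symm hg' hx hx'
    exact hg'.ne y hLy hcy
  -- the ends of that gap are fixed by `b`
  have hend : ∀ s, a s = s → (s = j1 ∨ s = j2) → b s = s := by
    intro s hs hs'
    by_contra hne
    obtain ⟨u, v, hg', hx'⟩ := exists_isGap hp hb.1 fb hne
    -- Since a fixes the point s of a gap of b, it is the identity on that gap, which overlaps J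
    -- near s.
    have hid := hg'.eqOn_of_fixed hp hb.1 hb.2 ha.1 hab.symm hx' hs
    rcases hs' with rfl | rfl
    · obtain ⟨w, hw1, hw2⟩ := exists_between (lt_min hx'.2 hJ.lt)
      exact hJ.ne w ⟨hw1, hw2.trans_le (min_le_right _ _)⟩
        (hid w ⟨hx'.1.trans hw1, hw2.trans_le (min_le_left _ _)⟩)
    · obtain ⟨w, hw1, hw2⟩ := exists_between (max_lt hx'.1 hJ.lt)
      exact hJ.ne w ⟨(le_max_right _ _).trans_lt hw1, hw2⟩
        (hid w ⟨(le_max_left _ _).trans_lt hw1, hw2.trans hx'.2⟩)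
  have hx1J : d⁻¹ y ∉ Ioo j1 j2 := fun h => hx1 (hJb _ h)
  have hx2L : a y ∉ Ioo l1 l2 := fun h => hx2 (hLc _ h)
  rcases le_or_gt (d⁻¹ y) j1 with hle | hgt
  · have hj1L : j1 ∈ Ioo l1 l2 := ⟨hx1L.1.trans_le hle, hJy.1.trans hLy.2⟩
    have hl2 : l2 ≤ a y := by
      by_contra! hlt
      exact hx2L ⟨hj1L.1.trans hx2J.1, hlt⟩
    have hl2J : l2 ∈ Ioo j1 j2 := ⟨hj1L.2, hl2.trans_lt hx2J.2⟩
    -- The image of s under d is at least y and below the end l2 of L, hence lies in J, where b is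
    -- the identity. This makes s a fixed point of d⁻¹ b d.
    refine ⟨j1, l2, ⟨hJ.left, hL.right, hL.ne _ hj1L, hJ.ne _ hl2J,
      Or.inl ⟨hle, hJy.1, hLy.2, hl2⟩⟩, hend _ hJ.left (Or.inl rfl), hLc _ hj1L, hJb _ ⟨?_, ?_⟩⟩
    · have := d.monotone hle
      rw [RelIso.apply_inv_self] at this
      exact hJy.1.trans_le this
    · have := d.strictMono hj1L.2
      rw [hL.right] at this
      exact this.trans hl2J.2
  · have hge : j2 ≤ d⁻¹ y := by
      by_contra! hlt
      exact hx1J ⟨hgt, hlt⟩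
    have hj2L : j2 ∈ Ioo l1 l2 := ⟨hLy.1.trans hJy.2, hge.trans_lt hx1L.2⟩
    have hl1 : a y ≤ l1 := by
      by_contra! hlt
      exact hx2L ⟨hlt, hx2J.2.trans hj2L.2⟩
    have hl1J : l1 ∈ Ioo j1 j2 := ⟨hx2J.1.trans_le hl1, hj2L.1⟩
    refine ⟨j2, l1, ⟨hJ.right, hL.left, hL.ne _ hj2L, hJ.ne _ hl1J,
      Or.inr ⟨hl1, hLy.1, hJy.2, hge⟩⟩, hend _ hJ.right (Or.inr rfl), hLc _ hj2L, hJb _ ⟨?_, ?_⟩⟩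
    · have := d.strictMono hj2L.1
      rw [hL.left] at this
      exact hl1J.1.trans this
    · have := d.monotone hge
      rw [RelIso.apply_inv_self] at this
      exact this.trans_lt hJy.2

/-- A point moved by the word comes from a two-jump. -/
theorem exists_isTwoJump_of_pathWord_moved (ha : a ∈ bvDiffeo p hp) (hb : b ∈ bvDiffeo p hp)
    (hc : c ∈ bvDiffeo p hp) (hd : d ∈ bvDiffeo p hp) (hab : Commute a b) (hbc : Commute b c)
    (hcd : Commute c d) (fa : ∃ z, a z = z) (fb : ∃ z, b z = z) (fc : ∃ z, c z = z)
    (fd : ∃ z, d z = z) {x : ℝ} (hx : pathWord a b c d x ≠ x) :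
    ∃ y s t, (y = x ∨ y = (d * b * d⁻¹)⁻¹ x ∨ y = (a⁻¹ * c * a)⁻¹ x) ∧ IsTwoJump a d y s t ∧
      b s = s ∧ c s = s ∧ b (d s) = d s := by
  obtain ⟨y, hyx, hfy, hgy⟩ := OrderIso.exists_moved_of_commutator_moved hx
  rcases exists_isTwoJump_of_moved ha hb hc hd hab hbc hcd fa fb fc fd hfy hgy with
    ⟨u, v, hgb, hgc, hy⟩ | ⟨s, t, h⟩
  swap
  · exact ⟨y, s, t, hyx, h⟩
  -- All four maps preserve the common gap, so x lies in it together with y; but the two factors of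
  -- the word commute there.
  exfalso
  obtain ⟨hau, hdu, hcomm⟩ := commute_on_common_gap ha hb hc hd hab hbc hcd fa fd hgb hgc
  have hf : ∀ w, w ∈ fixingPoint u ⊓ fixingPoint v → ∀ z ∈ Ioo u v, w z ∈ Ioo u v :=
    fun w hw z hz => OrderIso.apply_mem_Ioo hw.1 hw.2 hz
  have ma : a ∈ fixingPoint u ⊓ fixingPoint v := hau
  have md : d ∈ fixingPoint u ⊓ fixingPoint v := hdu
  have mb : b ∈ fixingPoint u ⊓ fixingPoint v := ⟨hgb.left, hgb.right⟩
  have mc : c ∈ fixingPoint u ⊓ fixingPoint v := ⟨hgc.left, hgc.right⟩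
  have mf := mul_mem (mul_mem md mb) (inv_mem md)
  have mg := mul_mem (mul_mem (inv_mem ma) mc) ma
  set f := d * b * d⁻¹
  set g := a⁻¹ * c * a
  have hxm : x ∈ Ioo u v := by
    rcases hyx with rfl | rfl | rfl
    · exact hy
    · have := hf _ mf _ hy
      rwa [RelIso.apply_inv_self] at this
    · have := hf _ mg _ hy
      rwa [RelIso.apply_inv_self] at this
  apply hx
  have h1 := hcomm (f⁻¹ (g⁻¹ x)) (hf _ (inv_mem mf) _ (hf _ (inv_mem mg) _ hxm))
  rw [RelIso.apply_inv_self, RelIso.apply_inv_self] at h1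
  exact h1

end Essential

section Essential

variable {p : ℝ} {hp : 0 < p} {a b c d : ℝ ≃o ℝ}

theorem eventually_apply_ne_of_deriv_ne_one {f : ℝ ≃o ℝ} (hf : f ∈ periodicDiffeo p) {q : ℝ}
    (h : deriv f q ≠ 1) : ∀ᶠ z in 𝓝[≠] q, f z ≠ z := by
  have h1 : HasDerivAt (fun z => f z - z) (deriv f q - 1) q :=
    (hf.2.1 q).hasDerivAt.sub (hasDerivAt_id q)
  have h2 := h1.eventually_ne (c := 0) (sub_ne_zero.mpr h)
  filter_upwards [h2] with z hz he
  exact hz (by rw [he, sub_self])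

theorem exists_deriv_mul_sub_eq {f : ℝ ≃o ℝ} (hf : f ∈ periodicDiffeo p) {x y : ℝ} (hxy : x < y) :
    ∃ z ∈ Ioo x y, f y - f x = deriv f z * (y - x) := by
  obtain ⟨z, hz, h⟩ := exists_deriv_eq_slope f hxy f.continuous.continuousOn
    fun z _ => (hf.2.1 z).differentiableWithinAt
  refine ⟨z, hz, ?_⟩
  rw [h, div_mul_cancel₀ _ (sub_pos.mpr hxy).ne']

/-- There are no two-jumps in a region where the derivatives are close to `1`. -/
theorem not_isTwoJump_of_deriv {f g : ℝ ≃o ℝ} (hf : f ∈ periodicDiffeo p)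
    (hg : g ∈ periodicDiffeo p) {U : Set ℝ} (hU : U.OrdConnected) (hfU : ∀ z ∈ U, deriv f z < 2)
    (hgU : ∀ z ∈ U, 1 / 2 < deriv g z) {y s t : ℝ} (hs : s ∈ U) (hy : y ∈ U) (ht : t ∈ U) :
    ¬ IsTwoJump f g y s t := by
  intro h
  rcases h.order with ⟨h1, h2, h3, h4⟩ | ⟨h1, h2, h3, h4⟩
  -- Measured from s, the slope of f below 2 places y beyond the midpoint of [s, t]; the slope of g
  -- above 1/2 places y before it.
  · have h5 : y ≤ g s := by
      rw [← g⁻¹.le_iff_le, RelIso.inv_apply_self]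
      exact h1
    obtain ⟨z, hz, e1⟩ := exists_deriv_mul_sub_eq hf h2
    obtain ⟨w, hw, e2⟩ := exists_deriv_mul_sub_eq hg (h2.trans h3)
    have h6 := hfU z (hU.out hs hy (Ioo_subset_Icc_self hz))
    have h7 := hgU w (hU.out hs ht (Ioo_subset_Icc_self hw))
    rw [h.left] at e1
    rw [h.right] at e2
    have h8 := mul_lt_mul_of_pos_right h6 (sub_pos.mpr h2)
    have h9 := mul_lt_mul_of_pos_right h7 (sub_pos.mpr (h2.trans h3))
    linarith
  · have h5 : g s ≤ y := by
      rw [← g⁻¹.le_iff_le, RelIso.inv_apply_self]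
      exact h4
    obtain ⟨z, hz, e1⟩ := exists_deriv_mul_sub_eq hf h3
    obtain ⟨w, hw, e2⟩ := exists_deriv_mul_sub_eq hg (h2.trans h3)
    have h6 := hfU z (hU.out hy hs (Ioo_subset_Icc_self hz))
    have h7 := hgU w (hU.out ht hs (Ioo_subset_Icc_self hw))
    rw [h.left] at e1
    rw [h.right] at e2
    have h8 := mul_lt_mul_of_pos_right h6 (sub_pos.mpr h3)
    have h9 := mul_lt_mul_of_pos_right h7 (sub_pos.mpr (h2.trans h3))
    linarith

/-- Two-jumps do not accumulate at a fixed point of `f`. -/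
theorem eventually_not_isTwoJump {f g : ℝ ≃o ℝ} (hf : f ∈ periodicDiffeo p)
    (hg : g ∈ periodicDiffeo p) {q : ℝ} (hq : f q = q) :
    ∀ᶠ y in 𝓝 q, ∀ s t, ¬ IsTwoJump f g y s t := by
  by_contra hcon
  rw [not_eventually] at hcon
  -- The point t lies between y and f y, and both tend to q because f fixes q.
  have key : ∀ U : Set ℝ, U ∈ 𝓝 q → ∃ y s t, IsTwoJump f g y s t ∧ y ∈ U ∧ t ∈ U := by
    intro U hU
    obtain ⟨ε, hε, hb⟩ := Metric.mem_nhds_iff.mp hU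
    have hoc : (Metric.ball q ε).OrdConnected := by
      rw [Real.ball_eq_Ioo]; exact ordConnected_Ioo
    have hball := Metric.ball_mem_nhds q hε
    have hfc : ∀ᶠ y in 𝓝 q, f y ∈ Metric.ball q ε :=
      f.continuous.continuousAt.eventually_mem (by rw [hq]; exact hball)
    obtain ⟨y, hy, hyU, hfy⟩ := (hcon.and_eventually (Filter.Eventually.and hball hfc)).exists
    push Not at hy
    obtain ⟨s, t, hst⟩ := hy
    refine ⟨y, s, t, hst, hb hyU, hb ?_⟩
    rcases hst.order with ⟨h1, h2, h3, h4⟩ | ⟨h1, h2, h3, h4⟩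
    · exact hoc.out hyU hfy ⟨h3.le, h4⟩
    · exact hoc.out hfy hyU ⟨h1, h2.le⟩
  -- The points t are fixed by g and accumulate at q. Once g fixes q, the points s, which lie
  -- between g⁻¹ y and y, accumulate there too.
  have hgq : g q = q := by
    by_contra hne
    obtain ⟨y, s, t, hst, -, ht⟩ :=
      key _ ((isOpen_ne_fun g.continuous continuous_id).mem_nhds hne)
    exact ht hst.right
  have hgq' : g⁻¹ q = q := OrderIso.inv_apply_eq_of_apply_eq hgq
  have key' : ∀ U : Set ℝ, U ∈ 𝓝 q → ∃ y s t, IsTwoJump f g y s t ∧ y ∈ U ∧ t ∈ U ∧ s ∈ U := by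
    intro U hU
    obtain ⟨ε, hε, hb⟩ := Metric.mem_nhds_iff.mp hU
    have hoc : (Metric.ball q ε).OrdConnected := by
      rw [Real.ball_eq_Ioo]; exact ordConnected_Ioo
    have hball := Metric.ball_mem_nhds q hε
    have hgc : ∀ᶠ y in 𝓝 q, g⁻¹ y ∈ Metric.ball q ε :=
      g⁻¹.continuous.continuousAt.eventually_mem (by rw [hgq']; exact hball)
    obtain ⟨y, s, t, hst, ⟨hyU, hgy⟩, htU, -⟩ := key _ (Filter.Eventually.and hball hgc)
    refine ⟨y, s, t, hst, hb hyU, hb htU, hb ?_⟩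
    rcases hst.order with ⟨h1, h2, h3, h4⟩ | ⟨h1, h2, h3, h4⟩
    · exact hoc.out hgy hyU ⟨h1, h2.le⟩
    · exact hoc.out hyU hgy ⟨h3.le, h4⟩
  -- The points s are fixed by f and differ from q, being moved by g; fixed points accumulating at q
  -- force derivative 1. The points t do the same for g.
  have hf1 : deriv f q = 1 := by
    by_contra hne
    have := eventually_nhdsWithin_iff.mp (eventually_apply_ne_of_deriv_ne_one hf hne)
    obtain ⟨y, s, t, hst, -, -, hs⟩ := key' _ this
    exact hs (fun e => hst.left_ne (e ▸ hgq)) hst.left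
  have hg1 : deriv g q = 1 := by
    by_contra hne
    have := eventually_nhdsWithin_iff.mp (eventually_apply_ne_of_deriv_ne_one hg hne)
    obtain ⟨y, s, t, hst, -, ht, -⟩ := key' _ this
    exact ht (fun e => hst.right_ne (e ▸ hq)) hst.right
  have h1 : ∀ᶠ z in 𝓝 q, deriv f z < 2 :=
    hf.2.2.1.continuousAt.eventually (gt_mem_nhds (by rw [hf1]; norm_num))
  have h2 : ∀ᶠ z in 𝓝 q, 1 / 2 < deriv g z :=
    hg.2.2.1.continuousAt.eventually (lt_mem_nhds (by rw [hg1]; norm_num))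
  obtain ⟨ε, hε, hb⟩ := Metric.mem_nhds_iff.mp (h1.and h2)
  obtain ⟨y, s, t, hst, hy, ht, hs⟩ := key' _ (Metric.ball_mem_nhds q hε)
  have hoc : (Metric.ball q ε).OrdConnected := by
    rw [Real.ball_eq_Ioo]; exact ordConnected_Ioo
  exact not_isTwoJump_of_deriv hf hg hoc (fun z hz => (hb hz).1) (fun z hz => (hb hz).2) hs hy ht
    hst

/-- The word with `d` replaced by its inverse is the identity near each common fixed point of `a`,
`c` and `d⁻¹ b d`. -/
theorem eventually_pathWord_inv_apply_eq (ha : a ∈ bvDiffeo p hp) (hb : b ∈ bvDiffeo p hp)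
    (hc : c ∈ bvDiffeo p hp) (hd : d ∈ bvDiffeo p hp) (hab : Commute a b) (hbc : Commute b c)
    (hcd : Commute c d) (fa : ∃ z, a z = z) (fb : ∃ z, b z = z) (fc : ∃ z, c z = z)
    (fd : ∃ z, d z = z) {q : ℝ} (haq : a q = q) (hcq : c q = q) (hbq : (d⁻¹ * b * d) q = q) :
    ∀ᶠ x in 𝓝 q, pathWord a b c d⁻¹ x = x := by
  have fd' : ∃ z, d⁻¹ z = z := by
    obtain ⟨z, hz⟩ := fd
    exact ⟨z, OrderIso.inv_apply_eq_of_apply_eq hz⟩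
  have h0 := eventually_not_isTwoJump ha.1 (inv_mem hd.1) haq
  have hbq' : (d⁻¹ * b * d⁻¹⁻¹) q = q := by rwa [inv_inv]
  have hgq : (a⁻¹ * c * a) q = q :=
    (mul_mem (mul_mem (inv_mem haq) hcq) haq : a⁻¹ * c * a ∈ fixingPoint q)
  have hlim : ∀ f : ℝ ≃o ℝ, f q = q → Tendsto ⇑(f⁻¹) (𝓝 q) (𝓝 q) := fun f hf => by
    have := f⁻¹.continuous.tendsto q
    rwa [OrderIso.inv_apply_eq_of_apply_eq hf] at this
  filter_upwards [h0, (hlim _ hbq').eventually h0, (hlim _ hgq).eventually h0] with x h1 h2 h3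
  by_contra hne
  obtain ⟨y, s, t, hy, hst, -⟩ := exists_isTwoJump_of_pathWord_moved ha hb hc (inv_mem hd) hab hbc
    hcd.inv_right fa fb fc fd' hne
  rcases hy with rfl | rfl | rfl
  · exact h1 _ _ hst
  · exact h2 _ _ hst
  · exact h3 _ _ hst

end Essential

/-! ### Killing the action by displacing supports -/

section Displacement

variable {Λ : Type*} [Group Λ] (ρ : Λ →* (ℝ ≃o ℝ)) (θ : Λ →* TwistTorus) (Γ : Subgroup Λ)

/-- The points moved by some element of `Γ`. -/
def movedSet : Set ℝ := {z | ∃ g ∈ Γ, ρ g z ≠ z}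

/-- The elements whose image in the fibre is nontrivial. -/
def IsFibral (w : Λ) : Prop := θ w ∈ TwistTorus.fib.range ∧ θ w ≠ 1

variable {ρ θ Γ}

theorem apply_of_notMem_movedSet {z : ℝ} (hz : z ∉ movedSet ρ Γ) {g : Λ} (hg : g ∈ Γ) :
    ρ g z = z := by
  by_contra hne
  exact hz ⟨g, hg, hne⟩

theorem map_inv_apply_map (g : Λ) (x : ℝ) : ρ g⁻¹ (ρ g x) = x := by
  rw [map_inv, RelIso.inv_apply_self]

theorem map_apply_map_inv (g : Λ) (x : ℝ) : ρ g (ρ g⁻¹ x) = x := by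
  rw [map_inv, RelIso.apply_inv_self]

/-- A point between x and its image that lies outside the moved set is fixed by g; monotonicity
identifies it with the image of x, and then with x. -/
theorem apply_mem_ordConnectedComponent {x : ℝ} (hx : x ∈ movedSet ρ Γ) {g : Λ} (hg : g ∈ Γ) :
    ρ g x ∈ (movedSet ρ Γ).ordConnectedComponent x := by
  intro z hz
  by_contra hzn
  have h1 := apply_of_notMem_movedSet hzn hg
  have h2 : z = ρ g x := by
    rcases mem_uIcc.mp hz with ⟨h3, h4⟩ | ⟨h3, h4⟩
    · refine h4.antisymm ?_
      rw [← h1]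
      exact (ρ g).monotone h3
    · refine le_antisymm ?_ h3
      rw [← h1]
      exact (ρ g).monotone h4
  have h3 : z = x := (ρ g).injective (h1.trans h2)
  exact hzn (h3 ▸ hx)

theorem isOpen_movedSet : IsOpen (movedSet ρ Γ) := by
  have : movedSet ρ Γ = ⋃ g ∈ Γ, {z | ρ g z ≠ z} := by
    ext z
    simp [movedSet]
  rw [this]
  exact isOpen_biUnion fun g _ => isOpen_ne_fun (ρ g).continuous continuous_id

/-- If the orbit of x₁ stayed below x₂, its supremum would be a global fixed point of Γ in [x₁, x₂].
-/
theorem exists_apply_gt {x₁ x₂ : ℝ} (h : Icc x₁ x₂ ⊆ movedSet ρ Γ) :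
    ∃ g ∈ Γ, x₂ < ρ g x₁ := by
  by_contra! hcon
  set O : Set ℝ := {y | ∃ g ∈ Γ, y = ρ g x₁}
  have hb : BddAbove O := ⟨x₂, by rintro _ ⟨g, hg, rfl⟩; exact hcon g hg⟩
  have hx : x₁ ∈ O := ⟨1, one_mem _, by rw [map_one]; rfl⟩
  have hle : ∀ g ∈ Γ, ρ g (sSup O) ≤ sSup O := by
    intro g hg
    rw [← (ρ g⁻¹).le_iff_le, map_inv_apply_map]
    refine csSup_le ⟨_, hx⟩ ?_
    rintro _ ⟨k, hk, rfl⟩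
    rw [← (ρ g).le_iff_le, map_apply_map_inv]
    refine le_csSup hb ⟨g * k, mul_mem hg hk, ?_⟩
    rw [map_mul]
    rfl
  obtain ⟨g, hg, hne⟩ := h ⟨le_csSup hb hx, csSup_le ⟨_, hx⟩ (by
    rintro _ ⟨g, hg, rfl⟩; exact hcon g hg)⟩
  refine hne ((hle g hg).antisymm ?_)
  have := hle _ (inv_mem hg)
  rwa [← (ρ g).le_iff_le, map_apply_map_inv] at this

theorem IsFibral.exists_notMem_conjStabilizer {w P Q : Λ} (hw : IsFibral θ w)
    (hP : θ P ∈ TwistTorus.fib.range) (hQ : θ Q ∈ TwistTorus.fib.range)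
    (hPQ : ¬ Commute (θ P) (θ Q)) :
    ∃ k, (k = P ∨ k = Q) ∧ θ k ∉ TwistTorus.conjStabilizer (θ w) hw.1 hw.2 := by
  by_contra! hcon
  exact hPQ (TwistTorus.commute_of_mem_conjStabilizer hw.1 hw.2 hP hQ (hcon P (Or.inl rfl))
    (hcon Q (Or.inr rfl)))

/-- An element of `Γ` that moves `x₁` beyond `x₂`, and moves `w` to a conjugate that does not
commute with it. -/
theorem exists_apply_gt_not_commute {w P Q : Λ} (hw : IsFibral θ w)
    (hP : θ P ∈ TwistTorus.fib.range) (hQ : θ Q ∈ TwistTorus.fib.range)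
    (hPQ : ¬ Commute (θ P) (θ Q)) (hPΓ : P ∈ Γ) (hQΓ : Q ∈ Γ) {x₁ x₂ : ℝ}
    (h : Icc x₁ x₂ ⊆ movedSet ρ Γ) :
    ∃ g ∈ Γ, x₂ < ρ g x₁ ∧ ¬ Commute (θ w) (θ g * θ w * (θ g)⁻¹) := by
  obtain ⟨g, hg, hgx⟩ := exists_apply_gt h
  obtain ⟨k, hk, hkE⟩ := hw.exists_notMem_conjStabilizer hP hQ hPQ
  have hkΓ : k ∈ Γ := by rcases hk with rfl | rfl <;> assumption
  set E := TwistTorus.conjStabilizer (θ w) hw.1 hw.2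
  have hE : ∀ g, θ g ∉ E → ¬ Commute (θ w) (θ g * θ w * (θ g)⁻¹) := fun g hg => hg
  by_cases hgE : θ g ∈ E
  swap
  · exact ⟨g, hg, hgx, hE g hgE⟩
  -- Either k or its inverse moves the image of x₁ further right or fixes it, and multiplying g ∈ E
  -- by an element outside E leaves E.
  rcases le_total (ρ g x₁) (ρ k (ρ g x₁)) with hle | hle
  · refine ⟨k * g, mul_mem hkΓ hg, ?_, hE _ ?_⟩
    · rw [map_mul]
      exact hgx.trans_le hle
    · rw [map_mul]
      exact fun hm => hkE ((Subgroup.mul_mem_cancel_right _ hgE).mp hm)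
  · refine ⟨k⁻¹ * g, mul_mem (inv_mem hkΓ) hg, ?_, hE _ ?_⟩
    · rw [map_mul]
      refine hgx.trans_le ?_
      rw [← (ρ k).le_iff_le]
      change _ ≤ ρ k (ρ k⁻¹ (ρ g x₁))
      rwa [map_apply_map_inv]
    · rw [map_mul, map_inv]
      exact fun hm => hkE (inv_mem_iff.mp ((Subgroup.mul_mem_cancel_right _ hgE).mp hm))

theorem map_commutator_apply_ne {w h : Λ} {x : ℝ} (hx : ρ (w * h * w⁻¹ * h⁻¹) x ≠ x) :
    ∃ y, (y = x ∨ y = ρ w⁻¹ x ∨ y = ρ h⁻¹ x) ∧ ρ w y ≠ y ∧ ρ h y ≠ y := by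
  simp only [map_mul, map_inv] at hx ⊢
  exact OrderIso.exists_moved_of_commutator_moved hx

/-- The quotient by the fibre is abelian, so a commutator is automatically in the fibre. -/
theorem IsFibral.commutator {w v : Λ} (h : ¬ Commute (θ w) (θ v)) :
    IsFibral θ (w * v * w⁻¹ * v⁻¹) := by
  simp only [IsFibral, map_mul, map_inv]
  refine ⟨TwistTorus.commutator_mem_range_fib _ _, fun he => h ?_⟩
  rw [mul_inv_eq_one, mul_inv_eq_iff_eq_mul] at he
  exact he

/-- Kill the action of `w` on one component of the moved set. -/
theorem exists_isFibral_trivial_on_component {w P Q : Λ} (hw : IsFibral θ w) (hwΓ : w ∈ Γ)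
    (hP : θ P ∈ TwistTorus.fib.range) (hQ : θ Q ∈ TwistTorus.fib.range)
    (hPQ : ¬ Commute (θ P) (θ Q)) (hPΓ : P ∈ Γ) (hQΓ : Q ∈ Γ)
    (hnear : ∀ z ∉ movedSet ρ Γ, ∀ᶠ x in 𝓝 z, ρ w x = x) (e : ℝ)
    (hA : BddAbove ((movedSet ρ Γ).ordConnectedComponent e))
    (hB : BddBelow ((movedSet ρ Γ).ordConnectedComponent e)) :
    ∃ w' ∈ Γ, IsFibral θ w' ∧ (∀ z ∉ movedSet ρ Γ, ∀ᶠ x in 𝓝 z, ρ w' x = x) ∧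
      (∀ x ∈ (movedSet ρ Γ).ordConnectedComponent e, ρ w' x = x) ∧
      ∀ x, ρ w' x ≠ x → ∃ y ∈ (movedSet ρ Γ).ordConnectedComponent x, ρ w y ≠ y := by
  set C := (movedSet ρ Γ).ordConnectedComponent e with hC
  have hCsub : C ⊆ movedSet ρ Γ := ordConnectedComponent_subset
  have hoc : C.OrdConnected := inferInstance
  have hCg : ∀ g ∈ Γ, ∀ x ∈ C, ρ g x ∈ C := fun g hg x hx =>
    mem_ordConnectedComponent_trans hx (apply_mem_ordConnectedComponent (hCsub hx) hg)
  by_cases hne : ∃ x ∈ C, ρ w x ≠ x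
  swap
  · push Not at hne
    refine ⟨w, hwΓ, hw, hnear, hne, fun x hx => ⟨x, ?_, hx⟩⟩
    exact self_mem_ordConnectedComponent.mpr ⟨w, hwΓ, hx⟩
  set X : Set ℝ := {x | x ∈ C ∧ ρ w x ≠ x}
  have hXne : X.Nonempty := hne
  have hXa : BddAbove X := hA.mono fun x hx => hx.1
  have hXb : BddBelow X := hB.mono fun x hx => hx.1
  -- Near points outside the moved set w is the identity, so X, the support of w in C, stays away
  -- from them.
  have hcl : ∀ z ∈ closure X, z ∈ movedSet ρ Γ := by
    intro z hz
    by_contra hzn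
    obtain ⟨x, hx, hxX⟩ := mem_closure_iff_frequently.mp hz |>.and_eventually (hnear z hzn) |>.exists
    exact hx.2 hxX
  have hIcc : Icc (sInf X) (sSup X) ⊆ movedSet ρ Γ := by
    intro z hz
    rcases hz.1.eq_or_lt with h1 | h1
    · rw [← h1]
      exact hcl _ (csInf_mem_closure hXne hXb)
    rcases hz.2.eq_or_lt with h2 | h2
    · rw [h2]
      exact hcl _ (csSup_mem_closure hXne hXa)
    obtain ⟨x, hx, hxz⟩ := exists_lt_of_csInf_lt hXne h1
    obtain ⟨y, hy, hyz⟩ := exists_lt_of_lt_csSup hXne h2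
    exact hCsub (hoc.out hx.1 hy.1 ⟨hxz.le, hyz.le⟩)
  obtain ⟨g, hg, hgx, hncomm⟩ := exists_apply_gt_not_commute hw hP hQ hPQ hPΓ hQΓ hIcc
  have hvΓ : g * w * g⁻¹ ∈ Γ := mul_mem (mul_mem hg hwΓ) (inv_mem hg)
  have hv : ∀ y, ρ (g * w * g⁻¹) y ≠ y → ρ w (ρ g⁻¹ y) ≠ ρ g⁻¹ y := by
    intro y hy he
    apply hy
    rw [map_mul, map_mul]
    change ρ g (ρ w (ρ g⁻¹ y)) = y
    rw [he, map_apply_map_inv]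
  -- As g moves the infimum of X beyond its supremum, w and its conjugate have disjoint supports in
  -- C. Noncommutation in the fibre keeps their commutator fibral.
  refine ⟨w * (g * w * g⁻¹) * w⁻¹ * (g * w * g⁻¹)⁻¹,
    mul_mem (mul_mem (mul_mem hwΓ hvΓ) (inv_mem hwΓ)) (inv_mem hvΓ), ?_, ?_, ?_, ?_⟩
  · refine IsFibral.commutator ?_
    rwa [map_mul, map_mul, map_inv]
  · intro z hz
    have hlim : ∀ k ∈ Γ, Tendsto (ρ k) (𝓝 z) (𝓝 z) := fun k hk => by
      have := (ρ k).continuous.tendsto z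
      rwa [apply_of_notMem_movedSet hz hk] at this
    filter_upwards [hnear z hz, (hlim _ (inv_mem hwΓ)).eventually (hnear z hz),
      (hlim _ (inv_mem hvΓ)).eventually (hnear z hz)] with x h1 h2 h3
    by_contra hne
    obtain ⟨y, hy, hwy, -⟩ := map_commutator_apply_ne hne
    rcases hy with rfl | rfl | rfl
    · exact hwy h1
    · exact hwy h2
    · exact hwy h3
  · intro x hx
    by_contra hne
    obtain ⟨y, hy, hwy, hvy⟩ := map_commutator_apply_ne hne
    have hyC : y ∈ C := by
      rcases hy with rfl | rfl | rfl
      · exact hx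
      · exact hCg _ (inv_mem hwΓ) _ hx
      · exact hCg _ (inv_mem hvΓ) _ hx
    have h1 : y ≤ sSup X := le_csSup hXa ⟨hyC, hwy⟩
    have h2 : sInf X ≤ ρ g⁻¹ y := csInf_le hXb ⟨hCg _ (inv_mem hg) _ hyC, hv y hvy⟩
    rw [← (ρ g).le_iff_le, map_apply_map_inv] at h2
    linarith
  · intro x hne
    have hxm : x ∈ movedSet ρ Γ :=
      ⟨_, mul_mem (mul_mem (mul_mem hwΓ hvΓ) (inv_mem hwΓ)) (inv_mem hvΓ), hne⟩
    obtain ⟨y, hy, hwy, -⟩ := map_commutator_apply_ne hne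
    refine ⟨y, ?_, hwy⟩
    rcases hy with rfl | rfl | rfl
    · exact self_mem_ordConnectedComponent.mpr hxm
    · exact apply_mem_ordConnectedComponent hxm (inv_mem hwΓ)
    · exact apply_mem_ordConnectedComponent hxm (inv_mem hvΓ)

theorem ordConnectedComponent_subset_Ioo {S : Set ℝ} {e u v : ℝ} (hu : u ∉ S) (hv : v ∉ S)
    (he : e ∈ Icc u v) : S.ordConnectedComponent e ⊆ Ioo u v := by
  intro x hx
  constructor
  · by_contra! hle
    exact hu (hx (mem_uIcc.mpr (Or.inr ⟨hle, he.1⟩)))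
  · by_contra! hle
    exact hv (hx (mem_uIcc.mpr (Or.inl ⟨he.2, hle⟩)))

/-- Since w is the identity near the points fixed by all of Γ, compactness of [q, q + p] leaves
finitely many components of the moved set where w acts. They are killed one at a time; q and q + p
are fixed by Γ, so each component met in this interval is bounded. -/
theorem exists_isFibral_map_eq_one {p : ℝ} (hp : 0 < p) {P Q : Λ}
    (hP : θ P ∈ TwistTorus.fib.range) (hQ : θ Q ∈ TwistTorus.fib.range)
    (hPQ : ¬ Commute (θ P) (θ Q)) (hPΓ : P ∈ Γ) (hQΓ : Q ∈ Γ)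
    (hper : ∀ g ∈ Γ, ∀ x, ρ g (x + p) = ρ g x + p) {q : ℝ} (hq : q ∉ movedSet ρ Γ)
    {w : Λ} (hw : IsFibral θ w) (hwΓ : w ∈ Γ)
    (hnear : ∀ z ∉ movedSet ρ Γ, ∀ᶠ x in 𝓝 z, ρ w x = x) :
    ∃ w' ∈ Γ, IsFibral θ w' ∧ ρ w' = 1 := by
  have hqp : q + p ∉ movedSet ρ Γ := by
    rintro ⟨g, hg, hne⟩
    rw [hper g hg, apply_of_notMem_movedSet hq hg] at hne
    exact hne rfl
  have main : ∀ E : Finset ℝ, (∀ e ∈ E, e ∈ Icc q (q + p)) → ∀ w ∈ Γ, IsFibral θ w →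
      (∀ z ∉ movedSet ρ Γ, ∀ᶠ x in 𝓝 z, ρ w x = x) →
      (∀ x ∈ Icc q (q + p), ρ w x ≠ x → ∃ e ∈ E, x ∈ (movedSet ρ Γ).ordConnectedComponent e) →
      ∃ w' ∈ Γ, IsFibral θ w' ∧ ρ w' = 1 := by
    intro E
    induction E using Finset.induction_on with
    | empty =>
      intro _ w hwΓ hw _ hE
      refine ⟨w, hwΓ, hw, ?_⟩
      have h1 : ∀ x ∈ Icc q (q + p), ρ w x = x := fun x hx => by
        by_contra hne
        simpa using hE x hx hne
      have hzper : ∀ (k : ℤ) x, ρ w (x + k * p) = ρ w x + k * p := by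
        intro k
        induction k using Int.induction_on with
        | zero => simp
        | succ k ih =>
          intro x
          push_cast at ih ⊢
          rw [add_mul, one_mul, ← add_assoc, hper w hwΓ, ih, add_assoc]
        | pred k ih =>
          intro x
          have h2 := hper w hwΓ (x + ((-(k : ℤ) - 1 : ℤ) : ℝ) * p)
          rw [add_assoc, show (((-(k : ℤ) - 1 : ℤ) : ℝ) * p + p) = ((-(k : ℤ) : ℤ) : ℝ) * p by
            push_cast; ring, ih] at h2
          push_cast at h2 ⊢
          linarith
      ext x
      obtain ⟨k, hk, -⟩ := existsUnique_add_zsmul_mem_Ico hp x q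
      have h2 := h1 _ (Ico_subset_Icc_self hk)
      rw [zsmul_eq_mul, hzper] at h2
      exact add_right_cancel h2
    | insert e E he ih =>
      intro hEI w hwΓ hw hnear hE
      have hsub := ordConnectedComponent_subset_Ioo hq hqp (hEI e (by simp))
      obtain ⟨w', hw'Γ, hw', hnear', hfix, hmoved⟩ := exists_isFibral_trivial_on_component hw hwΓ
        hP hQ hPQ hPΓ hQΓ hnear e (bddAbove_Ioo.mono hsub) (bddBelow_Ioo.mono hsub)
      refine ih (fun e' he' => hEI e' (by simp [he'])) w' hw'Γ hw' hnear' fun x hx hne => ?_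
      obtain ⟨y, hy, hwy⟩ := hmoved x hne
      obtain ⟨e', he', hye⟩ := hE y
        (Ioo_subset_Icc_self (ordConnectedComponent_subset_Ioo hq hqp hx hy)) hwy
      have hxe : x ∈ (movedSet ρ Γ).ordConnectedComponent e' :=
        mem_ordConnectedComponent_trans hye (mem_ordConnectedComponent_comm.mp hy)
      rcases Finset.mem_insert.mp he' with rfl | h
      · exact absurd (hfix x hxe) hne
      · exact ⟨e', h, hxe⟩
  have hcov : ∃ E : Finset ℝ, (∀ e ∈ E, e ∈ Icc q (q + p)) ∧ ∀ x ∈ Icc q (q + p), ρ w x ≠ x →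
      ∃ e ∈ E, x ∈ (movedSet ρ Γ).ordConnectedComponent e := by
    refine isCompact_Icc.induction_on (p := fun S => ∃ E : Finset ℝ,
      (∀ e ∈ E, e ∈ Icc q (q + p)) ∧ ∀ x ∈ S, ρ w x ≠ x →
      ∃ e ∈ E, x ∈ (movedSet ρ Γ).ordConnectedComponent e) ⟨∅, by simp, by simp⟩ ?_ ?_ ?_
    · rintro s t hst ⟨E, h1, h2⟩
      exact ⟨E, h1, fun x hx => h2 x (hst hx)⟩
    · rintro s t ⟨E, h1, h2⟩ ⟨E', h1', h2'⟩
      classical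
      refine ⟨E ∪ E', fun e he => ?_, ?_⟩
      · rcases Finset.mem_union.mp he with h | h
        · exact h1 e h
        · exact h1' e h
      · rintro x (hx | hx) hne
        · obtain ⟨e, he, h⟩ := h2 x hx hne
          exact ⟨e, Finset.mem_union_left _ he, h⟩
        · obtain ⟨e, he, h⟩ := h2' x hx hne
          exact ⟨e, Finset.mem_union_right _ he, h⟩
    · intro z hz
      by_cases hzm : z ∈ movedSet ρ Γ
      · exact ⟨_, mem_nhdsWithin_of_mem_nhds (ordConnectedComponent_mem_nhds.mpr
          (isOpen_movedSet.mem_nhds hzm)), {z}, by simpa using hz,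
          fun x hx _ => ⟨z, by simp, hx⟩⟩
      · exact ⟨_, mem_nhdsWithin_of_mem_nhds (hnear z hzm), ∅, by simp,
          fun x hx hne => absurd hx hne⟩
  obtain ⟨E, h1, h2⟩ := hcov
  exact main E h1 w hwΓ hw hnear h2

end Displacement

/-! ### Fibral elements acting trivially on the line -/

/-- No power of `f` maps a point to its translate by a multiple of `p`. -/
def IsAperiodic (p : ℝ) (f : ℝ ≃o ℝ) : Prop :=
  ∀ n : ℕ, 0 < n → ∀ (k : ℤ) (x : ℝ), (f ^ n) x ≠ x + k * p

section Representation

variable {Λ : Type*} [Group Λ] {ρ : Λ →* (ℝ ≃o ℝ)} {θ : Λ →* TwistTorus} {v : Fin 4 → Λ} {N : ℕ}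

theorem commutator_mem_fib_range (g h : Λ) : θ (g * h * g⁻¹ * h⁻¹) ∈ TwistTorus.fib.range := by
  simp only [map_mul, map_inv]
  exact TwistTorus.commutator_mem_range_fib _ _

theorem isFibral_pathWord (hN : 0 < N) (hθ : ∀ i, θ (v i) = TwistTorus.gen i ^ N) :
    IsFibral θ (pathWord (v 0) (v 1) (v 2) (v 3)) := by
  refine ⟨commutator_mem_fib_range _ _, ?_⟩
  rw [map_pathWord]
  simp only [hθ]
  exact TwistTorus.pathWord_gen_pow_ne_one hN

theorem isFibral_pathWord_inv (hN : 0 < N) (hθ : ∀ i, θ (v i) = TwistTorus.gen i ^ N) :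
    IsFibral θ (pathWord (v 0) (v 1) (v 2) (v 3)⁻¹) := by
  refine ⟨commutator_mem_fib_range _ _, ?_⟩
  rw [map_pathWord, map_inv]
  simp only [hθ]
  exact TwistTorus.pathWord_gen_pow_inv_ne_one hN

theorem exists_not_commute_fib (hN : 0 < N) (hθ : ∀ i, θ (v i) = TwistTorus.gen i ^ N)
    {Γ : Subgroup Λ} (h0 : v 0 ∈ Γ) (h2 : v 2 ∈ Γ) :
    ∃ P ∈ Γ, ∃ Q ∈ Γ, θ P ∈ TwistTorus.fib.range ∧ θ Q ∈ TwistTorus.fib.range ∧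
      ¬ Commute (θ P) (θ Q) := by
  have hP := commutator_mem_fib_range (θ := θ) (v 0) (v 2)
  have hPΓ := mul_mem (mul_mem (mul_mem h0 h2) (inv_mem h0)) (inv_mem h2)
  refine ⟨_, hPΓ, v 0 * (v 0 * v 2 * (v 0)⁻¹ * (v 2)⁻¹) * (v 0)⁻¹,
    mul_mem (mul_mem h0 hPΓ) (inv_mem h0), hP, ?_, ?_⟩
  · rw [map_mul, map_mul, map_inv]
    exact TwistTorus.mem_range_fib_conj hP _
  · simp only [map_mul, map_inv, hθ]
    exact TwistTorus.not_commute_commutator_gen_pow hN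

/-- If the word acts nontrivially, a two-jump supplies a point s fixed by a, c and d⁻¹ b d. The word
with d inverted belongs to the group Γ they generate and is the identity near all global fixed
points of Γ, so it can be displaced. -/
theorem exists_isFibral_map_eq_one_of_fixed {p : ℝ} (hp : 0 < p) (hN : 0 < N)
    (hθ : ∀ i, θ (v i) = TwistTorus.gen i ^ N) (hρ : ∀ i, ρ (v i) ∈ bvDiffeo p hp)
    (hcomm : ∀ i j, (SimpleGraph.pathGraph 4).Adj i j → Commute (ρ (v i)) (ρ (v j)))
    (hfix : ∀ i, ∃ z, ρ (v i) z = z) : ∃ W, IsFibral θ W ∧ ρ W = 1 := by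
  have h01 := hcomm 0 1 (by simp [SimpleGraph.pathGraph_adj])
  have h12 := hcomm 1 2 (by simp [SimpleGraph.pathGraph_adj])
  have h23 := hcomm 2 3 (by simp [SimpleGraph.pathGraph_adj])
  by_cases hW : ρ (pathWord (v 0) (v 1) (v 2) (v 3)) = 1
  · exact ⟨_, isFibral_pathWord hN hθ, hW⟩
  obtain ⟨x, hx⟩ : ∃ x, ρ (pathWord (v 0) (v 1) (v 2) (v 3)) x ≠ x := by
    by_contra! hcon
    exact hW (RelIso.ext hcon)
  rw [map_pathWord] at hx
  obtain ⟨y, s, t, -, hst, hbs, hcs, hds⟩ := exists_isTwoJump_of_pathWord_moved (hρ 0) (hρ 1)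
    (hρ 2) (hρ 3) h01 h12 h23 (hfix 0) (hfix 1) (hfix 2) (hfix 3) hx
  set Γ : Subgroup Λ := Subgroup.closure {v 0, v 2, (v 3)⁻¹ * v 1 * v 3} with hΓ
  have m0 : v 0 ∈ Γ := Subgroup.subset_closure (by simp)
  have m2 : v 2 ∈ Γ := Subgroup.subset_closure (by simp)
  have m3 : (v 3)⁻¹ * v 1 * v 3 ∈ Γ := Subgroup.subset_closure (by simp)
  have hs : s ∉ movedSet ρ Γ := by
    rintro ⟨g, hg, hne⟩
    have : Γ ≤ (fixingPoint s).comap ρ := by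
      rw [hΓ, Subgroup.closure_le]
      rintro _ (rfl | rfl | rfl)
      · exact hst.left
      · exact hcs
      · simp only [SetLike.mem_coe, Subgroup.mem_comap, map_mul, map_inv, mem_fixingPoint]
        change (ρ (v 3))⁻¹ (ρ (v 1) (ρ (v 3) s)) = s
        rw [hds, RelIso.inv_apply_self]
    exact hne (this hg)
  have hper : ∀ g ∈ Γ, ∀ x, ρ g (x + p) = ρ g x + p := by
    have : Γ ≤ (periodicDiffeo p).comap ρ := by
      rw [hΓ, Subgroup.closure_le]
      rintro _ (rfl | rfl | rfl)
      · exact (hρ 0).1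
      · exact (hρ 2).1
      · simp only [SetLike.mem_coe, Subgroup.mem_comap, map_mul, map_inv]
        exact mul_mem (mul_mem (inv_mem (hρ 3).1) (hρ 1).1) (hρ 3).1
    exact fun g hg => (this hg).1
  obtain ⟨P, hPΓ, Q, hQΓ, hP, hQ, hPQ⟩ := exists_not_commute_fib hN hθ m0 m2
  have hw : pathWord (v 0) (v 1) (v 2) (v 3)⁻¹ ∈ Γ := by
    have m4 := mul_mem (mul_mem (inv_mem m0) m2) m0
    rw [pathWord, inv_inv]
    exact mul_mem (mul_mem (mul_mem m3 m4) (inv_mem m3)) (inv_mem m4)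
  obtain ⟨W, -, hW, hW1⟩ := exists_isFibral_map_eq_one hp hP hQ hPQ hPΓ hQΓ hper hs
    (isFibral_pathWord_inv hN hθ) hw fun z hz => by
      have := eventually_pathWord_inv_apply_eq (hρ 0) (hρ 1) (hρ 2) (hρ 3) h01 h12 h23 (hfix 0)
        (hfix 1) (hfix 2) (hfix 3) (apply_of_notMem_movedSet hz m0)
        (apply_of_notMem_movedSet hz m2) (by
          have := apply_of_notMem_movedSet hz m3
          rwa [map_mul, map_mul, map_inv] at this)
      rwa [map_pathWord, map_inv]
  exact ⟨W, hW, hW1⟩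

/-- An aperiodic b would make a and c commute, and an aperiodic c would make b and d commute; either
trivializes the word. Only with fixed points of b and c at hand can a and d be treated: if d is
aperiodic then c is the identity, and if a is aperiodic then b is. -/
theorem exists_isFibral_map_eq_one_of_normalized {p : ℝ} (hp : 0 < p) (hN : 0 < N)
    (hθ : ∀ i, θ (v i) = TwistTorus.gen i ^ N) (hρ : ∀ i, ρ (v i) ∈ bvDiffeo p hp)
    (hcomm : ∀ i j, (SimpleGraph.pathGraph 4).Adj i j → Commute (ρ (v i)) (ρ (v j)))
    (hnorm : ∀ i, (∃ z, ρ (v i) z = z) ∨ IsAperiodic p (ρ (v i))) :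
    ∃ W, IsFibral θ W ∧ ρ W = 1 := by
  have h01 := hcomm 0 1 (by simp [SimpleGraph.pathGraph_adj])
  have h12 := hcomm 1 2 (by simp [SimpleGraph.pathGraph_adj])
  have h23 := hcomm 2 3 (by simp [SimpleGraph.pathGraph_adj])
  by_cases hW : ρ (pathWord (v 0) (v 1) (v 2) (v 3)) = 1
  · exact ⟨_, isFibral_pathWord hN hθ, hW⟩
  rw [map_pathWord] at hW
  have f1 : ∃ z, ρ (v 1) z = z := (hnorm 1).resolve_right fun hap => hW
    (pathWord_eq_one_of_commute_ac h12 h23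
      (commute_of_commute_aperiodic (hρ 1) hap (hρ 0).1 (hρ 2).1 h01.symm h12))
  have f2 : ∃ z, ρ (v 2) z = z := (hnorm 2).resolve_right fun hap => hW
    (pathWord_eq_one_of_commute_bd h01 h12
      (commute_of_commute_aperiodic (hρ 2) hap (hρ 1).1 (hρ 3).1 h12.symm h23))
  have f3 : ∃ z, ρ (v 3) z = z := (hnorm 3).resolve_right fun hap => hW
    (pathWord_eq_one_of_commute_ac h12 h23 (by
      rw [eq_one_of_commute_of_aperiodic hp (hρ 3).1 (hρ 3).2 (hρ 2).1 h23.symm hap f2]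
      exact Commute.one_right _))
  have f0 : ∃ z, ρ (v 0) z = z := (hnorm 0).resolve_right fun hap => hW
    (pathWord_eq_one_of_commute_bd h01 h12 (by
      rw [eq_one_of_commute_of_aperiodic hp (hρ 0).1 (hρ 0).2 (hρ 1).1 h01 hap f1]
      exact Commute.one_left _))
  refine exists_isFibral_map_eq_one_of_fixed hp hN hθ hρ hcomm fun i => ?_
  fin_cases i <;> assumption

end Representation

/-- A commutator of elements from two kernels lies in both. If W₁ commuted with all conjugates of
W₂, transitivity of commuting in the fibre would make W₂ commute with all its conjugates, against
the noncommuting pair P, Q. -/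
theorem exists_isFibral_forall_map_eq_one {Λ ι : Type*} [Group Λ] {G : Type*} [Group G]
    {θ : Λ →* TwistTorus} {P Q : Λ} (hP : θ P ∈ TwistTorus.fib.range)
    (hQ : θ Q ∈ TwistTorus.fib.range) (hPQ : ¬ Commute (θ P) (θ Q)) (ρ : ι → Λ →* G)
    (h : ∀ i, ∃ W, IsFibral θ W ∧ ρ i W = 1) (h0 : ∃ W, IsFibral θ W) (s : Finset ι) :
    ∃ W, IsFibral θ W ∧ ∀ i ∈ s, ρ i W = 1 := by
  classical
  induction s using Finset.induction_on with
  | empty => simpa using h0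
  | insert i s hi ih =>
    obtain ⟨W₁, hW₁, h₁⟩ := ih
    obtain ⟨W₂, hW₂, h₂⟩ := h i
    obtain ⟨k, hk⟩ : ∃ k, ¬ Commute (θ W₁) (θ (k * W₂ * k⁻¹)) := by
      by_contra! hcon
      obtain ⟨k, -, hk⟩ := hW₂.exists_notMem_conjStabilizer hP hQ hPQ
      have h1 : Commute (θ W₁) (θ W₂) := by simpa using hcon 1
      have h2 := hcon k
      simp only [map_mul, map_inv] at h2
      exact hk (TwistTorus.commute_trans hW₁.1 hW₂.1
        (TwistTorus.mem_range_fib_conj hW₂.1 _) hW₁.2 h1 h2)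
    refine ⟨_, IsFibral.commutator hk, fun j hj => ?_⟩
    rcases Finset.mem_insert.mp hj with rfl | hj
    · simp [h₂]
    · simp [h₁ j hj]

/-! ### Normalization by powers and translations -/

section Normalize

variable {p : ℝ}

theorem addRight_mem_bvDiffeo (hp : 0 < p) (c : ℝ) : OrderIso.addRight c ∈ bvDiffeo p hp := by
  have h : deriv (⇑(OrderIso.addRight c)) = fun _ => 1 := by
    ext x
    change deriv (fun y : ℝ => y + c) x = 1
    simp
  refine ⟨⟨fun x => ?_, fun x => ?_, ?_, ?_⟩, ?_⟩
  · simp only [OrderIso.addRight_apply]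
    ring
  · change DifferentiableAt ℝ (fun y : ℝ => y + c) x
    fun_prop
  · rw [h]; exact continuous_const
  · rw [h]; exact fun _ => one_pos
  · rw [h]
    exact monotone_const.monotoneOn univ |>.locallyBoundedVariationOn

theorem commute_addRight {f : ℝ ≃o ℝ} (hf : f ∈ periodicDiffeo p) (k : ℤ) :
    Commute (OrderIso.addRight (k * p)) f := by
  ext x
  exact (periodicDiffeo.map_add_int_mul hf x k).symm

theorem addRight_pow (c : ℝ) (n : ℕ) (x : ℝ) : (OrderIso.addRight c ^ n) x = x + n * c := by
  induction n generalizing x with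
  | zero => simp
  | succ n ih =>
    rw [pow_succ, RelIso.mul_apply, ih, OrderIso.addRight_apply]
    push_cast
    ring

/-- Some power of each member of a finite family of periodic diffeomorphisms becomes, after a
translation, aperiodic or has a fixed point. -/
theorem exists_normalized_pow {ι : Type*} (p : ι → ℝ) (F : ι → ℝ ≃o ℝ)
    (hF : ∀ i, F i ∈ periodicDiffeo (p i)) (s : Finset ι) :
    ∃ n : ℕ, 0 < n ∧ ∀ i ∈ s, ∃ k : ℤ,
      (∃ z, (OrderIso.addRight (k * p i) * F i ^ n) z = z) ∨
        IsAperiodic (p i) (OrderIso.addRight (k * p i) * F i ^ n) := by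
  classical
  induction s using Finset.induction_on with
  | empty => exact ⟨1, one_pos, by simp⟩
  | insert i s hi ih =>
    have hpow : ∀ j, ∀ (n m : ℕ) (k : ℤ) x, ((OrderIso.addRight (k * p j) * F j ^ n) ^ m) x =
        (F j ^ (n * m)) x + (m * k : ℤ) * p j := fun j n m k x => by
      rw [(commute_addRight (pow_mem (hF j) n) k).mul_pow, RelIso.mul_apply, addRight_pow,
        ← pow_mul]
      push_cast
      ring
    -- Both alternatives survive powers: the m-th power of the map normalized with exponent n and
    -- shift k is normalized with exponent nm and shift mk. This yields a common exponent.
    have hmul : ∀ j (n m : ℕ), 0 < n → 0 < m → (∃ k : ℤ,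
        (∃ z, (OrderIso.addRight (k * p j) * F j ^ n) z = z) ∨
        IsAperiodic (p j) (OrderIso.addRight (k * p j) * F j ^ n)) → ∃ k : ℤ,
        (∃ z, (OrderIso.addRight (k * p j) * F j ^ (n * m)) z = z) ∨
        IsAperiodic (p j) (OrderIso.addRight (k * p j) * F j ^ (n * m)) := by
      rintro j n m hn hm ⟨k, h⟩
      have he : OrderIso.addRight ((m * k : ℤ) * p j) * F j ^ (n * m) =
          (OrderIso.addRight (k * p j) * F j ^ n) ^ m := by
        ext x
        rw [hpow]
        rfl
      refine ⟨m * k, h.imp ?_ ?_⟩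
      · rintro ⟨z, hz⟩
        rw [he]
        exact ⟨z, pow_mem (mem_fixingPoint.mpr hz) m⟩
      · intro h l hl k' x
        rw [he, ← pow_mul]
        exact h _ (Nat.mul_pos hm hl) k' x
    obtain ⟨n, hn, h⟩ := ih
    obtain ⟨m, hm, h'⟩ : ∃ m : ℕ, 0 < m ∧ ∃ k : ℤ,
        (∃ z, (OrderIso.addRight (k * p i) * F i ^ m) z = z) ∨
        IsAperiodic (p i) (OrderIso.addRight (k * p i) * F i ^ m) := by
      by_cases hap : IsAperiodic (p i) (F i)
      · refine ⟨1, one_pos, 0, Or.inr ?_⟩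
        have : OrderIso.addRight (((0 : ℤ) : ℝ) * p i) * F i ^ 1 = F i := by
          ext x
          simp [RelIso.mul_apply]
        rwa [this]
      · simp only [IsAperiodic] at hap
        push Not at hap
        obtain ⟨m, hm, k, x, hx⟩ := hap
        refine ⟨m, hm, -k, Or.inl ⟨x, ?_⟩⟩
        rw [RelIso.mul_apply, hx, OrderIso.addRight_apply]
        push_cast
        ring
    refine ⟨n * m, Nat.mul_pos hn hm, fun j hj => ?_⟩
    rcases Finset.mem_insert.mp hj with rfl | hj
    · rw [mul_comm]
      exact hmul _ m n hm hn h'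
    · exact hmul _ n m hn hm (h j hj)

end Normalize

/-- For finitely many quadruples of periodic diffeomorphisms that satisfy the relations of the path
with four vertices there is a word, nontrivial in the path group, that acts trivially after passing
to powers and translating. -/
theorem exists_isFibral_of_family {ι : Type*} [Finite ι] (p : ι → ℝ) (hp : ∀ i, 0 < p i)
    (F : ι → Fin 4 → ℝ ≃o ℝ) (hF : ∀ i j, F i j ∈ bvDiffeo (p i) (hp i))
    (hcomm : ∀ i j j', (SimpleGraph.pathGraph 4).Adj j j' → Commute (F i j) (F i j')) :
    ∃ n : ℕ, 0 < n ∧ ∃ G : ι → Fin 4 → ℝ ≃o ℝ,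
      (∀ i j, ∃ k : ℤ, ∀ x, G i j x = (F i j ^ n) x + k * p i) ∧
      ∀ N : ℕ, 0 < N → ∃ W : FreeGroup (Fin 4),
        IsFibral (FreeGroup.lift fun j => TwistTorus.gen j ^ N) W ∧
        ∀ i, FreeGroup.lift (G i) W = 1 := by
  classical
  cases nonempty_fintype ι
  obtain ⟨n, hn, h⟩ := exists_normalized_pow (fun x : ι × Fin 4 => p x.1) (fun x => F x.1 x.2)
    (fun x => (hF x.1 x.2).1) Finset.univ
  choose k hk using fun i j => h (i, j) (Finset.mem_univ _)
  refine ⟨n, hn, fun i j => OrderIso.addRight (k i j * p i) * F i j ^ n,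
    fun i j => ⟨k i j, fun x => rfl⟩, fun N hN => ?_⟩
  have hθ : ∀ i, FreeGroup.lift (fun j => TwistTorus.gen j ^ N) (FreeGroup.of i) =
      TwistTorus.gen i ^ N := fun i => FreeGroup.lift_apply_of
  obtain ⟨P, -, Q, -, hP, hQ, hPQ⟩ :=
    exists_not_commute_fib hN hθ (Γ := ⊤) trivial trivial
  obtain ⟨W, hW, hW1⟩ := exists_isFibral_forall_map_eq_one hP hQ hPQ
    (fun i => FreeGroup.lift fun j => OrderIso.addRight (k i j * p i) * F i j ^ n) (fun i => by
      refine exists_isFibral_map_eq_one_of_normalized (hp i) hN hθ ?_ ?_ ?_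
      · intro j
        rw [FreeGroup.lift_apply_of]
        exact mul_mem (addRight_mem_bvDiffeo _ _) (pow_mem (hF i j) n)
      · intro j j' hj
        rw [FreeGroup.lift_apply_of, FreeGroup.lift_apply_of]
        have h1 : ∀ j, F i j ^ n ∈ periodicDiffeo (p i) := fun j => pow_mem (hF i j).1 n
        have h2 : Commute (OrderIso.addRight (k i j * p i)) (OrderIso.addRight (k i j' * p i)) := by
          refine commute_addRight (addRight_mem_bvDiffeo (hp i) _).1 _
        exact (h2.mul_right (commute_addRight (h1 j') _)).mul_left
          ((commute_addRight (h1 j) _).symm.mul_right ((hcomm i j j' hj).pow_pow n n))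
      · intro j
        rw [FreeGroup.lift_apply_of]
        exact hk i j) ⟨_, isFibral_pathWord hN hθ⟩ Finset.univ
  exact ⟨W, hW, fun i => hW1 i (Finset.mem_univ i)⟩

/-! ### Unit speed curves reflected at the boundary -/

/-- `σ` is a sign. -/
def IsSign (σ : ℝ) : Prop := σ = 1 ∨ σ = -1

namespace IsSign

theorem mul_self {σ : ℝ} (h : IsSign σ) : σ * σ = 1 := by
  rcases h with rfl | rfl <;> norm_num

theorem mul {σ τ : ℝ} (h : IsSign σ) (h' : IsSign τ) : IsSign (σ * τ) := by
  rcases h with rfl | rfl <;> rcases h' with rfl | rfl <;> simp [IsSign]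

theorem abs_eq {σ : ℝ} (h : IsSign σ) : |σ| = 1 := by
  rcases h with rfl | rfl <;> simp

theorem ne_zero {σ : ℝ} (h : IsSign σ) : σ ≠ 0 := by
  rcases h with rfl | rfl <;> norm_num

theorem mul_mul_cancel {σ : ℝ} (h : IsSign σ) (x : ℝ) : σ * (σ * x) = x := by
  rw [← mul_assoc, h.mul_self, one_mul]

theorem tendsto_mul {σ : ℝ} : Tendsto (fun h => σ * h) (𝓝 0) (𝓝 0) := by
  have : Continuous fun h : ℝ => σ * h := by fun_prop
  simpa using this.tendsto 0

theorem tendsto_mul_ne {σ : ℝ} (h : IsSign σ) : Tendsto (fun h => σ * h) (𝓝[≠] 0) (𝓝[≠] 0) := by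
  refine tendsto_nhdsWithin_iff.mpr ⟨tendsto_mul.mono_left nhdsWithin_le_nhds, ?_⟩
  filter_upwards [self_mem_nhdsWithin] with x hx
  exact mul_ne_zero h.ne_zero hx

end IsSign

theorem tendsto_const_add_nhds_zero (t : ℝ) : Tendsto (fun h => t + h) (𝓝 0) (𝓝 t) := by
  have : Continuous fun h : ℝ => t + h := by fun_prop
  simpa using this.tendsto 0

theorem tendsto_sub_nhds_zero (t : ℝ) : Tendsto (fun z => z - t) (𝓝 t) (𝓝 0) := by
  have : Continuous fun z : ℝ => z - t := by fun_prop
  simpa using this.tendsto t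

/-- A family of curves of unit speed through the points of a one-manifold, which are reflected at
the boundary. -/
structure IsFoldedExp {M : Type*} [TopologicalSpace M] (E : M → ℝ → M) : Prop where
  zero : ∀ x, E x 0 = x
  continuousAt : ∀ x, ContinuousAt (E x) 0
  image_mem : ∀ x, ∀ U ∈ 𝓝 (0 : ℝ), E x '' U ∈ 𝓝 x
  restart : ∀ x, ∀ᶠ u in 𝓝 (0 : ℝ), ∃ σ, IsSign σ ∧ ∀ᶠ h in 𝓝 0, E x (u + h) = E (E x u) (σ * h)
  fold : ∀ x, (∃ᶠ h in 𝓝[≠] (0 : ℝ), E x h = E x (-h)) → ∀ᶠ h in 𝓝 (0 : ℝ), E x h = E x (-h)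
  ne : ∀ x, ∀ᶠ u in 𝓝[≠] (0 : ℝ), E x u ≠ x

/-- The curve `γ` is given near `t` by the map `E (γ t)`. -/
abbrev IsBilliardAt {M : Type*} (E : M → ℝ → M) (γ : ℝ → M) (t : ℝ) : Prop :=
  ∃ σ, IsSign σ ∧ ∀ᶠ h in 𝓝 0, γ (t + h) = E (γ t) (σ * h)

/-- The curve `γ` is locally given by the maps `E x`. -/
def IsBilliard {M : Type*} (E : M → ℝ → M) (γ : ℝ → M) (s : Set ℝ) : Prop :=
  ∀ t ∈ s, IsBilliardAt E γ t

section Billiard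

variable {M : Type*} {E : M → ℝ → M} {γ η : ℝ → M} {s : Set ℝ} {t : ℝ}

theorem IsBilliard.mono {s' : Set ℝ} (h : IsBilliard E γ s) (hs : s' ⊆ s) : IsBilliard E γ s' :=
  fun t ht => h t (hs ht)

theorem IsBilliardAt.congr (h : IsBilliardAt E γ t) (he : η =ᶠ[𝓝 t] γ) :
    IsBilliardAt E η t := by
  obtain ⟨σ, hσ, h⟩ := h
  refine ⟨σ, hσ, ?_⟩
  filter_upwards [h, (tendsto_const_add_nhds_zero t).eventually he] with k hk hk'
  rw [hk', hk, he.self_of_nhds]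

theorem IsBilliard.comp_affine (h : IsBilliard E γ s) {a κ : ℝ} (hκ : IsSign κ) :
    IsBilliard E (fun t => γ (a + κ * t)) {t | a + κ * t ∈ s} := by
  intro t ht
  obtain ⟨σ, hσ, h⟩ := h _ ht
  refine ⟨σ * κ, hσ.mul hκ, ?_⟩
  filter_upwards [IsSign.tendsto_mul.eventually h] with k hk
  rw [mul_assoc, ← hk, mul_add, add_assoc]

theorem IsBilliard.exists_germ (hγ : IsBilliard E γ s) {s' : Set ℝ} (hη : IsBilliard E η s')
    (ht : t ∈ s) {t' : ℝ} (ht' : t' ∈ s') (he : γ t = η t') :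
    ∃ κ, IsSign κ ∧ ∀ᶠ h in 𝓝 0, γ (t + h) = η (t' + κ * h) := by
  obtain ⟨σ, hσ, h1⟩ := hγ t ht
  obtain ⟨τ, hτ, h2⟩ := hη t' ht'
  refine ⟨τ * σ, hτ.mul hσ, ?_⟩
  filter_upwards [h1, (IsSign.tendsto_mul (σ := τ * σ)).eventually h2] with k hk hk'
  rw [hk, hk', he, mul_assoc, hτ.mul_mul_cancel]

variable [TopologicalSpace M]

theorem IsBilliard.continuousAt (hE : IsFoldedExp E) (h : IsBilliard E γ s) (ht : t ∈ s) :
    ContinuousAt γ t := by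
  obtain ⟨σ, hσ, h⟩ := h t ht
  have h1 : Tendsto (fun k => E (γ t) (σ * k)) (𝓝 0) (𝓝 (γ t)) := by
    have := (hE.continuousAt (γ t)).tendsto.comp (IsSign.tendsto_mul (σ := σ))
    rwa [hE.zero] at this
  have h2 := (h1.congr' (h.mono fun _ hk => hk.symm)).comp (tendsto_sub_nhds_zero t)
  exact h2.congr fun z => by simp

theorem IsFoldedExp.eventually_eq (hE : IsFoldedExp E) {x : M} {σ τ : ℝ} (hσ : IsSign σ)
    (hτ : IsSign τ) (h : ∃ᶠ k in 𝓝[≠] (0 : ℝ), E x (σ * k) = E x (τ * k)) :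
    ∀ᶠ k in 𝓝 (0 : ℝ), E x (σ * k) = E x (τ * k) := by
  rcases hσ with rfl | rfl <;> rcases hτ with rfl | rfl
  · exact Eventually.of_forall fun _ => rfl
  · simpa using hE.fold x (by simpa using h)
  · have := hE.fold x (by simpa [eq_comm] using h)
    simpa [eq_comm] using this
  · exact Eventually.of_forall fun _ => rfl

/-- The set where the germs agree is open. At a limit point z both curves are the curve through
their common value, up to the sign of the parameter. They agree at points arbitrarily close to z, so
either the signs coincide or the `fold` property makes them irrelevant. -/
theorem IsBilliard.eqOn [T2Space M] (hE : IsFoldedExp E) (hs : IsPreconnected s)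
    (hγ : IsBilliard E γ s) (hη : IsBilliard E η s) (ht : t ∈ s) (h : γ =ᶠ[𝓝 t] η) :
    EqOn γ η s := by
  have hsub : s ⊆ {t | γ =ᶠ[𝓝 t] η} := by
    refine hs.subset_of_closure_inter_subset isOpen_setOfPred_eventually_nhds ⟨t, ht, h⟩ ?_
    rintro z ⟨hz, hzs⟩
    by_contra hzn
    have hf : ∃ᶠ w in 𝓝[≠] z, γ w = η w := by
      rw [mem_closure_iff_frequently] at hz
      rw [frequently_nhdsWithin_iff]
      refine hz.mono fun w hw => ⟨hw.self_of_nhds, ?_⟩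
      rintro rfl
      exact hzn hw
    have hzz : γ z = η z := tendsto_nhds_unique_of_frequently_eq (hγ.continuousAt hE hzs)
      (hη.continuousAt hE hzs) (hf.filter_mono nhdsWithin_le_nhds)
    obtain ⟨σ, hσ, h1⟩ := hγ z hzs
    obtain ⟨τ, hτ, h2⟩ := hη z hzs
    have hlim : Tendsto (fun w => w - z) (𝓝[≠] z) (𝓝[≠] 0) := by
      refine tendsto_nhdsWithin_iff.mpr
        ⟨(tendsto_sub_nhds_zero z).mono_left nhdsWithin_le_nhds, ?_⟩
      filter_upwards [self_mem_nhdsWithin] with w hw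
      exact sub_ne_zero.mpr hw
    have h3 := ((tendsto_sub_nhds_zero z).eventually (h1.and h2)).filter_mono
      (nhdsWithin_le_nhds (s := {z}ᶜ))
    have h4 : ∃ᶠ k in 𝓝[≠] (0 : ℝ), E (γ z) (σ * k) = E (γ z) (τ * k) := by
      refine hlim.frequently ((hf.and_eventually h3).mono ?_)
      rintro w ⟨hw, h5, h6⟩
      rw [← h5]
      conv_rhs => rw [hzz]
      rw [← h6]
      simpa using hw
    refine hzn ?_
    filter_upwards [(tendsto_sub_nhds_zero z).eventually ((h1.and h2).and
      (hE.eventually_eq hσ hτ h4))] with w ⟨⟨h5, h6⟩, h7⟩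
    rw [add_sub_cancel] at h5 h6
    rw [h5, h6, h7, hzz]
  exact fun z hz => (hsub hz).self_of_nhds

theorem IsFoldedExp.exists_isBilliard_ball (hE : IsFoldedExp E) (x : M) :
    ∃ δ > 0, IsBilliard E (E x) (Metric.ball 0 δ) :=
  Metric.eventually_nhds_iff_ball.mp (hE.restart x)

theorem ball_half_add {δ u h : ℝ} (hu : u ∈ Metric.ball (0 : ℝ) (δ / 2))
    (hh : h ∈ Metric.ball (0 : ℝ) (δ / 2)) : u + h ∈ Metric.ball (0 : ℝ) δ := by
  rw [mem_ball_zero_iff] at *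
  have := norm_add_le u h
  linarith

/-- The curve through a point near x is the curve at x with its parameter shifted, which lives for
half the time; compactness makes this time uniform. -/
theorem IsFoldedExp.exists_uniform [CompactSpace M] (hE : IsFoldedExp E) :
    ∃ ε > 0, ∀ x, ∃ η : ℝ → M, IsBilliard E η (Metric.ball 0 ε) ∧ η 0 = x := by
  suffices h : ∃ ε > 0, ∀ x ∈ (univ : Set M), ∃ η : ℝ → M,
      IsBilliard E η (Metric.ball 0 ε) ∧ η 0 = x by
    obtain ⟨ε, hε, h⟩ := h
    exact ⟨ε, hε, fun x => h x trivial⟩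
  refine isCompact_univ.induction_on (p := fun S => ∃ ε > 0, ∀ x ∈ S, ∃ η : ℝ → M,
      IsBilliard E η (Metric.ball 0 ε) ∧ η 0 = x) ⟨1, one_pos, by simp⟩ ?_ ?_ ?_
  · rintro s t hst ⟨ε, hε, h⟩
    exact ⟨ε, hε, fun x hx => h x (hst hx)⟩
  · rintro s t ⟨ε, hε, h⟩ ⟨ε', hε', h'⟩
    refine ⟨min ε ε', lt_min hε hε', ?_⟩
    rintro x (hx | hx)
    · obtain ⟨η, hη, h0⟩ := h x hx
      exact ⟨η, hη.mono (Metric.ball_subset_ball (min_le_left _ _)), h0⟩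
    · obtain ⟨η, hη, h0⟩ := h' x hx
      exact ⟨η, hη.mono (Metric.ball_subset_ball (min_le_right _ _)), h0⟩
  · intro x _
    obtain ⟨δ, hδ, hx⟩ := hE.exists_isBilliard_ball x
    refine ⟨_, mem_nhdsWithin_of_mem_nhds
      (hE.image_mem x _ (Metric.ball_mem_nhds 0 (half_pos hδ))), δ / 2, half_pos hδ, ?_⟩
    rintro _ ⟨u, hu, rfl⟩
    refine ⟨fun h => E x (u + 1 * h), ?_, by simp⟩
    refine (hx.comp_affine (a := u) (κ := 1) (Or.inl rfl)).mono fun h hh => ?_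
    rw [mem_ofPred_eq, one_mul]
    exact ball_half_add hu hh

/-- A local curve of lifetime ε started at time b − ε/2 outlives γ by ε/2, and uniqueness allows
gluing. -/
theorem IsBilliard.exists_extend_right [T2Space M] (hE : IsFoldedExp E) {ε : ℝ} (hε : 0 < ε)
    (hunif : ∀ x, ∃ η : ℝ → M, IsBilliard E η (Metric.ball 0 ε) ∧ η 0 = x) {a b : ℝ}
    (hab : a < b - ε / 2) (hγ : IsBilliard E γ (Ioo a b)) :
    ∃ γ', IsBilliard E γ' (Ioo a (b + ε / 2)) ∧ EqOn γ' γ (Ioo a b) := by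
  set t₁ := b - ε / 2 with ht₁
  have ht₁m : t₁ ∈ Ioo a b := ⟨hab, by linarith⟩
  obtain ⟨η, hη, hη0⟩ := hunif (γ t₁)
  obtain ⟨κ, hκ, hg⟩ := hγ.exists_germ hη ht₁m (Metric.mem_ball_self hε) hη0.symm
  have hη' : IsBilliard E (fun t => η (-(κ * t₁) + κ * t)) (Ioo (t₁ - ε) (t₁ + ε)) := by
    refine (hη.comp_affine (a := -(κ * t₁)) hκ).mono fun t ht => ?_
    rw [mem_ofPred_eq, mem_ball_zero_iff, Real.norm_eq_abs,
      show -(κ * t₁) + κ * t = κ * (t - t₁) by ring, abs_mul, hκ.abs_eq, one_mul, abs_lt]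
    constructor <;> linarith [ht.1, ht.2]
  set η' := fun t => η (-(κ * t₁) + κ * t)
  have hgerm : γ =ᶠ[𝓝 t₁] η' := by
    filter_upwards [(tendsto_sub_nhds_zero t₁).eventually hg] with z hz
    rw [add_sub_cancel] at hz
    rw [hz]
    simp only [η']
    congr 1
    ring
  have hsub : Ioo (max a (t₁ - ε)) b ⊆ Ioo a b := Ioo_subset_Ioo_left (le_max_left _ _)
  have hagree : EqOn γ η' (Ioo (max a (t₁ - ε)) b) := by
    refine (hγ.mono hsub).eqOn hE isPreconnected_Ioo (hη'.mono ?_)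
      (t := t₁) ⟨max_lt hab (by linarith), ht₁m.2⟩ hgerm
    exact Ioo_subset_Ioo (le_max_right _ _) (by linarith)
  classical
  refine ⟨fun t => if t < b then γ t else η' t, ?_, fun t ht => if_pos ht.2⟩
  have h1 : ∀ t < b, (fun t => if t < b then γ t else η' t) =ᶠ[𝓝 t] γ := fun t ht => by
    filter_upwards [gt_mem_nhds ht] with z hz
    exact if_pos hz
  intro t ht
  rcases lt_or_ge t b with hlt | hge
  · exact IsBilliardAt.congr (hγ t ⟨ht.1, hlt⟩) (h1 t hlt)
  · refine IsBilliardAt.congr (hη' t ⟨by linarith, by linarith [ht.2]⟩) ?_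
    have : t₁ < t := by linarith
    filter_upwards [lt_mem_nhds this] with z hz
    rcases lt_or_ge z b with h | h
    · exact (if_pos h).trans (hagree ⟨max_lt (hab.trans hz) (by linarith), h⟩)
    · exact if_neg (not_lt.mpr h)

theorem IsBilliard.exists_extend [T2Space M] (hE : IsFoldedExp E) {ε : ℝ} (hε : 0 < ε)
    (hunif : ∀ x, ∃ η : ℝ → M, IsBilliard E η (Metric.ball 0 ε) ∧ η 0 = x) {r : ℝ}
    (hr : ε ≤ r) (hγ : IsBilliard E γ (Ioo (-r) r)) :
    ∃ γ', IsBilliard E γ' (Ioo (-(r + ε / 2)) (r + ε / 2)) ∧ EqOn γ' γ (Ioo (-r) r) := by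
  obtain ⟨γ₁, h1, e1⟩ := hγ.exists_extend_right hE hε hunif (by linarith)
  have hneg : IsSign (-1) := Or.inr rfl
  have h2 : IsBilliard E (fun t => γ₁ (0 + -1 * t)) (Ioo (-(r + ε / 2)) r) :=
    (h1.comp_affine hneg).mono fun t ht => by
      constructor <;> linarith [ht.1, ht.2]
  obtain ⟨γ₂, h3, e2⟩ := h2.exists_extend_right hE hε hunif (by linarith)
  refine ⟨fun t => γ₂ (0 + -1 * t), (h3.comp_affine hneg).mono fun t ht => ?_, fun t ht => ?_⟩
  · constructor <;> linarith [ht.1, ht.2]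
  · change γ₂ (0 + -1 * t) = γ t
    rw [e2 ⟨by linarith [ht.2], by linarith [ht.1]⟩, ← e1 ht]
    change γ₁ (0 + -1 * (0 + -1 * t)) = γ₁ t
    congr 1
    ring

/-- Each extension gains the fixed length ε/2, so the curves exhaust the line; uniqueness makes them
consistent. -/
theorem IsFoldedExp.exists_isBilliard [T2Space M] [CompactSpace M] (hE : IsFoldedExp E) (x : M) :
    ∃ γ, IsBilliard E γ univ ∧ γ 0 = x := by
  obtain ⟨ε, hε, hunif⟩ := hE.exists_uniform
  obtain ⟨η, hη, hη0⟩ := hunif x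
  have key : ∀ n : ℕ, ∃ γ, IsBilliard E γ (Ioo (-(ε + n * (ε / 2))) (ε + n * (ε / 2))) ∧
      EqOn γ η (Ioo (-ε) ε) := by
    intro n
    induction n with
    | zero =>
      refine ⟨η, hη.mono fun t ht => ?_, fun _ _ => rfl⟩
      rw [mem_ball_zero_iff, Real.norm_eq_abs, abs_lt]
      simpa using ht
    | succ n ih =>
      obtain ⟨γ, h, he⟩ := ih
      have hn : 0 ≤ (n : ℝ) * (ε / 2) := by positivity
      obtain ⟨γ', h', he'⟩ := h.exists_extend hE hε hunif (by linarith)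
      refine ⟨γ', ?_, (he'.mono (Ioo_subset_Ioo (by linarith) (by linarith))).trans he⟩
      convert h' using 2 <;> push_cast <;> ring
  choose γ hγ hγη using key
  set r : ℕ → ℝ := fun n => ε + n * (ε / 2) with hr
  have hrε : ∀ n, ε ≤ r n := fun n => by
    have : 0 ≤ (n : ℝ) * (ε / 2) := by positivity
    simp only [hr]; linarith
  have hagree : ∀ m n t, |t| < r m → |t| < r n → γ m t = γ n t := by
    intro m n t hm hn
    have h0 : 0 < min (r m) (r n) := lt_min (hε.trans_le (hrε m)) (hε.trans_le (hrε n))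
    refine ((hγ m).mono ?_).eqOn hE (s := Ioo (-(min (r m) (r n))) (min (r m) (r n)))
      isPreconnected_Ioo ((hγ n).mono ?_) (t := 0) ⟨by linarith, h0⟩ ?_ ?_
    · exact Ioo_subset_Ioo (neg_le_neg (min_le_left _ _)) (min_le_left _ _)
    · exact Ioo_subset_Ioo (neg_le_neg (min_le_right _ _)) (min_le_right _ _)
    · filter_upwards [Ioo_mem_nhds (neg_lt_zero.mpr hε) hε] with z hz
      rw [hγη m hz, hγη n hz]
    · rw [mem_Ioo, ← abs_lt]
      exact lt_min hm hn
  have hex : ∀ t : ℝ, |t| < r ⌈|t| / (ε / 2)⌉₊ := fun t => by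
    have := Nat.le_ceil (|t| / (ε / 2))
    rw [div_le_iff₀ (by positivity)] at this
    simp only [hr]
    linarith
  refine ⟨fun t => γ ⌈|t| / (ε / 2)⌉₊ t, fun t _ => ?_, ?_⟩
  · have h1 := hγ ⌈|t| / (ε / 2)⌉₊ t (by rw [mem_Ioo, ← abs_lt]; exact hex t)
    refine IsBilliardAt.congr h1 ?_
    filter_upwards [continuous_abs.continuousAt.eventually (gt_mem_nhds (hex t))] with z hz
    exact hagree _ _ z (hex z) hz
  · change γ _ 0 = x
    rw [hγη _ ⟨neg_lt_zero.mpr hε, hε⟩, hη0]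

theorem IsBilliard.continuous (hE : IsFoldedExp E) (h : IsBilliard E γ univ) : Continuous γ :=
  continuous_iff_continuousAt.mpr fun _ => h.continuousAt hE trivial

/-- Global billiard curves that meet differ by an affine change of parameter. -/
theorem IsBilliard.exists_affine [T2Space M] (hE : IsFoldedExp E) (hγ : IsBilliard E γ univ)
    (hs : IsPreconnected s) (hη : IsBilliard E η s) {t' : ℝ} (ht' : t' ∈ s) (he : η t' = γ t) :
    ∃ κ, IsSign κ ∧ ∀ z ∈ s, η z = γ (t + κ * (z - t')) := by
  obtain ⟨κ, hκ, h⟩ := hη.exists_germ hγ ht' (mem_univ t) he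
  have h1 : IsBilliard E (fun z => γ ((t - κ * t') + κ * z)) s :=
    (hγ.comp_affine hκ).mono fun _ _ => trivial
  refine ⟨κ, hκ, fun z hz => ?_⟩
  have h2 : η =ᶠ[𝓝 t'] fun z => γ ((t - κ * t') + κ * z) := by
    filter_upwards [(tendsto_sub_nhds_zero t').eventually h] with w hw
    rw [add_sub_cancel] at hw
    rw [hw]
    congr 1
    ring
  rw [hη.eqOn hE hs h1 ht' h2 hz]
  change γ (t - κ * t' + κ * z) = _
  congr 1
  ring

/-- Curves that meet agree after an affine change of parameter, so γ passes through the centre y as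
well. This makes ranges closed and yields recurrence to an exact point. -/
theorem IsBilliard.exists_apply_eq_of_near [T2Space M] (hE : IsFoldedExp E)
    (hγ : IsBilliard E γ univ) {y : M} {δ : ℝ} (hδ : 0 < δ)
    (hy : IsBilliard E (E y) (Metric.ball 0 δ)) {u : ℝ} (hu : u ∈ Metric.ball (0 : ℝ) δ)
    (he : E y u = γ t) : ∃ t', |t' - t| ≤ |u| ∧ γ t' = y := by
  obtain ⟨κ, hκ, h⟩ := hγ.exists_affine hE (convex_ball (0 : ℝ) δ).isPreconnected hy hu he
  refine ⟨t + κ * (0 - u), ?_, ?_⟩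
  · rw [add_sub_cancel_left, abs_mul, hκ.abs_eq, one_mul, zero_sub, abs_neg]
  · rw [← h 0 (Metric.mem_ball_self hδ), hE.zero]

theorem IsBilliard.isOpen_range (hE : IsFoldedExp E) (hγ : IsBilliard E γ univ) :
    IsOpen (range γ) := by
  rw [isOpen_iff_mem_nhds]
  rintro _ ⟨t, rfl⟩
  obtain ⟨σ, hσ, h⟩ := hγ t trivial
  refine mem_of_superset (hE.image_mem (γ t) _ (IsSign.tendsto_mul (σ := σ) |>.eventually h)) ?_
  rintro _ ⟨u, hu, rfl⟩
  rw [mem_ofPred_eq, hσ.mul_mul_cancel] at hu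
  exact ⟨_, hu⟩

theorem IsBilliard.isClosed_range [T2Space M] (hE : IsFoldedExp E) (hγ : IsBilliard E γ univ) :
    IsClosed (range γ) := by
  refine isClosed_of_closure_subset fun y hy => ?_
  obtain ⟨δ, hδ, hb⟩ := hE.exists_isBilliard_ball y
  obtain ⟨_, ⟨u, hu, rfl⟩, t, ht⟩ :=
    mem_closure_iff_nhds.mp hy _ (hE.image_mem y _ (Metric.ball_mem_nhds 0 hδ))
  obtain ⟨t', -, h⟩ := hγ.exists_apply_eq_of_near hE hδ hb hu ht.symm
  exact ⟨t', h⟩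

theorem IsBilliard.range_eq [T2Space M] (hE : IsFoldedExp E) (hγ : IsBilliard E γ univ) (t : ℝ) :
    range γ = connectedComponent (γ t) := by
  refine Subset.antisymm ?_ ?_
  · exact (isPreconnected_range (hγ.continuous hE)).subset_connectedComponent ⟨t, rfl⟩
  · exact IsClopen.connectedComponent_subset ⟨hγ.isClosed_range hE, hγ.isOpen_range hE⟩ ⟨t, rfl⟩

/-- By compactness the curve passes three times through one point. Two visits give a symmetry of the
curve, a translation or a reflection of the parameter; two successive reflections compose to a
translation by t₃ − t₁. -/
theorem IsBilliard.exists_period [T2Space M] [CompactSpace M] (hE : IsFoldedExp E)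
    (hγ : IsBilliard E γ univ) : ∃ p, p ≠ 0 ∧ ∀ t, γ (t + p) = γ t := by
  obtain ⟨y, hy⟩ := exists_clusterPt_of_compactSpace (map (fun n : ℕ => γ n) atTop)
  obtain ⟨δ, hδ, hb⟩ := hE.exists_isBilliard_ball y
  -- Visits within 1/4 of distinct integers happen at distinct times.
  set ε := min δ (1 / 4) with hεdef
  have hε : 0 < ε := lt_min hδ (by norm_num)
  have hbε := hb.mono (Metric.ball_subset_ball (min_le_left δ (1 / 4)))
  have hfreq : ∃ᶠ n : ℕ in atTop, γ n ∈ E y '' Metric.ball 0 ε :=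
    ClusterPt.frequently (p := fun z => z ∈ E y '' Metric.ball 0 ε) hy
      (hE.image_mem y _ (Metric.ball_mem_nhds 0 hε))
  have hnext : ∀ m : ℕ, ∃ n : ℕ, m < n ∧ ∃ t : ℝ, |t - (n : ℝ)| ≤ 1 / 4 ∧ γ t = y := by
    intro m
    obtain ⟨n, hn, u, hu, he⟩ := (frequently_atTop.mp hfreq) (m + 1)
    obtain ⟨t, ht, h⟩ := hγ.exists_apply_eq_of_near hE hε hbε hu he
    refine ⟨n, hn, t, ht.trans ?_, h⟩
    rw [mem_ball_zero_iff, Real.norm_eq_abs] at hu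
    exact hu.le.trans (min_le_right _ _)
  obtain ⟨n₁, -, t₁, h₁, e₁⟩ := hnext 0
  obtain ⟨n₂, l₂, t₂, h₂, e₂⟩ := hnext n₁
  obtain ⟨n₃, l₃, t₃, h₃, e₃⟩ := hnext n₂
  have l₂' : (n₁ : ℝ) + 1 ≤ n₂ := by exact_mod_cast l₂
  have l₃' : (n₂ : ℝ) + 1 ≤ n₃ := by exact_mod_cast l₃
  rw [abs_le] at h₁ h₂ h₃
  have hper : ∀ s s', γ s = γ s' → ∃ κ, IsSign κ ∧ ∀ z, γ z = γ (s' + κ * (z - s)) := by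
    intro s s' h
    obtain ⟨κ, hκ, h⟩ := hγ.exists_affine hE isPreconnected_univ hγ (mem_univ s) h
    exact ⟨κ, hκ, fun z => h z trivial⟩
  obtain ⟨κ, hκ, h12⟩ := hper t₁ t₂ (e₁.trans e₂.symm)
  obtain ⟨τ, hτ, h23⟩ := hper t₂ t₃ (e₂.trans e₃.symm)
  rcases hκ with rfl | rfl
  · refine ⟨t₂ - t₁, by linarith, fun z => ?_⟩
    rw [h12 z]
    congr 1
    ring
  rcases hτ with rfl | rfl
  · refine ⟨t₃ - t₂, by linarith, fun z => ?_⟩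
    rw [h23 z]
    congr 1
    ring
  · refine ⟨t₃ - t₁, by linarith, fun z => ?_⟩
    rw [h12 z, h23]
    congr 1
    ring

/-- The periods of a global billiard curve form an infinite cyclic group. -/
theorem IsBilliard.exists_minimal_period [T2Space M] [CompactSpace M] (hE : IsFoldedExp E)
    (hγ : IsBilliard E γ univ) :
    ∃ p, 0 < p ∧ ∀ c, (∀ t, γ (t + c) = γ t) ↔ ∃ k : ℤ, c = k * p := by
  set A : AddSubgroup ℝ :=
    { carrier := {c | ∀ t, γ (t + c) = γ t}
      zero_mem' := fun t => by rw [add_zero]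
      add_mem' := fun {a b} ha hb t => by rw [← add_assoc, hb, ha]
      neg_mem' := fun {a} ha t => by rw [← ha (t + -a), neg_add_cancel_right] }
  obtain ⟨c, hc0, hc⟩ := hγ.exists_period hE
  obtain ⟨σ, hσ, hg⟩ := hγ 0 trivial
  have h1 := eventually_nhdsWithin_iff.mp (hσ.tendsto_mul_ne.eventually (hE.ne (γ 0)))
  obtain ⟨δ, hδ, hb⟩ := Metric.eventually_nhds_iff_ball.mp (h1.and hg)
  -- A small positive period would bring the local curve back to its starting point at once, against
  -- `IsFoldedExp.ne`.
  have hiso : Disjoint (A : Set ℝ) (Ioo 0 δ) := by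
    rw [Set.disjoint_left]
    intro a ha hlt
    have hmem : a ∈ Metric.ball (0 : ℝ) δ := by
      rw [mem_ball_zero_iff, Real.norm_eq_abs, abs_of_pos hlt.1]
      exact hlt.2
    obtain ⟨h2, h3⟩ := hb a hmem
    refine h2 hlt.1.ne' ?_
    rw [← h3]
    exact ha 0
  obtain ⟨p, hp⟩ := AddSubgroup.cyclic_of_isolated_zero hδ hiso
  have hmem : ∀ c, (∀ t, γ (t + c) = γ t) ↔ ∃ k : ℤ, c = k * p := fun c => by
    have : c ∈ A ↔ c ∈ AddSubgroup.closure {p} := by rw [hp]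
    rw [AddSubgroup.mem_closure_singleton] at this
    simp only [zsmul_eq_mul, eq_comm (b := c)] at this
    exact this
  have hp0 : p ≠ 0 := by
    rintro rfl
    obtain ⟨k, hk⟩ := (hmem c).mp hc
    exact hc0 (by simpa using hk)
  rcases hp0.lt_or_gt with h | h
  · refine ⟨-p, neg_pos.mpr h, fun c => (hmem c).trans ⟨?_, ?_⟩⟩
    · rintro ⟨k, hk⟩
      exact ⟨-k, by push_cast; linarith⟩
    · rintro ⟨k, hk⟩
      exact ⟨-k, by push_cast; linarith⟩
  · exact ⟨p, h, hmem⟩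

end Billiard

/-! ### Lifting transformations to the parameter line -/

theorem exists_orderIso_of_hasDerivAt {F F' : ℝ → ℝ} (hF : ∀ t, HasDerivAt F (F' t) t) {m : ℝ}
    (hm : 0 < m) (hF' : ∀ t, m ≤ F' t) : ∃ S : ℝ ≃o ℝ, ⇑S = F := by
  have hmono : Monotone fun t => F t - m * t := by
    refine monotone_of_deriv_nonneg (fun t => ?_) fun t => ?_
    · exact ((hF t).sub ((hasDerivAt_id t).const_mul m)).differentiableAt
    · have h : HasDerivAt (fun t => F t - m * t) (F' t - m * 1) t :=
        (hF t).sub ((hasDerivAt_id t).const_mul m)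
      rw [h.deriv]
      linarith [hF' t]
  have hstrict : StrictMono F := fun x y hxy => by
    have h1 := hmono hxy.le
    have h2 := mul_lt_mul_of_pos_left hxy hm
    simp only at h1
    linarith
  have hcont : Continuous F := continuous_iff_continuousAt.mpr fun t => (hF t).continuousAt
  have h1 : Tendsto (fun t => F 0 + m * t) atTop atTop :=
    tendsto_atTop_add_const_left _ _ (tendsto_id.const_mul_atTop hm)
  have h2 : Tendsto (fun t => F 0 + m * t) atBot atBot :=
    tendsto_atBot_add_const_left _ _ (tendsto_id.const_mul_atBot hm)
  have hsurj : Function.Surjective F := by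
    refine hcont.surjective (tendsto_atTop_mono' _ ?_ h1) (tendsto_atBot_mono' _ ?_ h2)
    · filter_upwards [eventually_ge_atTop 0] with t ht
      have := hmono ht
      simp only at this
      linarith
    · filter_upwards [eventually_le_atBot 0] with t ht
      have := hmono ht
      simp only at this
      linarith
  exact ⟨hstrict.orderIsoOfSurjective F hsurj, rfl⟩

theorem locallyBoundedVariationOn_of_nhds {φ : ℝ → ℝ}
    (h : ∀ t, ∃ U ∈ 𝓝 t, BoundedVariationOn φ U) : LocallyBoundedVariationOn φ univ := by
  intro a b _ _
  rw [univ_inter]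
  rcases lt_or_ge b a with hlt | hab
  · rw [Icc_eq_empty_of_lt hlt]
    exact BoundedVariationOn.of_subsingleton subsingleton_empty
  choose U hU hb using h
  obtain ⟨t, ht0, hmono, ⟨m, hm⟩, hsub⟩ := exists_monotone_Icc_subset_open_cover_Icc hab
    (c := fun z : ℝ => {x : Icc a b | (x : ℝ) ∈ interior (U z)})
    (fun z => isOpen_interior.preimage continuous_subtype_val)
    (fun x _ => mem_iUnion.mpr ⟨x, mem_interior_iff_mem_nhds.mpr (hU x)⟩)
  have hstep : ∀ n, BoundedVariationOn φ (Icc (t n : ℝ) (t (n + 1))) := by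
    intro n
    obtain ⟨z, hz⟩ := hsub n
    refine (hb z).mono fun x hx => interior_subset (s := U z) ?_
    have : x ∈ Icc a b := ⟨(t n).2.1.trans hx.1, hx.2.trans (t (n + 1)).2.2⟩
    exact hz (show (⟨x, this⟩ : Icc a b) ∈ Icc (t n) (t (n + 1)) from hx)
  have hall : ∀ n, BoundedVariationOn φ (Icc a (t n : ℝ)) := by
    intro n
    induction n with
    | zero =>
      rw [ht0, Icc_self]
      exact BoundedVariationOn.of_subsingleton subsingleton_singleton
    | succ n ih =>
      have := eVariationOn.Icc_add_Icc φ (s := univ) (t n).2.1 (hmono n.le_succ) trivial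
      simp only [univ_inter] at this
      rw [BoundedVariationOn, ← this]
      exact ENNReal.add_ne_top.mpr ⟨ih, hstep n⟩
  have := hall m
  rwa [hm m le_rfl] at this

theorem periodicDiffeo.abs_sub_le {p : ℝ} (hp : 0 < p) {f : ℝ ≃o ℝ} (hf : f ∈ periodicDiffeo p)
    (x : ℝ) : |f x - x - f 0| ≤ p := by
  have h1 := mul_le_mul_of_nonneg_right (Int.floor_le (x / p)) hp.le
  have h2 := mul_le_mul_of_nonneg_right (Int.lt_floor_add_one (x / p)).le hp.le
  rw [div_mul_cancel₀ _ hp.ne'] at h1 h2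
  have h3 := periodicDiffeo.map_add_int_mul hf 0 ⌊x / p⌋
  have h4 := periodicDiffeo.map_add_int_mul hf 0 (⌊x / p⌋ + 1)
  have h5 : f (0 + ⌊x / p⌋ * p) ≤ f x := f.monotone (by linarith)
  have h6 : f x ≤ f (0 + ((⌊x / p⌋ + 1 : ℤ) : ℝ) * p) := f.monotone (by push_cast; linarith)
  rw [h3] at h5
  rw [h4] at h6
  push_cast at h6
  rw [abs_le]
  constructor <;> linarith

/-- The elements of `G` stretch the curves `E x` by the factor `D`, a cocycle of locally bounded
variation. -/
structure IsStretch {M G : Type*} [TopologicalSpace M] [Group G] [MulAction G M] (E : M → ℝ → M)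
    (D : G → M → ℝ) : Prop where
  continuous : ∀ g, Continuous (D g)
  pos : ∀ g x, 0 < D g x
  mul : ∀ g h x, D (g * h) x = D g (h • x) * D h x
  map : ∀ g x, ∃ σ, IsSign σ ∧
    ∀ᶠ u in 𝓝 (0 : ℝ), g • E x u = E (g • x) (σ * ∫ v in (0 : ℝ)..u, D g (E x v))
  bv : ∀ g x, ∃ U ∈ 𝓝 (0 : ℝ), BoundedVariationOn (fun u => D g (E x u)) U

section Lift

variable {M G : Type*} [TopologicalSpace M] [Group G] [MulAction G M] {E : M → ℝ → M}
  {D : G → M → ℝ} {γ : ℝ → M} {g h : G} {A B : ℝ ≃o ℝ}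

/-- `A` is an orientation-preserving lift of `g` to the parameter of the curve `γ`. -/
structure IsLift (γ : ℝ → M) (D : G → M → ℝ) (g : G) (A : ℝ ≃o ℝ) : Prop where
  map : ∀ t, γ (A t) = g • γ t
  hasDerivAt : ∀ t, HasDerivAt A (D g (γ t)) t

theorem IsStretch.exists_pos_le [CompactSpace M] (hD : IsStretch E D) (g : G) :
    ∃ m, 0 < m ∧ ∀ x, m ≤ D g x := by
  rcases isEmpty_or_nonempty M with hM | hM
  · exact ⟨1, one_pos, fun x => (hM.false x).elim⟩
  · obtain ⟨x₀, -, hx₀⟩ := isCompact_univ.exists_isMinOn univ_nonempty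
      (hD.continuous g).continuousOn
    exact ⟨D g x₀, hD.pos g x₀, fun x => hx₀ (mem_univ x)⟩

theorem IsStretch.one (hD : IsStretch E D) (x : M) : D (1 : G) x = 1 := by
  have h := hD.mul 1 1 x
  rw [mul_one, one_smul] at h
  exact (mul_eq_left₀ (hD.pos 1 x).ne').mp h.symm

/-- The image of a billiard curve under `g` is, up to a change of parameter, the same curve. -/
theorem IsStretch.exists_semilift [T2Space M] [CompactSpace M] (hE : IsFoldedExp E)
    (hD : IsStretch E D) (hγ : IsBilliard E γ univ) {t₀ t₁ : ℝ} (ht : g • γ t₀ = γ t₁) :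
    ∃ F : ℝ → ℝ, ∃ κ, IsSign κ ∧ (∀ t, γ (F t) = g • γ t) ∧
      ∀ t, HasDerivAt F (κ * D g (γ t)) t := by
  have hcont : Continuous fun t => D g (γ t) := (hD.continuous g).comp (hγ.continuous hE)
  obtain ⟨m, hm, hmD⟩ := hD.exists_pos_le g
  have hderiv : ∀ t, HasDerivAt (fun t => ∫ v in (0 : ℝ)..t, D g (γ v)) (D g (γ t)) t := fun t =>
    intervalIntegral.integral_hasDerivAt_right (hcont.intervalIntegrable _ _)
      (hcont.stronglyMeasurableAtFilter _ _) hcont.continuousAt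
  -- S measures length along the image curve; in this parameter the image has unit speed and is
  -- again a billiard curve.
  obtain ⟨S, hS⟩ := exists_orderIso_of_hasDerivAt hderiv hm fun t => hmD _
  have hSt : ∀ t, S t = ∫ v in (0 : ℝ)..t, D g (γ v) := fun t => by rw [hS]
  have hη : IsBilliard E (fun s => g • γ (S.symm s)) univ := by
    intro s _
    set t := S.symm s with ht
    obtain ⟨σ, hσ, h1⟩ := hγ t trivial
    obtain ⟨κ, hκ, h2⟩ := hD.map g (γ t)
    refine ⟨κ * σ, hκ.mul hσ, ?_⟩
    have hlim : Tendsto (fun k => S.symm (s + k) - t) (𝓝 0) (𝓝 0) := by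
      have : Continuous fun k => S.symm (s + k) - t := by fun_prop
      simpa [ht] using this.tendsto 0
    obtain ⟨δ, hδ, hb⟩ := Metric.eventually_nhds_iff_ball.mp h1
    filter_upwards [hlim.eventually (Metric.ball_mem_nhds 0 hδ),
      hlim.eventually ((IsSign.tendsto_mul (σ := σ)).eventually h2)] with k hk hk'
    set l := S.symm (s + k) - t with hl
    have e1 : S.symm (s + k) = t + l := by rw [hl]; ring
    -- Near t the curve is E (γ t) with parameter multiplied by σ. Substitution turns the integral
    -- into σ times the increment of S, which is k.
    have e2 : (∫ v in (0 : ℝ)..(σ * l), D g (E (γ t) v)) = σ * k := by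
      have h3 := intervalIntegral.smul_integral_comp_mul_left (a := 0) (b := l)
        (fun v => D g (E (γ t) v)) σ
      rw [mul_zero] at h3
      rw [← h3, smul_eq_mul]
      congr 1
      have h4 : (∫ v in (0 : ℝ)..l, D g (E (γ t) (σ * v))) =
          ∫ v in (0 : ℝ)..l, D g (γ (t + v)) := by
        refine intervalIntegral.integral_congr fun v hv => ?_
        have hoc : (Metric.ball (0 : ℝ) δ).OrdConnected := by
          rw [Real.ball_eq_Ioo]; exact ordConnected_Ioo
        rw [hb v (hoc.uIcc_subset (Metric.mem_ball_self hδ) hk hv)]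
      have h5 := intervalIntegral.integral_comp_add_left (a := 0) (b := l)
        (fun v => D g (γ v)) t
      have h6 := intervalIntegral.integral_add_adjacent_intervals
        (hcont.intervalIntegrable (μ := MeasureTheory.volume) 0 t)
        (hcont.intervalIntegrable (μ := MeasureTheory.volume) t (t + l))
      rw [← hSt, ← hSt, ← e1, S.apply_symm_apply, ht, S.apply_symm_apply] at h6
      rw [h4, h5, add_zero, ← e1]
      rw [ht]
      linarith
    change g • γ (S.symm (s + k)) = _
    rw [e1, hb l hk, hk', e2, mul_assoc]
  obtain ⟨κ, hκ, hF⟩ := hγ.exists_affine hE isPreconnected_univ hη (mem_univ (S t₀)) (t := t₁)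
    (by simpa using ht)
  refine ⟨fun t => t₁ + κ * (S t - S t₀), κ, hκ, fun t => ?_, fun t => ?_⟩
  · rw [← hF (S t) trivial, S.symm_apply_apply]
  · have h1 : HasDerivAt S (D g (γ t)) t := by
      rw [hS]
      exact hderiv t
    exact ((h1.sub_const _).const_mul κ).const_add t₁

/-- A semilift may reverse the parameter; composing it with itself cancels the sign. -/
theorem IsStretch.exists_isLift_sq [T2Space M] [CompactSpace M] (hE : IsFoldedExp E)
    (hD : IsStretch E D) (hγ : IsBilliard E γ univ) {t₀ t₁ : ℝ} (ht : g • γ t₀ = γ t₁) :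
    ∃ A, IsLift γ D (g * g) A := by
  obtain ⟨F, κ, hκ, hF, hF'⟩ := hD.exists_semilift hE hγ ht
  have hderiv : ∀ t, HasDerivAt (F ∘ F) (D (g * g) (γ t)) t := fun t => by
    have := (hF' (F t)).comp t (hF' t)
    rwa [hF, mul_mul_mul_comm, hκ.mul_self, one_mul, ← hD.mul] at this
  obtain ⟨m, hm, hmD⟩ := hD.exists_pos_le (g * g)
  obtain ⟨A, hA⟩ := exists_orderIso_of_hasDerivAt hderiv hm fun t => hmD _
  refine ⟨A, fun t => ?_, fun t => ?_⟩
  · rw [hA, Function.comp_apply, hF, hF, mul_smul]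
  · rw [hA]
    exact hderiv t

namespace IsLift

theorem mul (hD : IsStretch E D) (hA : IsLift γ D g A) (hB : IsLift γ D h B) :
    IsLift γ D (g * h) (A * B) := by
  refine ⟨fun t => ?_, fun t => ?_⟩
  · rw [RelIso.mul_apply, hA.map, hB.map, mul_smul]
  · rw [hD.mul, ← hB.map]
    exact (hA.hasDerivAt (B t)).comp t (hB.hasDerivAt t)

theorem inv (hD : IsStretch E D) (hA : IsLift γ D g A) : IsLift γ D g⁻¹ A⁻¹ := by
  have hmap : ∀ t, γ (A⁻¹ t) = g⁻¹ • γ t := fun t => by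
    rw [eq_inv_smul_iff, ← hA.map, RelIso.apply_inv_self]
  refine ⟨hmap, fun t => ?_⟩
  have h1 := hD.mul g g⁻¹ (γ t)
  rw [mul_inv_cancel, hD.one] at h1
  rw [eq_inv_of_mul_eq_one_right h1.symm, ← hmap]
  exact (hA.hasDerivAt _).of_local_left_inverse A.symm.continuous.continuousAt (hD.pos _ _).ne'
    (Eventually.of_forall A.apply_symm_apply)

variable {p : ℝ}

-- Two lifts have the same derivative, so they differ by a constant, which must be a period of γ.
omit [TopologicalSpace M] in
theorem exists_eq_add (hper : ∀ c, (∀ t, γ (t + c) = γ t) ↔ ∃ k : ℤ, c = k * p)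
    (hA : IsLift γ D g A) (hB : IsLift γ D g B) : ∃ k : ℤ, ∀ t, A t = B t + k * p := by
  have hd : ∀ t, HasDerivAt (fun t => A t - B t) 0 t := fun t => by
    have := (hA.hasDerivAt t).sub (hB.hasDerivAt t)
    rwa [sub_self] at this
  have hc : ∀ t, A t - B t = A 0 - B 0 := fun t =>
    is_const_of_deriv_eq_zero (fun t => (hd t).differentiableAt) (fun t => (hd t).deriv) t 0
  obtain ⟨k, hk⟩ := (hper (A 0 - B 0)).mp fun s => by
    obtain ⟨t, rfl⟩ := B.surjective s
    rw [← hc t, add_sub_cancel, hA.map, hB.map]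
  exact ⟨k, fun t => by rw [← hk, ← hc t, add_sub_cancel]⟩

omit [TopologicalSpace M] in
theorem exists_pos_eq_add (hp : 0 < p) (hper : ∀ c, (∀ t, γ (t + c) = γ t) ↔ ∃ k : ℤ, c = k * p)
    (hA : IsLift γ D g A) : ∃ k : ℤ, 0 < k ∧ ∀ t, A (t + p) = A t + k * p := by
  have hγp : ∀ t, γ (t + p) = γ t := (hper p).mpr ⟨1, by simp⟩
  have h1 : IsLift γ D g (A * OrderIso.addRight p) := by
    refine ⟨fun t => ?_, fun t => ?_⟩
    · rw [RelIso.mul_apply, OrderIso.addRight_apply, hA.map, hγp]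
    · rw [← hγp]
      exact (hA.hasDerivAt (t + p)).comp_add_const t p
  obtain ⟨k, hk⟩ := h1.exists_eq_add hper hA
  refine ⟨k, ?_, hk⟩
  have h2 : A 0 < A (0 + p) := A.strictMono (by linarith)
  have h3 : A (0 + p) = A 0 + k * p := hk 0
  have h4 : 0 < (k : ℝ) * p := by linarith
  exact_mod_cast (pos_iff_pos_of_mul_pos h4).mpr hp

/-- Both A and its inverse translate by a positive number of periods when the parameter advances by
one period, and these numbers are inverse to each other. -/
theorem apply_add_period (hD : IsStretch E D) (hp : 0 < p)
    (hper : ∀ c, (∀ t, γ (t + c) = γ t) ↔ ∃ k : ℤ, c = k * p) (hA : IsLift γ D g A) (t : ℝ) :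
    A (t + p) = A t + p := by
  obtain ⟨k, hk0, hk⟩ := hA.exists_pos_eq_add hp hper
  obtain ⟨l, hl0, hl⟩ := (hA.inv hD).exists_pos_eq_add hp hper
  have hk1 : (1 : ℝ) ≤ k := by exact_mod_cast hk0
  have hl1 : (1 : ℝ) ≤ l := by exact_mod_cast hl0
  have h1 := hl (A t)
  rw [RelIso.inv_apply_self] at h1
  have h2 : A (A⁻¹ (A t + p)) = A t + p := RelIso.apply_inv_self _ _
  have h3 : A (t + p) ≤ A t + p := by
    rw [← h2, h1]
    exact A.monotone (by nlinarith)
  rw [hk t] at h3 ⊢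
  have h4 : p ≤ k * p := by nlinarith
  linarith

theorem mem_periodicDiffeo (hE : IsFoldedExp E) (hD : IsStretch E D) (hγ : IsBilliard E γ univ)
    (hp : 0 < p) (hper : ∀ c, (∀ t, γ (t + c) = γ t) ↔ ∃ k : ℤ, c = k * p)
    (hA : IsLift γ D g A) : A ∈ periodicDiffeo p := by
  have h : deriv A = fun t => D g (γ t) := funext fun t => (hA.hasDerivAt t).deriv
  refine ⟨hA.apply_add_period hD hp hper, fun t => (hA.hasDerivAt t).differentiableAt, ?_, ?_⟩
  · rw [h]
    exact (hD.continuous g).comp (hγ.continuous hE)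
  · rw [h]
    exact fun t => hD.pos _ _

theorem mem_bvDiffeo (hE : IsFoldedExp E) (hD : IsStretch E D) (hγ : IsBilliard E γ univ)
    (hp : 0 < p) (hper : ∀ c, (∀ t, γ (t + c) = γ t) ↔ ∃ k : ℤ, c = k * p)
    (hA : IsLift γ D g A) : A ∈ bvDiffeo p hp := by
  refine ⟨hA.mem_periodicDiffeo hE hD hγ hp hper, ?_⟩
  have h : deriv A = fun t => D g (γ t) := funext fun t => (hA.hasDerivAt t).deriv
  rw [h]
  refine locallyBoundedVariationOn_of_nhds fun t => ?_
  obtain ⟨σ, hσ, hg⟩ := hγ t trivial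
  obtain ⟨U, hU, hb⟩ := hD.bv g (γ t)
  obtain ⟨ε, hε, hball⟩ := Metric.mem_nhds_iff.mp
    (inter_mem ((IsSign.tendsto_mul (σ := σ)).eventually hU) hg)
  refine ⟨Metric.ball t ε, Metric.ball_mem_nhds t hε, ?_⟩
  have hmem : ∀ z ∈ Metric.ball t ε, z - t ∈ Metric.ball (0 : ℝ) ε := fun z hz => by
    rwa [mem_ball_zero_iff, ← dist_eq_norm]
  have hEq : EqOn (fun z => D g (γ z)) ((fun u => D g (E (γ t) u)) ∘ fun z => σ * (z - t))
      (Metric.ball t ε) := by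
    intro z hz
    have := (hball (hmem z hz)).2
    rw [mem_ofPred_eq, add_sub_cancel] at this
    simp only [this, Function.comp_apply]
  rw [BoundedVariationOn, eVariationOn.congr hEq]
  refine ne_top_of_le_ne_top hb ?_
  have hmaps : MapsTo (fun z => σ * (z - t)) (Metric.ball t ε) U := fun z hz =>
    (hball (hmem z hz)).1
  rcases hσ with rfl | rfl
  · refine eVariationOn.comp_le_of_monotoneOn _ _ (fun x _ y _ hxy => ?_) hmaps
    linarith
  · refine eVariationOn.comp_le_of_antitoneOn _ _ (fun x _ y _ hxy => ?_) hmaps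
    linarith

/-- Lifts of commuting elements commute. -/
theorem commute (hE : IsFoldedExp E) (hD : IsStretch E D) (hγ : IsBilliard E γ univ)
    (hp : 0 < p) (hper : ∀ c, (∀ t, γ (t + c) = γ t) ↔ ∃ k : ℤ, c = k * p)
    (hgh : Commute g h) (hA : IsLift γ D g A) (hB : IsLift γ D h B) : Commute A B := by
  have hAp := hA.mem_periodicDiffeo hE hD hγ hp hper
  have hBp := hB.mem_periodicDiffeo hE hD hγ hp hper
  have h1 := hA.mul hD hB
  rw [hgh.eq] at h1
  obtain ⟨k, hk⟩ := h1.exists_eq_add hper (hB.mul hD hA)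
  -- A defect of k periods between AB and BA grows to nk periods for the n-th power of B, whereas
  -- the displacement bounds allow at most two. Hence n = 3 already forces k = 0.
  have hpow : ∀ n : ℕ, ∀ t, A ((B ^ n) t) = (B ^ n) (A t) + (n * k : ℤ) * p := by
    intro n
    induction n with
    | zero => intro t; simp
    | succ n ih =>
      intro t
      have h2 := hk ((B ^ n) t)
      rw [RelIso.mul_apply, RelIso.mul_apply, ih,
        periodicDiffeo.map_add_int_mul hBp] at h2
      rw [pow_succ', RelIso.mul_apply, h2, RelIso.mul_apply]
      push_cast
      ring
  have h3 := hpow 3 0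
  have h4 := periodicDiffeo.abs_sub_le hp hAp ((B ^ 3) 0)
  have h5 := periodicDiffeo.abs_sub_le hp (pow_mem hBp 3) (A 0)
  rw [h3] at h4
  rw [abs_le] at h4 h5
  push_cast at h3 h4
  have h6 : (3 * k : ℝ) * p ≤ 2 * p := by linarith
  have h7 : -(2 * p) ≤ (3 * k : ℝ) * p := by linarith
  have h8 : (3 * k : ℝ) ≤ 2 := le_of_mul_le_mul_right h6 hp
  have h9 : (-2 : ℝ) ≤ 3 * k := le_of_mul_le_mul_right (by linarith) hp
  have h10 : 3 * k ≤ 2 := by exact_mod_cast h8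
  have h11 : -2 ≤ 3 * k := by exact_mod_cast h9
  have hk0 : k = 0 := by omega
  ext t
  have := hk t
  rwa [hk0, Int.cast_zero, zero_mul, add_zero] at this

end IsLift

end Lift

/-! ### From the lifts on the components to the path group -/

section Components

variable {M G : Type*} [TopologicalSpace M] [Group G] [MulAction G M]

/-- The order of the permutation group of the components serves for all g simultaneously. -/
theorem exists_pow_smul_mem_connectedComponent [Finite (ConnectedComponents M)]
    (hcont : ∀ g : G, Continuous fun x : M => g • x) :
    ∃ n : ℕ, 0 < n ∧ ∀ (g : G) (x : M), g ^ n • x ∈ connectedComponent x := by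
  let _ : MulAction G (ConnectedComponents M) :=
    { smul := fun g c => (hcont g).connectedComponentsMap c
      one_smul := fun c => by
        obtain ⟨x, rfl⟩ := ConnectedComponents.surjective_coe c
        change (ConnectedComponents.mk ((1 : G) • x) : ConnectedComponents M) = _
        rw [one_smul]
      mul_smul := fun g h c => by
        obtain ⟨x, rfl⟩ := ConnectedComponents.surjective_coe c
        change (ConnectedComponents.mk ((g * h) • x) : ConnectedComponents M) =
          ConnectedComponents.mk (g • h • x)
        rw [mul_smul] }
  have hmk : ∀ (g : G) (x : M), g • (ConnectedComponents.mk x) = ConnectedComponents.mk (g • x) :=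
    fun _ _ => rfl
  refine ⟨Nat.card (Equiv.Perm (ConnectedComponents M)), Nat.card_pos, fun g x => ?_⟩
  rw [← ConnectedComponents.coe_eq_coe', ← hmk]
  have h : MulAction.toPermHom G (ConnectedComponents M)
      (g ^ Nat.card (Equiv.Perm (ConnectedComponents M))) = 1 := by
    rw [map_pow, pow_card_eq_one']
  exact DFunLike.congr_fun h (ConnectedComponents.mk x)

theorem IsFoldedExp.finite_connectedComponents [T2Space M] [CompactSpace M] {E : M → ℝ → M}
    (hE : IsFoldedExp E) : Finite (ConnectedComponents M) := by
  have : DiscreteTopology (ConnectedComponents M) := by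
    rw [ConnectedComponents.discreteTopology_iff]
    intro x
    obtain ⟨γ, hγ, rfl⟩ := hE.exists_isBilliard x
    rw [← hγ.range_eq hE]
    exact hγ.isOpen_range hE
  exact finite_of_compact_of_discrete

end Components

theorem exists_pow_mem_of_finiteIndex {A ι : Type*} [Group A] [Finite ι] (K : Subgroup A)
    [K.FiniteIndex] (v : ι → A) : ∃ k : ℕ, 0 < k ∧ ∀ i, v i ^ k ∈ K := by
  cases nonempty_fintype ι
  choose k hk0 _ hk using fun i =>
    Subgroup.exists_pow_mem_of_index_ne_zero (H := K) Subgroup.FiniteIndex.index_ne_zero (v i)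
  refine ⟨∏ i, k i, Finset.prod_pos fun i _ => hk0 i, fun i => ?_⟩
  obtain ⟨c, hc⟩ := Finset.dvd_prod_of_mem k (Finset.mem_univ i)
  rw [hc, pow_mul]
  exact pow_mem (hk i) c

theorem lift_apply_eq_smul {M G ι : Type*} [Group G] [MulAction G M] {γ : ℝ → M}
    {A : ι → ℝ ≃o ℝ} {g : ι → G} (h : ∀ i t, γ (A i t) = g i • γ t) (W : FreeGroup ι) :
    ∀ t, γ (FreeGroup.lift A W t) = FreeGroup.lift g W • γ t := by
  induction W using FreeGroup.induction_on with
  | C1 =>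
    intro t
    rw [map_one, map_one, one_smul]
    rfl
  | of i =>
    intro t
    rw [FreeGroup.lift_apply_of, FreeGroup.lift_apply_of, h]
  | inv_of i ih =>
    intro t
    rw [map_inv, map_inv, eq_inv_smul_iff, ← ih, RelIso.apply_inv_self]
  | mul x y hx hy =>
    intro t
    rw [map_mul, map_mul, RelIso.mul_apply, hx, hy, mul_smul]

/-- The right-angled Artin group on the path with four vertices does not virtually embed into a
group of transformations with stretching factors of bounded variation of a compact
one-dimensional space. -/
theorem not_virtuallyEmbeds_of_isStretch {M G : Type*} [TopologicalSpace M] [T2Space M]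
    [CompactSpace M] [Group G] [MulAction G M] [FaithfulSMul G M] {E : M → ℝ → M}
    {D : G → M → ℝ} (hE : IsFoldedExp E) (hD : IsStretch E D)
    (hcont : ∀ g : G, Continuous fun x : M => g • x) :
    ¬ VirtuallyEmbeds (RightAngledArtinGroup (SimpleGraph.pathGraph 4)) G := by
  rintro ⟨K, hK, φ, hφ⟩
  have := hE.finite_connectedComponents
  set v : Fin 4 → RightAngledArtinGroup (SimpleGraph.pathGraph 4) := fun j => PresentedGroup.of j
  obtain ⟨k, hk, hvK⟩ := exists_pow_mem_of_finiteIndex K v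
  obtain ⟨m, hm, hcomp⟩ := exists_pow_smul_mem_connectedComponent hcont
  have hvcomm : ∀ i j, (SimpleGraph.pathGraph 4).Adj i j → Commute (v i) (v j) := by
    intro i j hij
    have h1 : ((v i)⁻¹ * (v j)⁻¹ * v i * v j) = 1 :=
      PresentedGroup.one_of_mem (rels := {r : FreeGroup (Fin 4) | ∃ v w,
        (SimpleGraph.pathGraph 4).Adj v w ∧ r = (FreeGroup.of v)⁻¹ * (FreeGroup.of w)⁻¹ *
          FreeGroup.of v * FreeGroup.of w}) ⟨i, j, hij, rfl⟩
    rw [mul_assoc, ← mul_inv_rev, inv_mul_eq_one] at h1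
    exact h1.symm
  set b : Fin 4 → G := fun j => φ ⟨v j ^ k, hvK j⟩ with hb
  set u : Fin 4 → G := fun j => b j ^ m with hu
  have hbcomm : ∀ i j, (SimpleGraph.pathGraph 4).Adj i j → Commute (b i) (b j) := by
    intro i j hij
    refine Commute.map (Subtype.ext ?_) φ
    exact ((hvcomm i j hij).pow_pow k k).eq
  choose x hx using fun c : ConnectedComponents M => ConnectedComponents.surjective_coe c
  choose γ hγ hγ0 using fun c : ConnectedComponents M => hE.exists_isBilliard (x c)
  choose p hp hper using fun c => (hγ c).exists_minimal_period hE
  have hlift : ∀ c j, ∃ A, IsLift (γ c) D (u j * u j) A := by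
    intro c j
    have h1 : u j • γ c 0 ∈ range (γ c) := by
      rw [(hγ c).range_eq hE 0]
      exact hcomp (b j) _
    obtain ⟨t₁, ht₁⟩ := h1
    exact hD.exists_isLift_sq hE (hγ c) ht₁.symm
  choose A hA using hlift
  obtain ⟨n, hn, B, hB, hW⟩ := exists_isFibral_of_family p hp A
    (fun c j => (hA c j).mem_bvDiffeo hE hD (hγ c) (hp c) (hper c)) (fun c i j hij => by
      have h1 : Commute (u i) (u j) := (hbcomm i j hij).pow_pow m m
      exact (hA c i).commute hE hD (hγ c) (hp c) (hper c)
        ((h1.mul_right h1).mul_left (h1.mul_right h1)) (hA c j))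
  have hBlift : ∀ c j t, γ c (B c j t) = ((u j * u j) ^ n) • γ c t := by
    intro c j t
    obtain ⟨l, hl⟩ := hB c j
    rw [hl, (hper c (l * p c)).mpr ⟨l, rfl⟩]
    have h1 : ∀ n : ℕ, ∀ t, γ c ((A c j ^ n) t) = ((u j * u j) ^ n) • γ c t := by
      intro n
      induction n with
      | zero => intro t; simp
      | succ n ih =>
        intro t
        rw [pow_succ, RelIso.mul_apply, ih, (hA c j).map, ← mul_smul, ← pow_succ]
    exact h1 n t
  -- The exponent collects the power k that enters K, the power m that preserves components, the
  -- square needed for lifting, and the normalizing power n.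
  obtain ⟨W, hWfib, hW1⟩ := hW (k * (m * 2 * n)) (by positivity)
  -- Every point of M lies on one of the chosen curves, so W acts trivially, and the action is
  -- faithful.
  have htriv : FreeGroup.lift (fun j => (u j * u j) ^ n) W = 1 := by
    refine FaithfulSMul.eq_of_smul_eq_smul (α := M) fun y => ?_
    rw [one_smul]
    obtain ⟨t, ht⟩ : y ∈ range (γ (ConnectedComponents.mk y)) := by
      rw [(hγ _).range_eq hE 0, hγ0, ← ConnectedComponents.coe_eq_coe', hx]
    rw [← ht, ← lift_apply_eq_smul (hBlift _) W, hW1]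
    rfl
  set w : Fin 4 → K := fun j => ⟨v j ^ k, hvK j⟩ ^ (m * 2 * n)
  have h1 : FreeGroup.lift w W = 1 := by
    apply hφ
    rw [map_one, ← htriv]
    have : φ.comp (FreeGroup.lift w) = FreeGroup.lift fun j => (u j * u j) ^ n := by
      ext j
      simp only [MonoidHom.comp_apply, FreeGroup.lift_apply_of, w, map_pow, hu, hb]
      rw [← pow_two, ← pow_mul, ← pow_mul, mul_assoc]
    exact DFunLike.congr_fun this W
  apply hWfib.2
  have h2 : (TwistTorus.ofArtin.comp K.subtype).comp (FreeGroup.lift w) =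
      FreeGroup.lift fun j => TwistTorus.gen j ^ (k * (m * 2 * n)) := by
    refine FreeGroup.ext_hom _ _ fun j => ?_
    simp only [MonoidHom.comp_apply, FreeGroup.lift_apply_of, w, map_pow, Subgroup.subtype_apply, v,
      TwistTorus.ofArtin_of]
    rw [← pow_mul]
  rw [← h2, MonoidHom.comp_apply, h1, map_one]

/-! ### Folding and arc length atlases -/

/-- `J` is the line or one of the two closed half-lines that start at the origin. -/
def IsHalfLine (J : Set ℝ) : Prop := J = univ ∨ J = Ici 0 ∨ J = Iic 0

open Classical in
/-- The reflection of the line onto `J`. -/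
noncomputable def foldOnto (J : Set ℝ) (u : ℝ) : ℝ := if u ∈ J then u else -u

section Fold

variable {J : Set ℝ} {u : ℝ}

theorem foldOnto_of_mem (hu : u ∈ J) : foldOnto J u = u := if_pos hu

theorem foldOnto_univ : foldOnto univ u = u := foldOnto_of_mem trivial

theorem abs_foldOnto : |foldOnto J u| = |u| := by
  unfold foldOnto
  split_ifs
  · rfl
  · exact abs_neg u

theorem IsHalfLine.zero_mem (hJ : IsHalfLine J) : (0 : ℝ) ∈ J := by
  rcases hJ with rfl | rfl | rfl <;> simp

theorem IsHalfLine.ordConnected (hJ : IsHalfLine J) : J.OrdConnected := by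
  rcases hJ with rfl | rfl | rfl
  · exact ordConnected_univ
  · exact ordConnected_Ici
  · exact ordConnected_Iic

theorem IsHalfLine.foldOnto_mem (hJ : IsHalfLine J) : foldOnto J u ∈ J := by
  unfold foldOnto
  split_ifs with h
  · exact h
  · rcases hJ with rfl | rfl | rfl
    · trivial
    · simp only [mem_Ici, not_le] at h ⊢
      linarith
    · simp only [mem_Iic, not_le] at h ⊢
      linarith

theorem foldOnto_zero : foldOnto J 0 = 0 := by
  unfold foldOnto
  split_ifs <;> simp

theorem IsHalfLine.foldOnto_neg (hJ : IsHalfLine J) (hne : J ≠ univ) :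
    foldOnto J (-u) = foldOnto J u := by
  unfold foldOnto
  rcases hJ with rfl | rfl | rfl
  · exact absurd rfl hne
  all_goals
    simp only [mem_Ici, mem_Iic]
    split_ifs <;> linarith

theorem IsHalfLine.foldOnto_sign_mul (hJ : IsHalfLine J) (hne : J ≠ univ) {σ : ℝ}
    (hσ : IsSign σ) : foldOnto J (σ * u) = foldOnto J u := by
  rcases hσ with rfl | rfl
  · rw [one_mul]
  · rw [neg_one_mul, hJ.foldOnto_neg hne]

theorem IsHalfLine.tendsto_foldOnto (hJ : IsHalfLine J) :
    Tendsto (foldOnto J) (𝓝 0) (𝓝[J] 0) := by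
  refine tendsto_nhdsWithin_iff.mpr ⟨?_, Eventually.of_forall fun u => hJ.foldOnto_mem⟩
  rw [tendsto_zero_iff_abs_tendsto_zero]
  have h : abs ∘ foldOnto J = fun u : ℝ => |u| := funext fun u => abs_foldOnto
  rw [h]
  simpa using (continuous_abs.tendsto (0 : ℝ))

theorem IsHalfLine.exists_foldOnto_add (hJ : IsHalfLine J) (hu : J = univ ∨ u ≠ 0) :
    J ∈ 𝓝 (foldOnto J u) ∧
      ∃ κ, IsSign κ ∧ ∀ᶠ h in 𝓝 0, foldOnto J (u + h) = foldOnto J u + κ * h := by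
  have h1 : J = univ → J ∈ 𝓝 (foldOnto J u) ∧
      ∃ κ, IsSign κ ∧ ∀ᶠ h in 𝓝 0, foldOnto J (u + h) = foldOnto J u + κ * h := by
    rintro rfl
    exact ⟨univ_mem, 1, Or.inl rfl, Eventually.of_forall fun h => by simp [foldOnto_univ]⟩
  rcases hu with h | hu
  · exact h1 h
  have hne : foldOnto J u ≠ 0 := by
    rw [← abs_ne_zero, abs_foldOnto, abs_ne_zero]
    exact hu
  have hmem : J ∈ 𝓝 (foldOnto J u) := by
    have := hJ.foldOnto_mem (u := u)
    rcases hJ with rfl | rfl | rfl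
    · exact univ_mem
    · exact Ici_mem_nhds (lt_of_le_of_ne this hne.symm)
    · exact Iic_mem_nhds (lt_of_le_of_ne this hne)
  refine ⟨hmem, ?_⟩
  by_cases huJ : u ∈ J
  · rw [foldOnto_of_mem huJ] at hmem ⊢
    refine ⟨1, Or.inl rfl, ?_⟩
    filter_upwards [(tendsto_const_add_nhds_zero u).eventually hmem] with h hh
    rw [foldOnto_of_mem hh, one_mul]
  · have hnu : J ≠ univ := by
      rintro rfl
      exact huJ trivial
    have he : foldOnto J u = -u := if_neg huJ
    rw [he] at hmem ⊢
    refine ⟨-1, Or.inr rfl, ?_⟩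
    have hlim : Tendsto (fun h => -(u + h)) (𝓝 0) (𝓝 (-u)) := (tendsto_const_add_nhds_zero u).neg
    filter_upwards [hlim.eventually hmem] with h hh
    rw [← hJ.foldOnto_neg hnu, foldOnto_of_mem hh]
    ring

end Fold

/-- Arc length coordinates `S x` of a one-manifold around its points `x`, with inverses `ψ x`
defined on `J x`, and the stretching factors `D g` of transformations. -/
structure IsArcAtlas {M G : Type*} [TopologicalSpace M] [Group G] [MulAction G M]
    (J : M → Set ℝ) (ψ : M → ℝ → M) (S : M → M → ℝ) (D : G → M → ℝ) : Prop where
  shape : ∀ x, IsHalfLine (J x)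
  zero : ∀ x, ψ x 0 = x
  right : ∀ x, ∀ᶠ y in 𝓝 x, ψ x (S x y) = y ∧ S x y ∈ J x
  left : ∀ x, ∀ᶠ s in 𝓝[J x] 0, S x (ψ x s) = s
  continuousAt : ∀ x, ContinuousAt (S x) x
  continuousWithinAt : ∀ x, ∀ᶠ s in 𝓝[J x] 0, ContinuousWithinAt (ψ x) (J x) s
  transition : ∀ g x, ∀ᶠ s in 𝓝[J x] 0, ∃ κ, IsSign κ ∧ ∀ᶠ r in 𝓝[J x] s,
    S (g • ψ x s) (g • ψ x r) = κ * ∫ v in s..r, D g (ψ x v)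
  continuous_smul : ∀ g : G, Continuous fun x : M => g • x
  continuous : ∀ g, Continuous (D g)
  pos : ∀ g x, 0 < D g x
  mul : ∀ g h x, D (g * h) x = D g (h • x) * D h x
  bv : ∀ g x, ∃ U ∈ 𝓝[J x] (0 : ℝ), BoundedVariationOn (fun s => D g (ψ x s)) U

section ArcAtlas

variable {M G : Type*} [TopologicalSpace M] [Group G] [MulAction G M]
  {J : M → Set ℝ} {ψ : M → ℝ → M} {S : M → M → ℝ} {D : G → M → ℝ}

namespace IsArcAtlas

theorem coord_self (h : IsArcAtlas J ψ S D) (x : M) : S x x = 0 := by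
  have := (h.left x).self_of_nhdsWithin (h.shape x).zero_mem
  rwa [h.zero] at this

theorem one (h : IsArcAtlas J ψ S D) (x : M) : D (1 : G) x = 1 := by
  have h1 := h.mul 1 1 x
  rw [mul_one, one_smul] at h1
  exact (mul_eq_left₀ (h.pos 1 x).ne').mp h1.symm

/-- Interior points are mapped to interior points. -/
theorem eventually_eq_univ (h : IsArcAtlas J ψ S D) (g : G) (x : M) :
    ∀ᶠ s in 𝓝[J x] 0, J x ∈ 𝓝 s → J (g • ψ x s) = univ := by
  filter_upwards [h.transition g x, (eventually_eventually_nhdsWithin.mpr (h.continuousWithinAt x)),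
    self_mem_nhdsWithin] with s ⟨κ, hκ, htr⟩ hc hs hJ
  rw [nhdsWithin_eq_nhds.mpr hJ] at htr hc
  have hz : ContinuousAt (fun r => g • ψ x r) s :=
    (h.continuous_smul g).continuousAt.comp (hc.self_of_nhds.continuousAt hJ)
  have hmem := hz.eventually (h.right (g • ψ x s))
  obtain ⟨ε, hε, hb⟩ := Metric.eventually_nhds_iff_ball.mp
    ((htr.and (hmem.and hc)).and (eventually_mem_nhds_iff.mpr hJ))
  have hcont : ContinuousOn (fun v => D g (ψ x v)) (Metric.ball s ε) := fun v hv =>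
    ((h.continuous g).continuousAt.comp
      ((hb v hv).1.2.2.continuousAt (hb v hv).2)).continuousWithinAt
  have hoc : (Metric.ball s ε).OrdConnected := by
    rw [Real.ball_eq_Ioo]; exact ordConnected_Ioo
  have hr1 : s + ε / 2 ∈ Metric.ball s ε := by
    rw [mem_ball_iff_norm, add_sub_cancel_left, Real.norm_eq_abs, abs_of_pos] <;> linarith
  have hr2 : s - ε / 2 ∈ Metric.ball s ε := by
    rw [mem_ball_iff_norm, sub_sub_cancel_left, Real.norm_eq_abs, abs_neg, abs_of_pos] <;> linarith
  have hs0 := Metric.mem_ball_self (x := s) hε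
  -- At an interior point the image coordinate takes values of both signs, which excludes
  -- half-lines.
  have p1 : 0 < ∫ v in s..(s + ε / 2), D g (ψ x v) :=
    intervalIntegral.intervalIntegral_pos_of_pos
      (hcont.mono (hoc.uIcc_subset hs0 hr1)).intervalIntegrable (fun v => h.pos _ _) (by linarith)
  have p2 : 0 < ∫ v in (s - ε / 2)..s, D g (ψ x v) :=
    intervalIntegral.intervalIntegral_pos_of_pos
      (hcont.mono (hoc.uIcc_subset hr2 hs0)).intervalIntegrable (fun v => h.pos _ _) (by linarith)
  have m1 := (hb _ hr1).1.2.1.2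
  have m2 := (hb _ hr2).1.2.1.2
  rw [(hb _ hr1).1.1] at m1
  rw [(hb _ hr2).1.1, intervalIntegral.integral_symm] at m2
  rcases h.shape (g • ψ x s) with e | e | e
  · exact e
  · rw [e, mem_Ici] at m1 m2
    rcases hκ with rfl | rfl <;> linarith
  · rw [e, mem_Iic] at m1 m2
    rcases hκ with rfl | rfl <;> linarith

theorem eq_univ_of_eq_univ (h : IsArcAtlas J ψ S D) (g : G) {x : M} (hx : J x = univ) :
    J (g • x) = univ := by
  have := (h.eventually_eq_univ g x).self_of_nhdsWithin (h.shape x).zero_mem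
  rw [h.zero] at this
  exact this (by rw [hx]; exact univ_mem)

/-- Folding the parameter onto J reflects the curve at boundary points and changes nothing at
interior ones. -/
theorem isFoldedExp (h : IsArcAtlas J ψ S D) :
    IsFoldedExp fun x u => ψ x (foldOnto (J x) u) := by
  have hz : ∀ x, ψ x (foldOnto (J x) 0) = x := fun x => by rw [foldOnto_zero, h.zero]
  refine ⟨hz, fun x => ?_, fun x U hU => ?_, fun x => ?_, fun x hx => ?_, fun x => ?_⟩
  · have h1 := (h.continuousWithinAt x).self_of_nhdsWithin (h.shape x).zero_mem
    have h2 := h1.tendsto.comp (h.shape x).tendsto_foldOnto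
    rw [ContinuousAt, hz]
    rwa [h.zero] at h2
  · have h1 := (h.continuousAt x).tendsto
    rw [h.coord_self] at h1
    filter_upwards [h.right x, h1.eventually hU] with y ⟨hy, hyJ⟩ hyU
    refine ⟨S x y, hyU, ?_⟩
    change ψ x (foldOnto (J x) (S x y)) = y
    rw [foldOnto_of_mem hyJ, hy]
  · filter_upwards [(h.shape x).tendsto_foldOnto.eventually ((h.transition 1 x).and
      ((h.eventually_eq_univ 1 x).and (h.continuousWithinAt x)))] with u ⟨⟨κ, hκ, htr⟩, huniv, hc⟩
    -- Away from the fold the point reached is interior, and the transition for g = 1 is an isometry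
    -- up to sign. At the fold point itself the curve restarts trivially.
    by_cases hu : J x = univ ∨ u ≠ 0
    swap
    · push Not at hu
      refine ⟨1, Or.inl rfl, Eventually.of_forall fun k => ?_⟩
      rw [hu.2, zero_add, one_mul, hz]
    obtain ⟨hJ, τ, hτ, hadd⟩ := (h.shape x).exists_foldOnto_add hu
    have hJy := huniv hJ
    simp only [one_smul] at hJy htr
    rw [nhdsWithin_eq_nhds.mpr hJ] at htr
    set s := foldOnto (J x) u
    have hlim : Tendsto (fun k => s + τ * k) (𝓝 0) (𝓝 s) :=
      (tendsto_const_add_nhds_zero s).comp IsSign.tendsto_mul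
    have hψ : Tendsto (fun k => ψ x (s + τ * k)) (𝓝 0) (𝓝 (ψ x s)) :=
      (hc.continuousAt hJ).tendsto.comp hlim
    refine ⟨κ * τ, hκ.mul hτ, ?_⟩
    filter_upwards [hadd, hlim.eventually htr, hψ.eventually (h.right (ψ x s))] with k h1 h2 h3
    rw [h1, hJy, foldOnto_univ]
    simp only [h.one, intervalIntegral.integral_const, add_sub_cancel_left, smul_eq_mul,
      mul_one] at h2
    rw [mul_assoc, ← h2, h3.1]
  · by_cases hu : J x = univ
    · have h1 := h.left x
      simp only [hu, nhdsWithin_univ, foldOnto_univ] at h1 hx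
      have h2 : Tendsto (fun k : ℝ => -k) (𝓝 0) (𝓝 0) := by
        simpa using (continuous_neg.tendsto (0 : ℝ))
      have h3 : ∀ᶠ k in 𝓝[≠] (0 : ℝ), ψ x k ≠ ψ x (-k) := by
        filter_upwards [h1.filter_mono nhdsWithin_le_nhds,
          (h2.eventually h1).filter_mono nhdsWithin_le_nhds, self_mem_nhdsWithin] with k a b hk he
        rw [he, b] at a
        exact hk (by rw [mem_singleton_iff]; linarith)
      exact absurd hx (not_frequently.mpr h3)
    · exact Eventually.of_forall fun k => by rw [(h.shape x).foldOnto_neg hu]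
  · have h1 := (h.shape x).tendsto_foldOnto.eventually (h.left x)
    filter_upwards [h1.filter_mono nhdsWithin_le_nhds, self_mem_nhdsWithin] with u hu hne he
    rw [he, h.coord_self] at hu
    have := abs_foldOnto (J := J x) (u := u)
    rw [← hu, abs_zero] at this
    exact hne (abs_eq_zero.mp this.symm)

theorem isStretch (h : IsArcAtlas J ψ S D) :
    IsStretch (fun x u => ψ x (foldOnto (J x) u)) D := by
  refine ⟨h.continuous, h.pos, h.mul, fun g x => ?_, fun g x => ?_⟩
  · obtain ⟨κ, hκ, htr⟩ := (h.transition g x).self_of_nhdsWithin (h.shape x).zero_mem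
    rw [h.zero] at htr
    have hc := (h.continuousWithinAt x).self_of_nhdsWithin (h.shape x).zero_mem
    have hlim : Tendsto (fun u => g • ψ x (foldOnto (J x) u)) (𝓝 0) (𝓝 (g • x)) := by
      have h1 := ((h.continuous_smul g).tendsto _).comp
        (hc.tendsto.comp (h.shape x).tendsto_foldOnto)
      rwa [h.zero] at h1
    have hEv := ((h.shape x).tendsto_foldOnto.eventually htr).and
      (hlim.eventually (h.right (g • x)))
    -- At an interior point the sign is that of the transition; at a boundary point the image is a
    -- boundary point too, and folding absorbs every sign.
    by_cases hx : J x = univ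
    · refine ⟨κ, hκ, ?_⟩
      have hgx := h.eq_univ_of_eq_univ g hx
      simp only [hx, hgx, foldOnto_univ] at hEv ⊢
      filter_upwards [hEv] with u ⟨h1, h2⟩
      rw [← h1, h2.1]
    · refine ⟨1, Or.inl rfl, ?_⟩
      have hgx : J (g • x) ≠ univ := fun he => hx (by
        have := h.eq_univ_of_eq_univ g⁻¹ he
        rwa [inv_smul_smul] at this)
      filter_upwards [hEv] with u ⟨h1, h2, h3⟩
      obtain ⟨σ, hσ, hfold⟩ : ∃ σ, IsSign σ ∧ foldOnto (J x) u = σ * u := by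
        unfold foldOnto
        split_ifs
        · exact ⟨1, Or.inl rfl, (one_mul u).symm⟩
        · exact ⟨-1, Or.inr rfl, (neg_one_mul u).symm⟩
      have hint : (∫ v in (0 : ℝ)..foldOnto (J x) u, D g (ψ x v)) =
          σ * ∫ v in (0 : ℝ)..u, D g (ψ x (foldOnto (J x) v)) := by
        have h4 := intervalIntegral.smul_integral_comp_mul_left (a := 0) (b := u)
          (fun v => D g (ψ x (foldOnto (J x) v))) σ
        simp only [mul_zero, (h.shape x).foldOnto_sign_mul hx hσ, smul_eq_mul] at h4
        rw [h4, ← hfold]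
        refine intervalIntegral.integral_congr fun v hv => ?_
        have := (h.shape x).ordConnected.uIcc_subset (h.shape x).zero_mem
          (h.shape x).foldOnto_mem hv
        simp only [foldOnto_of_mem this]
      rw [hint, ← mul_assoc] at h1
      rw [one_mul, ← (h.shape (g • x)).foldOnto_sign_mul hgx (hκ.mul hσ), ← h1,
        foldOnto_of_mem h3, h2]
  · obtain ⟨U, hU, hb⟩ := h.bv g x
    have hev := (h.shape x).tendsto_foldOnto.eventually hU
    obtain ⟨ε, hε, hball⟩ := Metric.eventually_nhds_iff_ball.mp hev
    refine ⟨Metric.ball 0 ε, Metric.ball_mem_nhds 0 hε, ?_⟩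
    have hunion : Metric.ball (0 : ℝ) ε = (Metric.ball 0 ε ∩ Iic 0) ∪ (Metric.ball 0 ε ∩ Ici 0) := by
      rw [← inter_union_distrib_left, Iic_union_Ici, inter_univ]
    have h0 := Metric.mem_ball_self (x := (0 : ℝ)) hε
    have hgr : IsGreatest (Metric.ball (0 : ℝ) ε ∩ Iic 0) 0 :=
      ⟨⟨h0, self_mem_Iic⟩, fun z hz => hz.2⟩
    have hle : IsLeast (Metric.ball (0 : ℝ) ε ∩ Ici 0) 0 :=
      ⟨⟨h0, self_mem_Ici⟩, fun z hz => hz.2⟩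
    rw [BoundedVariationOn, hunion, eVariationOn.union _ hgr hle]
    have hmaps : ∀ K : Set ℝ, MapsTo (foldOnto (J x)) (Metric.ball 0 ε ∩ K) U :=
      fun K z hz => hball z hz.1
    have key : ∀ K : Set ℝ, (MonotoneOn (foldOnto (J x)) K ∨ AntitoneOn (foldOnto (J x)) K) →
        eVariationOn (fun u => D g (ψ x (foldOnto (J x) u))) (Metric.ball 0 ε ∩ K) ≠ ⊤ := by
      rintro K (hK | hK)
      · exact ne_top_of_le_ne_top hb (eVariationOn.comp_le_of_monotoneOn
          (fun s => D g (ψ x s)) _ (hK.mono inter_subset_right) (hmaps K))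
      · exact ne_top_of_le_ne_top hb (eVariationOn.comp_le_of_antitoneOn
          (fun s => D g (ψ x s)) _ (hK.mono inter_subset_right) (hmaps K))
    have hid : ∀ K : Set ℝ, K ⊆ J x → MonotoneOn (foldOnto (J x)) K := fun K hK a ha b hb hab => by
      rwa [foldOnto_of_mem (hK ha), foldOnto_of_mem (hK hb)]
    have hneg : ∀ K : Set ℝ, J x ≠ univ → (∀ z ∈ K, -z ∈ J x) → AntitoneOn (foldOnto (J x)) K :=
      fun K hx hK a ha b hb hab => by
        rw [← (h.shape x).foldOnto_neg hx, ← (h.shape x).foldOnto_neg hx (u := a),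
          foldOnto_of_mem (hK a ha), foldOnto_of_mem (hK b hb)]
        linarith
    refine ENNReal.add_ne_top.mpr ⟨key _ ?_, key _ ?_⟩
    · by_cases hx : J x = univ
      · exact Or.inl (hid _ (by rw [hx]; exact subset_univ _))
      rcases h.shape x with e | e | e
      · exact absurd e hx
      · exact Or.inr (hneg _ hx fun z hz => by
          rw [e, mem_Ici]
          exact neg_nonneg.mpr hz)
      · exact Or.inl (hid _ e.ge)
    · by_cases hx : J x = univ
      · exact Or.inl (hid _ (by rw [hx]; exact subset_univ _))
      rcases h.shape x with e | e | e
      · exact absurd e hx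
      · exact Or.inl (hid _ e.ge)
      · exact Or.inr (hneg _ hx fun z hz => by
          rw [e, mem_Iic]
          exact neg_nonpos.mpr hz)

end IsArcAtlas

end ArcAtlas

theorem IsHalfLine.continuous_foldOnto {J : Set ℝ} (hJ : IsHalfLine J) :
    Continuous (foldOnto J) := by
  rcases hJ with rfl | rfl | rfl
  · exact continuous_id.congr fun u => foldOnto_univ.symm
  · refine continuous_abs.congr fun u => ?_
    unfold foldOnto
    split_ifs with h
    · exact abs_of_nonneg h
    · exact abs_of_neg (not_le.mp h)
  · refine continuous_abs.neg.congr fun u => ?_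
    rw [Pi.neg_apply]
    unfold foldOnto
    split_ifs with h
    · rw [abs_of_nonpos h, neg_neg]
    · rw [abs_of_pos (not_le.mp h)]

/-- A nondegenerate interval agrees with a line or a closed half-line near each of its points. -/
theorem Convex.exists_isHalfLine {R : Set ℝ} (hR : Convex ℝ R) (hn : R.Nontrivial) {c : ℝ}
    (hc : c ∈ R) : ∃ J, IsHalfLine J ∧ ∀ᶠ t in 𝓝 c, (t ∈ R ↔ t - c ∈ J) := by
  have hord := hR.ordConnected
  by_cases h1 : ∃ d ∈ R, c < d
  · obtain ⟨d, hd, hcd⟩ := h1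
    by_cases h2 : ∃ d ∈ R, d < c
    · obtain ⟨d', hd', hcd'⟩ := h2
      refine ⟨univ, Or.inl rfl, ?_⟩
      filter_upwards [Icc_mem_nhds hcd' hcd] with t ht
      exact iff_of_true (hord.out hd' hd ht) trivial
    · push Not at h2
      refine ⟨Ici 0, Or.inr (Or.inl rfl), ?_⟩
      filter_upwards [Iic_mem_nhds hcd] with t ht
      simp only [mem_Ici, sub_nonneg]
      exact ⟨h2 t, fun h => hord.out hc hd ⟨h, ht⟩⟩
  · push Not at h1
    obtain ⟨d, hd, hdc⟩ := hn.exists_ne c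
    have hdc' : d < c := lt_of_le_of_ne (h1 d hd) hdc
    refine ⟨Iic 0, Or.inr (Or.inr rfl), ?_⟩
    filter_upwards [Ici_mem_nhds hdc'] with t ht
    simp only [mem_Iic, sub_nonpos]
    exact ⟨h1 t, fun h => hord.out hd hc ⟨ht, h⟩⟩

theorem IsHalfLine.orderIso_mem_iff {J : Set ℝ} (hJ : IsHalfLine J) (T : ℝ ≃o ℝ) {c : ℝ}
    (hT : T c = 0) (t : ℝ) : T t ∈ J ↔ t - c ∈ J := by
  rcases hJ with rfl | rfl | rfl
  · simp
  · rw [mem_Ici, mem_Ici, sub_nonneg, ← T.le_iff_le (x := c), hT]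
  · rw [mem_Iic, mem_Iic, sub_nonpos, ← T.le_iff_le (x := t), hT]

/-- A positive continuous function on an interval is, near a point of the interval, the derivative
of an increasing homeomorphism of the line. -/
theorem exists_orderIso_hasDerivAt_near {R s : Set ℝ} (hR : Convex ℝ R) (hn : R.Nontrivial) {c : ℝ}
    (hc : c ∈ R) (hs : s ∈ 𝓝[R] c) {l : ℝ → ℝ} (hl : ContinuousOn l s) (hpos : ∀ t ∈ s, 0 < l t) :
    ∃ (J : Set ℝ) (T : ℝ ≃o ℝ), IsHalfLine J ∧ T c = 0 ∧ (∀ᶠ t in 𝓝 c, (t ∈ R ↔ T t ∈ J)) ∧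
      ∀ᶠ t in 𝓝[R] c, HasDerivAt T (l t) t := by
  obtain ⟨J, hJ, hRJ⟩ := hR.exists_isHalfLine hn hc
  have hsJ : ∀ᶠ t in 𝓝 c, t - c ∈ J → t ∈ s := by
    filter_upwards [hRJ, eventually_nhdsWithin_iff.mp hs] with t h1 h2 h3
    exact h2 (h1.mpr h3)
  obtain ⟨r, hr, hball⟩ := Metric.nhds_basis_closedBall.eventually_iff.mp hsJ
  -- A retraction of the line onto the compact piece K of R near c: truncate, then fold. Composing l
  -- with it gives a continuous function with a positive minimum, equal to l on R near c, which can
  -- be integrated to T.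
  set p : ℝ → ℝ := fun t => c + foldOnto J (max (-r) (min r (t - c))) with hp
  have hpc : Continuous p := continuous_const.add (hJ.continuous_foldOnto.comp (by fun_prop))
  have habs : ∀ t, |max (-r) (min r (t - c))| ≤ r := fun t =>
    abs_le.mpr ⟨le_max_left _ _, max_le (by linarith) (min_le_left _ _)⟩
  set K : Set ℝ := {t | t - c ∈ J} ∩ Metric.closedBall c r with hK
  have hpK : ∀ t, p t ∈ K := by
    intro t
    refine ⟨?_, ?_⟩
    · simp only [hp, mem_ofPred_eq, add_sub_cancel_left]
      exact hJ.foldOnto_mem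
    · simp only [hp, Metric.mem_closedBall, Real.dist_eq, add_sub_cancel_left, abs_foldOnto]
      exact habs t
  have hKs : K ⊆ s := fun t ht => hball ht.2 ht.1
  have hJc : IsClosed J := by
    rcases hJ with rfl | rfl | rfl
    · exact isClosed_univ
    · exact isClosed_Ici
    · exact isClosed_Iic
  have hKc : IsCompact K :=
    (isCompact_closedBall c r).inter_left (hJc.preimage (continuous_id.sub continuous_const))
  obtain ⟨k, hk, hmin⟩ := hKc.exists_isMinOn ⟨p c, hpK c⟩ (hl.mono hKs)
  have hlp : Continuous (l ∘ p) := (hl.mono hKs).comp_continuous hpc hpK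
  have hder : ∀ t, HasDerivAt (fun t => ∫ v in c..t, (l ∘ p) v) ((l ∘ p) t) t := fun t =>
    intervalIntegral.integral_hasDerivAt_right (hlp.intervalIntegrable _ _)
      hlp.stronglyMeasurable.stronglyMeasurableAtFilter hlp.continuousAt
  obtain ⟨T, hT⟩ := exists_orderIso_of_hasDerivAt hder (hpos k (hKs hk)) fun t => hmin (hpK t)
  have hTc : T c = 0 := by rw [hT]; simp
  refine ⟨J, T, hJ, hTc, ?_, ?_⟩
  · filter_upwards [hRJ] with t ht
    rw [ht, hJ.orderIso_mem_iff T hTc]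
  · rw [eventually_nhdsWithin_iff]
    filter_upwards [hRJ, Metric.closedBall_mem_nhds c hr] with t ht hb htR
    have hpt : p t = t := by
      rw [Metric.mem_closedBall, Real.dist_eq, abs_le] at hb
      simp only [hp]
      rw [min_eq_right hb.2, max_eq_right hb.1, foldOnto_of_mem (ht.mp htR)]
      ring
    have := hder t
    rw [← hT, Function.comp_apply, hpt] at this
    exact this

theorem BoundedVariationOn.inv_of_le {f : ℝ → ℝ} {U : Set ℝ} (hf : BoundedVariationOn f U) {m : ℝ}
    (hm : 0 < m) (h : ∀ t ∈ U, m ≤ f t) : BoundedVariationOn (fun t => (f t)⁻¹) U := by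
  have hL : LipschitzOnWith (Real.toNNReal (m⁻¹ * m⁻¹)) (fun t : ℝ => t⁻¹) (Ici m) := by
    refine LipschitzOnWith.of_dist_le_mul fun x hx y hy => ?_
    have hx' : 0 < x := lt_of_lt_of_le hm hx
    have hy' : 0 < y := lt_of_lt_of_le hm hy
    rw [Real.coe_toNNReal _ (by positivity), Real.dist_eq, Real.dist_eq,
      show x⁻¹ - y⁻¹ = (x⁻¹ * y⁻¹) * (y - x) by field_simp, abs_mul, abs_sub_comm y x,
      abs_of_pos (by positivity)]
    have hx1 : x⁻¹ ≤ m⁻¹ := inv_anti₀ hm hx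
    have hy1 : y⁻¹ ≤ m⁻¹ := inv_anti₀ hm hy
    gcongr
  exact hL.comp_boundedVariationOn h hf

/-! ### Speeds and stretching factors in charts -/

section Chart

variable {H : Type*} [TopologicalSpace H] (I : ModelWithCorners ℝ ℝ H)
  {M : Type*} [TopologicalSpace M] [ChartedSpace H M] {V : Type*} [NormedAddCommGroup V]
  [NormedSpace ℝ V]

theorem contDiffWithinAt_comp_extChartAt_symm {n : WithTop ℕ∞} [IsManifold I n M] {h : M → V}
    (hh : ContMDiff I 𝓘(ℝ, V) n h) (x : M) {w : ℝ} (hw : w ∈ (extChartAt I x).target) :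
    ContDiffWithinAt ℝ n (h ∘ (extChartAt I x).symm) (range I) w :=
  ((hh _).comp_contMDiffWithinAt w
    (contMDiffWithinAt_extChartAt_symm_range x hw)).contDiffWithinAt

theorem contDiffWithinAt_extChartAt_comp {n : WithTop ℕ∞} [IsManifold I n M] {f : M → M}
    (hf : ContMDiff I I n f) (x z : M) {w : ℝ} (hw : w ∈ (extChartAt I x).target)
    (hz : f ((extChartAt I x).symm w) ∈ (extChartAt I z).source) :
    ContDiffWithinAt ℝ n (extChartAt I z ∘ f ∘ (extChartAt I x).symm) (range I) w := by
  rw [extChartAt_source] at hz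
  exact ((contMDiffAt_extChartAt' hz).comp_contMDiffWithinAt w ((hf _).comp_contMDiffWithinAt w
    (contMDiffWithinAt_extChartAt_symm_range x hw))).contDiffWithinAt

theorem tendsto_extChartAt_comp {f : M → M} (hf : Continuous f) (x z : M) {w : ℝ}
    (hw : w ∈ (extChartAt I x).target)
    (hz : f ((extChartAt I x).symm w) ∈ (extChartAt I z).source) :
    Tendsto (extChartAt I z ∘ f ∘ (extChartAt I x).symm) (𝓝[range I] w)
      (𝓝[range I] (extChartAt I z (f ((extChartAt I x).symm w)))) := by
  refine tendsto_nhdsWithin_iff.mpr ⟨?_, Eventually.of_forall fun t => ⟨_, rfl⟩⟩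
  have h1 : ContinuousWithinAt (extChartAt I x).symm (range I) w :=
    (continuousOn_extChartAt_symm x w hw).mono_of_mem_nhdsWithin
      (extChartAt_target_mem_nhdsWithin_of_mem hw)
  exact (continuousAt_extChartAt' hz).tendsto.comp
    (hf.continuousAt.tendsto.comp h1)

theorem eventually_comp_mem_source {f : M → M} (hf : Continuous f) (x z : M) {w : ℝ}
    (hw : w ∈ (extChartAt I x).target)
    (hz : f ((extChartAt I x).symm w) ∈ (extChartAt I z).source) :
    ∀ᶠ t in 𝓝[range I] w, f ((extChartAt I x).symm t) ∈ (extChartAt I z).source := by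
  have h1 : ContinuousWithinAt (extChartAt I x).symm (range I) w :=
    (continuousOn_extChartAt_symm x w hw).mono_of_mem_nhdsWithin
      (extChartAt_target_mem_nhdsWithin_of_mem hw)
  exact (hf.continuousAt.tendsto.comp h1).eventually ((isOpen_extChartAt_source z).mem_nhds hz)

/-- The chain rule in charts. -/
theorem derivWithin_comp_extChartAt_symm [IsManifold I 1 M] {h : M → V} {f : M → M}
    (hh : ContMDiff I 𝓘(ℝ, V) 1 h) (hf : ContMDiff I I 1 f) (x z : M) {w : ℝ}
    (hw : w ∈ (extChartAt I x).target)
    (hz : f ((extChartAt I x).symm w) ∈ (extChartAt I z).source) :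
    derivWithin (h ∘ f ∘ (extChartAt I x).symm) (range I) w =
      derivWithin (extChartAt I z ∘ f ∘ (extChartAt I x).symm) (range I) w •
        derivWithin (h ∘ (extChartAt I z).symm) (range I)
          (extChartAt I z (f ((extChartAt I x).symm w))) := by
  have hwR : w ∈ range I := extChartAt_target_subset_range x hw
  have heq : h ∘ f ∘ (extChartAt I x).symm =ᶠ[𝓝[range I] w]
      (h ∘ (extChartAt I z).symm) ∘ (extChartAt I z ∘ f ∘ (extChartAt I x).symm) := by
    filter_upwards [eventually_comp_mem_source I hf.continuous x z hw hz] with t ht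
    simp only [Function.comp_apply, (extChartAt I z).left_inv ht]
  rw [heq.derivWithin_eq_of_mem hwR]
  exact derivWithin.scomp w
    ((contDiffWithinAt_comp_extChartAt_symm I hh z
      ((extChartAt I z).map_source hz)).differentiableWithinAt one_ne_zero)
    ((contDiffWithinAt_extChartAt_comp I hf x z hw hz).differentiableWithinAt one_ne_zero)
    (fun t _ => ⟨_, rfl⟩)

/-- The speed of the curve `h` read in the chart at `x`. -/
noncomputable def chartSpeed (h : M → V) (x : M) (w : ℝ) : ℝ :=
  ‖derivWithin (h ∘ (extChartAt I x).symm) (range I) w‖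

/-- The factor by which `g` stretches the metric induced by `e`. -/
noncomputable def stretchFactor (e : M → V) (g : M → M) (x : M) : ℝ :=
  chartSpeed I (e ∘ g) x (extChartAt I x x) / chartSpeed I e x (extChartAt I x x)

variable {I}

theorem chartSpeed_comp [IsManifold I 1 M] {h : M → V} {f : M → M}
    (hh : ContMDiff I 𝓘(ℝ, V) 1 h) (hf : ContMDiff I I 1 f) (x z : M) {w : ℝ}
    (hw : w ∈ (extChartAt I x).target)
    (hz : f ((extChartAt I x).symm w) ∈ (extChartAt I z).source) :
    chartSpeed I (h ∘ f) x w =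
      |derivWithin (extChartAt I z ∘ f ∘ (extChartAt I x).symm) (range I) w| *
        chartSpeed I h z (extChartAt I z (f ((extChartAt I x).symm w))) := by
  unfold chartSpeed
  rw [Function.comp_assoc, derivWithin_comp_extChartAt_symm I hh hf x z hw hz, norm_smul,
    Real.norm_eq_abs]

/-- The factor relating the two charts does not depend on h. -/
theorem chartSpeed_change [IsManifold I 1 M] {h : M → V} (hh : ContMDiff I 𝓘(ℝ, V) 1 h) (x : M)
    {w : ℝ} (hw : w ∈ (extChartAt I x).target) :
    chartSpeed I h ((extChartAt I x).symm w)
        (extChartAt I ((extChartAt I x).symm w) ((extChartAt I x).symm w)) =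
      |derivWithin (extChartAt I x ∘ (extChartAt I ((extChartAt I x).symm w)).symm) (range I)
        (extChartAt I ((extChartAt I x).symm w) ((extChartAt I x).symm w))| *
        chartSpeed I h x w := by
  have := chartSpeed_comp hh contMDiff_id ((extChartAt I x).symm w) x
    (mem_extChartAt_target (I := I) ((extChartAt I x).symm w))
    (by simpa using (extChartAt I x).map_target hw)
  simp only [Function.comp_id, Function.id_comp, extChartAt_to_inv, id_eq] at this
  rwa [(extChartAt I x).right_inv hw] at this

theorem continuousWithinAt_chartSpeed [IsManifold I 1 M] {h : M → V}
    (hh : ContMDiff I 𝓘(ℝ, V) 1 h) (x : M) {w : ℝ} (hw : w ∈ (extChartAt I x).target) :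
    ContinuousWithinAt (chartSpeed I h x) (range I) w := by
  have := (contDiffWithinAt_comp_extChartAt_symm I hh x hw).continuousWithinAt_fderivWithin
    I.uniqueDiffOn one_ne_zero (extChartAt_target_subset_range x hw)
  exact (this.clm_apply continuousWithinAt_const).norm

theorem stretchFactor_id {e : M → V} (himm : ∀ x, chartSpeed I e x (extChartAt I x x) ≠ 0)
    (x : M) : stretchFactor I e id x = 1 :=
  div_self (himm x)

section Immersion

variable [IsManifold I 1 M] {e : M → V}

theorem chartSpeed_pos (he : ContMDiff I 𝓘(ℝ, V) 1 e)
    (himm : ∀ x, chartSpeed I e x (extChartAt I x x) ≠ 0) (x : M) {w : ℝ}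
    (hw : w ∈ (extChartAt I x).target) : 0 < chartSpeed I e x w := by
  have h := himm ((extChartAt I x).symm w)
  rw [chartSpeed_change he x hw] at h
  exact lt_of_le_of_ne (norm_nonneg _) (right_ne_zero_of_mul h).symm

/-- The change of chart cancels in the quotient, so one fixed chart computes the factor at all
nearby points; its continuity and variation can be examined there. -/
theorem stretchFactor_symm (he : ContMDiff I 𝓘(ℝ, V) 1 e)
    (himm : ∀ x, chartSpeed I e x (extChartAt I x x) ≠ 0) {g : M → M} (hg : ContMDiff I I 1 g)
    (x : M) {w : ℝ} (hw : w ∈ (extChartAt I x).target) :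
    stretchFactor I e g ((extChartAt I x).symm w) =
      chartSpeed I (e ∘ g) x w / chartSpeed I e x w := by
  have h := himm ((extChartAt I x).symm w)
  rw [chartSpeed_change he x hw] at h
  unfold stretchFactor
  rw [chartSpeed_change he x hw, chartSpeed_change (he.comp hg) x hw,
    mul_div_mul_left _ _ (left_ne_zero_of_mul h)]

theorem abs_derivWithin_mul_chartSpeed (he : ContMDiff I 𝓘(ℝ, V) 1 e)
    (himm : ∀ x, chartSpeed I e x (extChartAt I x x) ≠ 0) {g : M → M} (hg : ContMDiff I I 1 g)
    (x z : M) {w : ℝ} (hw : w ∈ (extChartAt I x).target)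
    (hz : g ((extChartAt I x).symm w) ∈ (extChartAt I z).source) :
    |derivWithin (extChartAt I z ∘ g ∘ (extChartAt I x).symm) (range I) w| *
        chartSpeed I e z (extChartAt I z (g ((extChartAt I x).symm w))) =
      stretchFactor I e g ((extChartAt I x).symm w) * chartSpeed I e x w := by
  rw [stretchFactor_symm he himm hg x hw, div_mul_cancel₀ _ (chartSpeed_pos he himm x hw).ne',
    chartSpeed_comp he hg x z hw hz]

theorem stretchFactor_comp (he : ContMDiff I 𝓘(ℝ, V) 1 e)
    (himm : ∀ x, chartSpeed I e x (extChartAt I x x) ≠ 0) {g h : M → M} (hg : ContMDiff I I 1 g)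
    (hh : ContMDiff I I 1 h) (x : M) :
    stretchFactor I e (g ∘ h) x = stretchFactor I e g (h x) * stretchFactor I e h x := by
  have hw := mem_extChartAt_target (I := I) x
  have hz : h ((extChartAt I x).symm (extChartAt I x x)) ∈ (extChartAt I (h x)).source := by simp
  unfold stretchFactor
  rw [← Function.comp_assoc, chartSpeed_comp (he.comp hg) hh x (h x) hw hz,
    chartSpeed_comp he hh x (h x) hw hz]
  simp only [extChartAt_to_inv]
  have := himm (h x)
  field_simp

theorem continuous_stretchFactor (he : ContMDiff I 𝓘(ℝ, V) 1 e)
    (himm : ∀ x, chartSpeed I e x (extChartAt I x x) ≠ 0) {g : M → M} (hg : ContMDiff I I 1 g) :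
    Continuous (stretchFactor I e g) := by
  refine continuous_iff_continuousAt.mpr fun x => ?_
  have hw := mem_extChartAt_target (I := I) x
  have h1 : ContinuousWithinAt (fun w => chartSpeed I (e ∘ g) x w / chartSpeed I e x w) (range I)
      (extChartAt I x x) :=
    (continuousWithinAt_chartSpeed (he.comp hg) x hw).div (continuousWithinAt_chartSpeed he x hw)
      (himm x)
  have h2 : Tendsto (extChartAt I x) (𝓝 x) (𝓝[range I] (extChartAt I x x)) :=
    tendsto_nhdsWithin_iff.mpr ⟨continuousAt_extChartAt x, Eventually.of_forall fun t => ⟨_, rfl⟩⟩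
  refine ContinuousAt.congr (f := fun y => chartSpeed I (e ∘ g) x (extChartAt I x y) /
    chartSpeed I e x (extChartAt I x y)) (h1.tendsto.comp h2) ?_
  filter_upwards [extChartAt_source_mem_nhds (I := I) x] with y hy
  have := stretchFactor_symm he himm hg x ((extChartAt I x).map_source hy)
  rw [(extChartAt I x).left_inv hy] at this
  exact this.symm

end Immersion

/-- The speed of a smooth curve has bounded variation locally. -/
theorem exists_boundedVariationOn_chartSpeed [IsManifold I 2 M] {e : M → V}
    (he : ContMDiff I 𝓘(ℝ, V) 2 e) (x : M) {w : ℝ} (hw : w ∈ (extChartAt I x).target) :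
    ∃ U ∈ 𝓝[range I] w, BoundedVariationOn (chartSpeed I e x) U := by
  have hwR := extChartAt_target_subset_range x hw
  have h1 : ContDiffWithinAt ℝ 1 (fderivWithin ℝ (e ∘ (extChartAt I x).symm) (range I))
      (range I) w :=
    (contDiffWithinAt_comp_extChartAt_symm I he x hw).fderivWithin_right I.uniqueDiffOn
      (by norm_num) hwR
  have h2 : ContDiffWithinAt ℝ 1 (derivWithin (e ∘ (extChartAt I x).symm) (range I)) (range I) w :=
    h1.clm_apply contDiffWithinAt_const
  obtain ⟨K, U, hU, hL⟩ := h2.exists_lipschitzOnWith I.convex_range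
  refine ⟨U ∩ Metric.closedBall w 1, inter_mem hU
    (mem_nhdsWithin_of_mem_nhds (Metric.closedBall_mem_nhds w one_pos)), ?_⟩
  have h3 : LipschitzOnWith (1 * K) (chartSpeed I e x) U :=
    lipschitzWith_one_norm.comp_lipschitzOnWith hL
  have h4 : BoundedVariationOn (id : ℝ → ℝ) (U ∩ Metric.closedBall w 1) := by
    rw [Real.closedBall_eq_Icc]
    exact ((monotone_id.monotoneOn univ).locallyBoundedVariationOn (w - 1) (w + 1) trivial
      trivial).mono fun t ht => ⟨trivial, ht.2⟩
  exact h3.comp_boundedVariationOn (f := chartSpeed I e x) (g := id) (fun t ht => ht.1) h4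

end Chart

/-! ### Arc length coordinates from an immersion -/

section ChartAtlas

variable {H : Type*} [TopologicalSpace H] {I : ModelWithCorners ℝ ℝ H}
  {M : Type*} [TopologicalSpace M] [ChartedSpace H M] {V : Type*} [NormedAddCommGroup V]
  [NormedSpace ℝ V]

theorem ModelWithCorners.nontrivial_range (I : ModelWithCorners ℝ ℝ H) :
    (range I).Nontrivial := by
  obtain ⟨a, ha⟩ := I.nonempty_interior
  exact (infinite_of_mem_nhds a (mem_interior_iff_mem_nhds.mp ha)).nontrivial

variable (I) in
/-- The straightening `T` of the chart at `x` by arc length, onto a neighbourhood of the origin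
in `J`. -/
structure IsStraightening (e : M → V) (x : M) (J : Set ℝ) (T : ℝ ≃o ℝ) : Prop where
  shape : IsHalfLine J
  zero : T (extChartAt I x x) = 0
  mem_iff : ∀ᶠ t in 𝓝 (extChartAt I x x), (t ∈ range I ↔ T t ∈ J)
  hasDerivAt : ∀ᶠ t in 𝓝[range I] (extChartAt I x x), HasDerivAt T (chartSpeed I e x t) t

theorem exists_isStraightening [IsManifold I 1 M] {e : M → V} (he : ContMDiff I 𝓘(ℝ, V) 1 e)
    (himm : ∀ x, chartSpeed I e x (extChartAt I x x) ≠ 0) (x : M) :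
    ∃ J T, IsStraightening I e x J T := by
  obtain ⟨J, T, h1, h2, h3, h4⟩ := exists_orderIso_hasDerivAt_near I.convex_range
    I.nontrivial_range (OneManifold.extChartAt_self_mem_range x)
    (extChartAt_target_mem_nhdsWithin (I := I) x) (l := chartSpeed I e x)
    (fun w hw => (continuousWithinAt_chartSpeed he x hw).mono (extChartAt_target_subset_range x))
    fun w hw => chartSpeed_pos he himm x hw
  exact ⟨J, T, h1, h2, h3, h4⟩

namespace IsStraightening

variable {e : M → V} {x : M} {J : Set ℝ} {T : ℝ ≃o ℝ}

theorem symm_zero (h : IsStraightening I e x J T) : T.symm 0 = extChartAt I x x := by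
  rw [← h.zero, T.symm_apply_apply]

theorem tendsto_symm (h : IsStraightening I e x J T) :
    Tendsto T.symm (𝓝[J] 0) (𝓝[range I] (extChartAt I x x)) := by
  have h1 : Tendsto T.symm (𝓝 0) (𝓝 (extChartAt I x x)) := by
    rw [← h.symm_zero]
    exact T.symm.continuous.tendsto 0
  refine tendsto_nhdsWithin_iff.mpr ⟨h1.mono_left nhdsWithin_le_nhds, ?_⟩
  filter_upwards [nhdsWithin_le_nhds (h1.eventually h.mem_iff), self_mem_nhdsWithin] with s hs hJ
  rw [hs, T.apply_symm_apply]
  exact hJ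

theorem tendsto_chart (h : IsStraightening I e x J T) :
    Tendsto (fun y => T (extChartAt I x y)) (𝓝 x) (𝓝[J] 0) := by
  have h1 : Tendsto (fun y => T (extChartAt I x y)) (𝓝 x) (𝓝 0) := by
    rw [← h.zero]
    exact (T.continuous.tendsto _).comp (continuousAt_extChartAt x).tendsto
  refine tendsto_nhdsWithin_iff.mpr ⟨h1, ?_⟩
  filter_upwards [(continuousAt_extChartAt (I := I) x).tendsto.eventually h.mem_iff] with y hy
  exact hy.mp ⟨_, rfl⟩

theorem eventually_mem_target (h : IsStraightening I e x J T) :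
    ∀ᶠ s in 𝓝[J] 0, T.symm s ∈ (extChartAt I x).target :=
  h.tendsto_symm.eventually (extChartAt_target_mem_nhdsWithin x)

theorem eventually_hasDerivAt_symm [IsManifold I 1 M] (h : IsStraightening I e x J T)
    (he : ContMDiff I 𝓘(ℝ, V) 1 e) (himm : ∀ x, chartSpeed I e x (extChartAt I x x) ≠ 0) :
    ∀ᶠ s in 𝓝[J] 0, HasDerivAt T.symm (chartSpeed I e x (T.symm s))⁻¹ s := by
  filter_upwards [h.tendsto_symm.eventually h.hasDerivAt, h.eventually_mem_target] with s hs ht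
  exact HasDerivAt.of_local_left_inverse T.symm.continuous.continuousAt hs
    (chartSpeed_pos he himm x ht).ne' (Eventually.of_forall T.apply_symm_apply)

theorem continuousWithinAt_symm (h : IsStraightening I e x J T) :
    ∀ᶠ s in 𝓝[J] 0, ContinuousWithinAt (fun s => (extChartAt I x).symm (T.symm s)) J s := by
  filter_upwards [eventually_eventually_nhdsWithin.mpr h.eventually_mem_target,
    h.eventually_mem_target] with s hs hs'
  exact (continuousOn_extChartAt_symm x _ hs').tendsto.comp
    (tendsto_nhdsWithin_iff.mpr ⟨T.symm.continuous.continuousAt.mono_left nhdsWithin_le_nhds, hs⟩)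

/-- Between arc length coordinates, g has derivative equal to the stretching factor up to sign. The
sign is locally constant because the derivative in charts is continuous and nonzero; integrate. -/
theorem transition [IsManifold I 1 M] {J : M → Set ℝ} {T : M → ℝ ≃o ℝ}
    (h : ∀ x, IsStraightening I e x (J x) (T x)) (he : ContMDiff I 𝓘(ℝ, V) 1 e)
    (himm : ∀ x, chartSpeed I e x (extChartAt I x x) ≠ 0) {g : M → M} (hg : ContMDiff I I 1 g)
    (hgpos : ∀ x, 0 < stretchFactor I e g x) (x : M) :
    ∀ᶠ s in 𝓝[J x] 0, ∃ κ, IsSign κ ∧ ∀ᶠ r in 𝓝[J x] s,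
      T (g ((extChartAt I x).symm ((T x).symm s)))
        (extChartAt I (g ((extChartAt I x).symm ((T x).symm s)))
          (g ((extChartAt I x).symm ((T x).symm r)))) =
      κ * ∫ v in s..r, stretchFactor I e g ((extChartAt I x).symm ((T x).symm v)) := by
  have hN := (h x).eventually_mem_target.and
    (((h x).eventually_hasDerivAt_symm he himm).and (h x).continuousWithinAt_symm)
  filter_upwards [hN, eventually_eventually_nhdsWithin.mpr hN, self_mem_nhdsWithin]
    with s ⟨hst, _⟩ hs hsJ
  set z := g ((extChartAt I x).symm ((T x).symm s)) with hz
  set G := extChartAt I z ∘ g ∘ (extChartAt I x).symm with hG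
  set w₀ := (T x).symm s with hw₀
  have hR₀ : w₀ ∈ range I := extChartAt_target_subset_range x hst
  have hzs : g ((extChartAt I x).symm w₀) ∈ (extChartAt I z).source := mem_extChartAt_source z
  have hGt : Tendsto G (𝓝[range I] w₀) (𝓝[range I] (extChartAt I z z)) :=
    tendsto_extChartAt_comp I hg.continuous x z hst hzs
  have hGd : ContDiffWithinAt ℝ 1 G (range I) w₀ :=
    contDiffWithinAt_extChartAt_comp I hg x z hst hzs
  have hGc : ContinuousWithinAt (derivWithin G (range I)) (range I) w₀ :=
    (hGd.continuousWithinAt_fderivWithin I.uniqueDiffOn one_ne_zero hR₀).clm_apply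
      continuousWithinAt_const
  have hG0 : derivWithin G (range I) w₀ ≠ 0 := by
    intro h0
    have := abs_derivWithin_mul_chartSpeed he himm hg x z hst hzs
    rw [h0, abs_zero, zero_mul] at this
    exact (mul_pos (hgpos _) (chartSpeed_pos he himm x hst)).ne this
  obtain ⟨κ, hκ, hsign⟩ : ∃ κ, IsSign κ ∧ ∀ᶠ w in 𝓝[range I] w₀,
      derivWithin G (range I) w = κ * |derivWithin G (range I) w| := by
    rcases lt_or_gt_of_ne hG0 with hlt | hgt
    · refine ⟨-1, Or.inr rfl, ?_⟩
      filter_upwards [hGc.tendsto.eventually (gt_mem_nhds hlt)] with w hw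
      rw [abs_of_neg hw]
      ring
    · refine ⟨1, Or.inl rfl, ?_⟩
      filter_upwards [hGc.tendsto.eventually (lt_mem_nhds hgt)] with w hw
      rw [abs_of_pos hw, one_mul]
  refine ⟨κ, hκ, ?_⟩
  have hdiff : ∀ᶠ w in 𝓝[range I] w₀, DifferentiableWithinAt ℝ G (range I) w := by
    have := hGd.eventually (by simp)
    rw [insert_eq_of_mem hR₀] at this
    exact this.mono fun w hw => hw.differentiableWithinAt one_ne_zero
  have hw := hsign.and (hdiff.and ((hGt.eventually (h z).hasDerivAt).and
    (eventually_comp_mem_source I hg.continuous x z hst hzs)))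
  have hTt : Tendsto (T x).symm (𝓝[J x] s) (𝓝[range I] w₀) :=
    tendsto_nhdsWithin_iff.mpr ⟨(T x).symm.continuous.continuousAt.mono_left nhdsWithin_le_nhds,
      hs.mono fun r hr => extChartAt_target_subset_range x hr.1⟩
  obtain ⟨δ, hδ, hball⟩ := Metric.mem_nhdsWithin_iff.mp (hs.and (hTt.eventually hw))
  set B := Metric.ball s δ ∩ J x with hB
  have hBord : B.OrdConnected :=
    (convex_ball s δ).ordConnected.inter (h x).shape.ordConnected
  have hder : ∀ v ∈ B, HasDerivWithinAt (fun r => T z (G ((T x).symm r)))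
      (κ * stretchFactor I e g ((extChartAt I x).symm ((T x).symm v))) B v := by
    intro v hv
    obtain ⟨⟨hvt, hvd, _⟩, hvs, hvdiff, hvT, hvz⟩ := hball hv
    have h1 : HasDerivWithinAt (G ∘ (T x).symm) (derivWithin G (range I) ((T x).symm v) *
        (chartSpeed I e x ((T x).symm v))⁻¹) B v :=
      hvdiff.hasDerivWithinAt.comp v hvd.hasDerivWithinAt
        fun r hr => extChartAt_target_subset_range x (hball hr).1.1
    have h2 := hvT.comp_hasDerivWithinAt v h1
    have h3 : |derivWithin G (range I) ((T x).symm v)| * chartSpeed I e z (G ((T x).symm v)) =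
        stretchFactor I e g ((extChartAt I x).symm ((T x).symm v)) *
          chartSpeed I e x ((T x).symm v) :=
      abs_derivWithin_mul_chartSpeed he himm hg x z hvt hvz
    have h4 := mul_inv_cancel₀ (chartSpeed_pos he himm x hvt).ne'
    refine h2.congr_deriv ?_
    rw [hvs]
    linear_combination κ * (chartSpeed I e x ((T x).symm v))⁻¹ * h3 +
      κ * stretchFactor I e g ((extChartAt I x).symm ((T x).symm v)) * h4
  have hcont : ContinuousOn
      (fun v => stretchFactor I e g ((extChartAt I x).symm ((T x).symm v))) B := fun v hv =>
    (continuous_stretchFactor he himm hg).continuousAt.comp_continuousWithinAt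
      ((hball hv).1.2.2.mono inter_subset_right)
  have hsB : s ∈ B := ⟨Metric.mem_ball_self hδ, hsJ⟩
  filter_upwards [inter_mem (mem_nhdsWithin_of_mem_nhds (Metric.ball_mem_nhds s hδ))
    self_mem_nhdsWithin] with r hr
  have hsub : uIcc s r ⊆ B := hBord.uIcc_subset hsB hr
  have hint := intervalIntegral.integral_eq_sub_of_hasDeriv_right
    (fun v hv => ((hder v (hsub hv)).continuousWithinAt.mono hsub))
    (fun v hv => ((hder v (hsub ⟨hv.1.le, hv.2.le⟩)).hasDerivAt
      (mem_of_superset (Ioo_mem_nhds hv.1 hv.2)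
        ((Ioo_subset_Icc_self).trans hsub))).hasDerivWithinAt)
    ((hcont.mono hsub).const_mul κ).intervalIntegrable
  rw [intervalIntegral.integral_const_mul] at hint
  rw [hint]
  have h0 : T z (G ((T x).symm s)) = 0 := (h z).zero
  rw [h0, sub_zero]
  rfl

/-- In charts the factor is the absolute derivative of g times the speed at the image divided by the
speed at the point. The first has bounded variation by hypothesis, the speeds because the immersion
is C². The monotone chart expression of g and the monotone T.symm preserve bounded variation under
composition. -/
theorem bv [IsManifold I 2 M] {J : Set ℝ} {T : ℝ ≃o ℝ}
    (h : IsStraightening I e x J T) (he : ContMDiff I 𝓘(ℝ, V) 2 e)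
    (himm : ∀ x, chartSpeed I e x (extChartAt I x x) ≠ 0) {g : M → M} (hg : ContMDiff I I 1 g)
    (hgpos : ∀ x, 0 < stretchFactor I e g x) (hbv : OneManifold.HasBVDerivative I g) :
    ∃ U ∈ 𝓝[J] (0 : ℝ), BoundedVariationOn
      (fun s => stretchFactor I e g ((extChartAt I x).symm (T.symm s))) U := by
  let _ : IsManifold I 1 M := IsManifold.of_le (n := 2) (by norm_num)
  have he1 : ContMDiff I 𝓘(ℝ, V) 1 e := he.of_le (by norm_num)
  set c := extChartAt I x x with hc
  have hct : c ∈ (extChartAt I x).target := mem_extChartAt_target x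
  have hcR : c ∈ range I := OneManifold.extChartAt_self_mem_range x
  set G := extChartAt I (g x) ∘ g ∘ (extChartAt I x).symm with hG
  have hzs : g ((extChartAt I x).symm c) ∈ (extChartAt I (g x)).source := by simp [hc]
  have hGd : ContDiffWithinAt ℝ 1 G (range I) c :=
    contDiffWithinAt_extChartAt_comp I hg x (g x) hct hzs
  have hGcc : G c = extChartAt I (g x) (g x) := by simp [hG, hc]
  have hG0 : derivWithin G (range I) c ≠ 0 := by
    intro h0
    have := abs_derivWithin_mul_chartSpeed he1 himm hg x (g x) hct hzs
    rw [h0, abs_zero, zero_mul] at this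
    exact (mul_pos (hgpos _) (chartSpeed_pos he1 himm x hct)).ne this
  obtain ⟨U₁, hU₁, b₁⟩ := hbv x
  obtain ⟨U₂, hU₂, b₂⟩ := exists_boundedVariationOn_chartSpeed he (g x)
    (mem_extChartAt_target (I := I) (g x))
  rw [← hGcc] at hU₂
  obtain ⟨U₂', hU₂', b₂'⟩ := OneManifold.bv_comp_nhd I.convex_range I.uniqueDiffOn hcR hGd hG0
    (fun t => ⟨_, rfl⟩) hU₂ b₂
  obtain ⟨U₃, hU₃, b₃⟩ := exists_boundedVariationOn_chartSpeed he x hct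
  have hpos := chartSpeed_pos he1 himm x hct
  have hlow : ∀ᶠ w in 𝓝[range I] c, chartSpeed I e x c / 2 < chartSpeed I e x w :=
    (continuousWithinAt_chartSpeed he1 x hct).tendsto.eventually (lt_mem_nhds (half_lt_self hpos))
  have heq : ∀ᶠ w in 𝓝[range I] c, stretchFactor I e g ((extChartAt I x).symm w) =
      |derivWithin G (range I) w| * chartSpeed I e (g x) (G w) * (chartSpeed I e x w)⁻¹ := by
    filter_upwards [extChartAt_target_mem_nhdsWithin (I := I) x,
      eventually_comp_mem_source I hg.continuous x (g x) hct hzs] with w hw hwz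
    rw [hG, Function.comp_apply, Function.comp_apply,
      abs_derivWithin_mul_chartSpeed he1 himm hg x (g x) hw hwz,
      mul_inv_cancel_right₀ (chartSpeed_pos he1 himm x hw).ne']
  set W : Set ℝ := U₁ ∩ (U₂' ∩ (U₃ ∩ {w | chartSpeed I e x c / 2 < chartSpeed I e x w ∧
    stretchFactor I e g ((extChartAt I x).symm w) =
      |derivWithin G (range I) w| * chartSpeed I e (g x) (G w) * (chartSpeed I e x w)⁻¹})) with hW
  have hWn : W ∈ 𝓝[range I] c :=
    inter_mem hU₁ (inter_mem hU₂' (inter_mem hU₃ (hlow.and heq)))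
  have b₁' : BoundedVariationOn (derivWithin G (range I)) W := b₁.mono inter_subset_left
  have habs : LipschitzOnWith 1 (fun t : ℝ => |t|) univ :=
    (lipschitzWith_one_norm (E := ℝ)).lipschitzOnWith
  have c₁ : BoundedVariationOn (fun w => |derivWithin G (range I) w|) W :=
    habs.comp_boundedVariationOn (g := derivWithin G (range I)) (fun t _ => trivial) b₁'
  have c₂ : BoundedVariationOn (fun w => chartSpeed I e (g x) (G w)) W :=
    b₂'.mono fun w hw => hw.2.1
  have c₃ : BoundedVariationOn (fun w => (chartSpeed I e x w)⁻¹) W :=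
    (b₃.mono fun w hw => hw.2.2.1).inv_of_le (half_pos hpos) fun w hw => hw.2.2.2.1.le
  have c₄ : BoundedVariationOn (fun w => stretchFactor I e g ((extChartAt I x).symm w)) W := by
    have c₅ := (c₁.mul c₂).mul c₃
    have hEq : EqOn (fun w => stretchFactor I e g ((extChartAt I x).symm w))
      ((fun w => |derivWithin G (range I) w|) * (fun w => chartSpeed I e (g x) (G w)) *
        fun w => (chartSpeed I e x w)⁻¹) W := fun w hw => hw.2.2.2.2
    rw [BoundedVariationOn, eVariationOn.congr hEq]
    exact c₅
  refine ⟨T.symm ⁻¹' W, h.tendsto_symm hWn, ne_top_of_le_ne_top c₄ ?_⟩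
  exact eVariationOn.comp_le_of_monotoneOn
    (fun w => stretchFactor I e g ((extChartAt I x).symm w)) T.symm
    (T.symm.monotone.monotoneOn _) fun t ht => ht

end IsStraightening

/-- A one-manifold with an immersion carries an atlas by arc length. -/
theorem exists_isArcAtlas [IsManifold I 2 M] {e : M → V} (he : ContMDiff I 𝓘(ℝ, V) 2 e)
    (himm : ∀ x, chartSpeed I e x (extChartAt I x x) ≠ 0) {G : Type*} [Group G] [MulAction G M]
    (hG : ∀ g : G, ContMDiff I I 1 fun x : M => g • x)
    (hbv : ∀ g : G, OneManifold.HasBVDerivative I fun x : M => g • x) :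
    ∃ (J : M → Set ℝ) (ψ : M → ℝ → M) (S : M → M → ℝ) (D : G → M → ℝ), IsArcAtlas J ψ S D := by
  let _ : IsManifold I 1 M := IsManifold.of_le (n := 2) (by norm_num)
  have he1 : ContMDiff I 𝓘(ℝ, V) 1 e := he.of_le (by norm_num)
  have hex := exists_isStraightening he1 himm
  choose J T hT using hex
  have hmul : ∀ (g h : G) (x : M), stretchFactor I e (fun x : M => (g * h) • x) x =
      stretchFactor I e (fun x : M => g • x) (h • x) * stretchFactor I e (fun x : M => h • x) x := by
    intro g h x
    rw [← stretchFactor_comp he1 himm (hG g) (hG h)]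
    exact congrArg (fun f => stretchFactor I e f x) (funext fun y => mul_smul g h y)
  -- A quotient of norms is nonnegative, and the cocycle identity for g⁻¹g shows that it does not
  -- vanish.
  have hpos : ∀ (g : G) (x : M), 0 < stretchFactor I e (fun x : M => g • x) x := by
    intro g x
    have h1 := hmul g⁻¹ g x
    simp only [inv_mul_cancel, one_smul] at h1
    have h2 : stretchFactor I e (fun x : M => x) x = 1 := stretchFactor_id himm x
    rw [h2] at h1
    exact lt_of_le_of_ne (div_nonneg (norm_nonneg _) (norm_nonneg _))
      (right_ne_zero_of_mul_eq_one h1.symm).symm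
  refine ⟨J, fun x s => (extChartAt I x).symm ((T x).symm s), fun x y => T x (extChartAt I x y),
    fun g => stretchFactor I e fun x : M => g • x, ?_⟩
  refine ⟨fun x => (hT x).shape, fun x => ?_, fun x => ?_, fun x => ?_, fun x => ?_,
    fun x => (hT x).continuousWithinAt_symm,
    fun g x => IsStraightening.transition hT he1 himm (hG g) (hpos g) x,
    fun g => (hG g).continuous, fun g => continuous_stretchFactor he1 himm (hG g), hpos, hmul,
    fun g x => (hT x).bv he himm (hG g) (hpos g) (hbv g)⟩
  · simp only [(hT x).symm_zero, extChartAt_to_inv]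
  · filter_upwards [extChartAt_source_mem_nhds (I := I) x,
      (hT x).tendsto_chart.eventually self_mem_nhdsWithin] with y hy hyJ
    exact ⟨by rw [(T x).symm_apply_apply, (extChartAt I x).left_inv hy], hyJ⟩
  · filter_upwards [(hT x).eventually_mem_target] with s hs
    rw [(extChartAt I x).right_inv hs, (T x).apply_symm_apply]
  · exact (T x).continuous.continuousAt.comp (continuousAt_extChartAt x)

end ChartAtlas
-- The action of the diffeomorphism group and the conclusion
namespace OneManifold

section Action

variable {H : Type*} [TopologicalSpace H] {I : ModelWithCorners ℝ ℝ H}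
  {M : Type*} [TopologicalSpace M] [ChartedSpace H M] [IsManifold I 1 M]

/-- The action of the diffeomorphisms of class `C^{1+bv}` on the manifold. -/
noncomputable instance diffBVAction (o : ManifoldOrientation I M) : MulAction (DiffBV o) M where
  smul f x := f.1 x
  one_smul _ := rfl
  mul_smul _ _ _ := rfl

theorem diffBV_smul_def {o : ManifoldOrientation I M} (f : DiffBV o) (x : M) : f • x = f.1 x := rfl

instance diffBV_faithfulSMul (o : ManifoldOrientation I M) : FaithfulSMul (DiffBV o) M where
  eq_of_smul_eq_smul h := Subtype.ext (Diffeomorph.ext h)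

end Action

end OneManifold

/-- A compact one-manifold embeds into a Euclidean space with nonvanishing speed. -/
theorem exists_chartSpeed_ne_zero {H : Type*} [TopologicalSpace H] (I : ModelWithCorners ℝ ℝ H)
    (M : Type*) [TopologicalSpace M] [T2Space M] [CompactSpace M] [ChartedSpace H M]
    [IsManifold I ∞ M] : ∃ (n : ℕ) (e : M → EuclideanSpace ℝ (Fin n)),
      ContMDiff I 𝓘(ℝ, EuclideanSpace ℝ (Fin n)) ∞ e ∧
        ∀ x, chartSpeed I e x (extChartAt I x x) ≠ 0 := by
  obtain ⟨n, e, he, -, himm⟩ := exists_embedding_euclidean_of_compact (I := I) (M := M)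
  refine ⟨n, e, he, fun x h0 => ?_⟩
  have hd : MDifferentiableAt I 𝓘(ℝ, EuclideanSpace ℝ (Fin n)) e x :=
    (he x).mdifferentiableAt (by simp)
  have h1 : mfderiv I 𝓘(ℝ, EuclideanSpace ℝ (Fin n)) e x (1 : ℝ) =
      derivWithin (e ∘ (extChartAt I x).symm) (range I) (extChartAt I x x) := by
    rw [hd.mfderiv]
    rfl
  rw [chartSpeed, norm_eq_zero, ← h1] at h0
  have h2 : (1 : ℝ) = 0 := himm x (h0.trans (map_zero _).symm)
  exact one_ne_zero h2

theorem theorem1p3 {H : Type*} [TopologicalSpace H] (I : ModelWithCorners ℝ ℝ H)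
    (M : Type*) [TopologicalSpace M] [T2Space M] [CompactSpace M] [ChartedSpace H M]
    [IsManifold I ∞ M] (o : OneManifold.ManifoldOrientation I M) :
    ¬ VirtuallyEmbeds (RightAngledArtinGroup (SimpleGraph.pathGraph 4))
      (OneManifold.DiffBV o) := by
  obtain ⟨n, e, he, himm⟩ := exists_chartSpeed_ne_zero I M
  obtain ⟨J, ψ, S, D, h⟩ := exists_isArcAtlas (he.of_le ENat.LEInfty.out) himm
    (G := OneManifold.DiffBV o) (fun g => g.1.contMDiff) fun g => g.2.2
  exact not_virtuallyEmbeds_of_isStretch h.isFoldedExp h.isStretch h.continuous_smul
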